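/- Let $M$ be a smooth $7$-manifold and let $\sigma$ be a closed $G_2$-structure of class $C^2$ on $M$: a closed $3$-form such that for each $p\in M$ there is a linear isomorphism $L:T_pM\to\mathbb R^7$ with $\sigma_p=L^*\sigma_{\mathbb R^7}$, where $$\sigma_{\mathbb R^7}=e^1\wedge(e^2\wedge e^3+e^4\wedge e^5+e^6\wedge e^7)+e^2\wedge(e^4\wedge e^6-e^5\wedge e^7)-e^3\wedge(e^4\wedge e^7+e^5\wedge e^6).$$ Let $*$, ${}_\sharp$, $d^*$ and $\Delta=dd^*+d^*d$ be the Hodge star, the metric duality, the codifferential and the Hodge Laplacian of the metric $L^*g_{\mathbb R^7}$ and the orientation $L^*(e^1\wedge\dots\wedge e^7)$ induced by $\sigma$. Let $\lrcorner$ be the contraction of a vector with a form, $\tau=d^*\sigma=-*d*\sigma$, $\;d^7_7\alpha=*d(\alpha\wedge*\sigma)$ for $1$-forms $\alpha$, and $\xi(\gamma)=\gamma+*(\sigma\wedge\gamma)$ for $2$-forms $\gamma$. Let $\theta$ be a closed $3$-form of class $C^2$, and write $\theta=f^0\sigma+*(f^1\wedge\sigma)+f^3$ with a function $f^0$, a $1$-form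 $f^1$ and a $3$-form $f^3$ satisfying $f^3\wedge\sigma=0$ and $f^3\wedge*\sigma=0$ (these components exist and are unique at each point). Put $$H(\theta)=*d*\left(\tfrac43 f^0\sigma+*(f^1\wedge\sigma)-f^3\right).$$ Then $$(H+*d*)\theta=\tfrac73*(df^0\wedge*\sigma)+2*(d^7_7f^1\wedge*\sigma)-2\,df^1-\tfrac23\,\xi\big(*(*\sigma\wedge*(f^1\wedge*\tau))\big)-\tfrac73f^0\tau$$ $$=\tfrac73(df^0)_\sharp\lrcorner\sigma+2(d^7_7f^1)_\sharp\lrcorner\sigma-2\,df^1-\tfrac23\,\xi\big(*(*\sigma\wedge*(f^1\wedge*\tau))\big)-\tfrac73f^0\tau,$$ and consequently $$\Delta\theta=d(H(\theta))-d\Big(\tfrac73(df^0)_\sharp\lrcorner\sigma+2(d^7_7f^1)_\sharp\lrcorner\sigma\Big)+d\Big[\tfrac73f^0\tau+\tfrac23\,\xi\big(*(*\sigma\wedge*(f^1\wedge*\tau))\big)\Big].$$ The same three formulas hold with $d^7_7f^1$ replaced by $\hat d^7_7f^1:=*(df^1\wedge*\sigma-f^1\wedge*\tau)$ and with the sign of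 each $\xi$-term reversed. -/

import Mathlib

open scoped Manifold

noncomputable section

namespace G2

/-! ### Multilinear algebra of forms -/

section Algebra

variable {V : Type*} [AddCommGroup V] [Module ℝ V] [TopologicalSpace V]

/-- The multilinear map `v ↦ α (v₁, …, v_p) * β (v_{p+1}, …, v_{p+q})`. -/
def mulForms {p q : ℕ} (α : V [⋀^Fin p]→L[ℝ] ℝ) (β : V [⋀^Fin q]→L[ℝ] ℝ) :
    ContinuousMultilinearMap ℝ (fun _ : Fin (p + q) => V) ℝ where
  toFun v := α (fun i => v (Fin.castAdd q i)) * β (fun j => v (Fin.natAdd p j))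
  map_update_add' := by
    intro inst v i x y
    have : inst = instDecidableEqFin _ := Subsingleton.elim _ _
    subst this
    refine Fin.addCases (fun i => ?_) (fun j => ?_) i
    · have h1 : ∀ z : V, (fun k => Function.update v (Fin.castAdd q i) z (Fin.castAdd q k))
          = Function.update (fun k => v (Fin.castAdd q k)) i z := by
        intro z; ext k
        by_cases hk : k = i <;> simp [hk]
      have h2 : ∀ z : V, (fun k => Function.update v (Fin.castAdd q i) z (Fin.natAdd p k))
          = (fun k => v (Fin.natAdd p k)) := by
        intro z; ext k
        rw [Function.update_of_ne]
        intro h; have := congrArg Fin.val h; simp at this; omega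
      simp only [h1, h2, ContinuousAlternatingMap.map_update_add, add_mul]
    · have h1 : ∀ z : V, (fun k => Function.update v (Fin.natAdd p j) z (Fin.natAdd p k))
          = Function.update (fun k => v (Fin.natAdd p k)) j z := by
        intro z; ext k
        by_cases hk : k = j <;> simp [hk]
      have h2 : ∀ z : V, (fun k => Function.update v (Fin.natAdd p j) z (Fin.castAdd q k))
          = (fun k => v (Fin.castAdd q k)) := by
        intro z; ext k
        rw [Function.update_of_ne]
        intro h; have := congrArg Fin.val h; simp at this; omega
      simp only [h1, h2, ContinuousAlternatingMap.map_update_add, mul_add]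
  map_update_smul' := by
    intro inst v i c x
    have : inst = instDecidableEqFin _ := Subsingleton.elim _ _
    subst this
    refine Fin.addCases (fun i => ?_) (fun j => ?_) i
    · have h1 : ∀ z : V, (fun k => Function.update v (Fin.castAdd q i) z (Fin.castAdd q k))
          = Function.update (fun k => v (Fin.castAdd q k)) i z := by
        intro z; ext k
        by_cases hk : k = i <;> simp [hk]
      have h2 : ∀ z : V, (fun k => Function.update v (Fin.castAdd q i) z (Fin.natAdd p k))
          = (fun k => v (Fin.natAdd p k)) := by
        intro z; ext k
        rw [Function.update_of_ne]
        intro h; have := congrArg Fin.val h; simp at this; omega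
      simp only [h1, h2, ContinuousAlternatingMap.map_update_smul, smul_eq_mul, mul_assoc]
    · have h1 : ∀ z : V, (fun k => Function.update v (Fin.natAdd p j) z (Fin.natAdd p k))
          = Function.update (fun k => v (Fin.natAdd p k)) j z := by
        intro z; ext k
        by_cases hk : k = j <;> simp [hk]
      have h2 : ∀ z : V, (fun k => Function.update v (Fin.natAdd p j) z (Fin.castAdd q k))
          = (fun k => v (Fin.castAdd q k)) := by
        intro z; ext k
        rw [Function.update_of_ne]
        intro h; have := congrArg Fin.val h; simp at this; omega
      simp only [h1, h2, ContinuousAlternatingMap.map_update_smul, smul_eq_mul, mul_left_comm]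
  cont := by
    refine Continuous.mul (α.cont.comp ?_) (β.cont.comp ?_) <;> fun_prop

/-- The wedge product
`(α ∧ β)(v) = 1/(p! q!) ∑_π sign(π) α(v_{π 1}, …, v_{π p}) β(v_{π (p+1)}, …, v_{π (p+q)})`. -/
def wedge {p q : ℕ} (α : V [⋀^Fin p]→L[ℝ] ℝ) (β : V [⋀^Fin q]→L[ℝ] ℝ) :
    V [⋀^Fin (p + q)]→L[ℝ] ℝ :=
  ((p.factorial : ℝ) * (q.factorial : ℝ))⁻¹ •
    ContinuousMultilinearMap.alternatization (mulForms α β)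

/-- Insertion of the vectors `a₁, …, a_k` into the first `k` slots of an `n`-form. -/
def insertVectors {k l n : ℕ} (h : k + l = n) (a : Fin k → V) (ω : V [⋀^Fin n]→L[ℝ] ℝ) :
    V [⋀^Fin l]→L[ℝ] ℝ where
  toFun v := ω (fun i => Fin.append a v (Fin.cast h.symm i))
  map_update_add' := by
    intro inst v i x y
    have : inst = instDecidableEqFin _ := Subsingleton.elim _ _
    subst this
    subst h
    have h1 : ∀ z : V, (fun j => Fin.append a (Function.update v i z) (Fin.cast rfl j))
        = Function.update (Fin.append a v) (Fin.natAdd k i) z := by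
      intro z; ext j
      refine Fin.addCases (fun j => ?_) (fun j => ?_) j
      · rw [Function.update_of_ne]
        · simp
        · intro h; have := congrArg Fin.val h; simp at this; omega
      · by_cases hj : j = i <;> simp [hj]
    simp only [h1, ContinuousAlternatingMap.map_update_add]
  map_update_smul' := by
    intro inst v i c x
    have : inst = instDecidableEqFin _ := Subsingleton.elim _ _
    subst this
    subst h
    have h1 : ∀ z : V, (fun j => Fin.append a (Function.update v i z) (Fin.cast rfl j))
        = Function.update (Fin.append a v) (Fin.natAdd k i) z := by
      intro z; ext j
      refine Fin.addCases (fun j => ?_) (fun j => ?_) j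
      · rw [Function.update_of_ne]
        · simp
        · intro h; have := congrArg Fin.val h; simp at this; omega
      · by_cases hj : j = i <;> simp [hj]
    simp only [h1, ContinuousAlternatingMap.map_update_smul]
  cont := by
    refine ω.cont.comp (continuous_pi fun i => ?_)
    refine Fin.addCases (fun j => ?_) (fun j => ?_) (Fin.cast h.symm i)
    · simpa using continuous_const
    · simpa using continuous_apply j
  map_eq_zero_of_eq' := by
    intro v i j hv hij
    subst h
    refine ω.map_eq_zero_of_eq _ (i := Fin.natAdd k i) (j := Fin.natAdd k j) ?_ ?_
    · simpa using hv
    · intro h; apply hij; ext; have := congrArg Fin.val h; simpa using this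

/-- The interior product `u ⌟ ω`. -/
def contract {k n : ℕ} (h : 1 + k = n) (u : V) (ω : V [⋀^Fin n]→L[ℝ] ℝ) :
    V [⋀^Fin k]→L[ℝ] ℝ :=
  insertVectors h (fun _ : Fin 1 => u) ω

end Algebra

/-! ### The standard structure on `ℝ⁷` -/

/-- `ℝ⁷` with its Euclidean inner product. -/
abbrev E7 : Type := EuclideanSpace ℝ (Fin 7)

/-- The standard basis vector `e_{i+1}` of `ℝ⁷` (indices are shifted to start at `0`). -/
def stdVec (i : Fin 7) : E7 := EuclideanSpace.single i 1

/-- The coordinate one-form `e^{i+1} = dx^{i+1}` on `ℝ⁷` (indices start at `0`). -/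
def dx (i : Fin 7) : E7 [⋀^Fin 1]→L[ℝ] ℝ :=
  ContinuousAlternatingMap.ofSubsingleton ℝ E7 ℝ (0 : Fin 1) (EuclideanSpace.proj i)

/-- The standard three-form
`e¹∧(e²∧e³ + e⁴∧e⁵ + e⁶∧e⁷) + e²∧(e⁴∧e⁶ - e⁵∧e⁷) - e³∧(e⁴∧e⁷ + e⁵∧e⁶)` on `ℝ⁷`. -/
def stdForm : E7 [⋀^Fin 3]→L[ℝ] ℝ :=
  (wedge (dx 0) (wedge (dx 1) (dx 2) + wedge (dx 3) (dx 4) + wedge (dx 5) (dx 6)) :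
    E7 [⋀^Fin 3]→L[ℝ] ℝ)
  + (wedge (dx 1) (wedge (dx 3) (dx 5) - wedge (dx 4) (dx 6)) : E7 [⋀^Fin 3]→L[ℝ] ℝ)
  - (wedge (dx 2) (wedge (dx 3) (dx 6) + wedge (dx 4) (dx 5)) : E7 [⋀^Fin 3]→L[ℝ] ℝ)

/-- The standard volume form `e¹ ∧ ⋯ ∧ e⁷`, i.e. `(v₁, …, v₇) ↦ det (v_i)_j`. -/
def stdVol : E7 [⋀^Fin 7]→L[ℝ] ℝ :=
  { (EuclideanSpace.basisFun (Fin 7) ℝ).toBasis.det with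
    cont := by
      change Continuous fun v : Fin 7 → E7 => (EuclideanSpace.basisFun (Fin 7) ℝ).toBasis.det v
      simp only [Module.Basis.det_apply]
      refine Continuous.matrix_det ?_
      refine continuous_matrix fun i j => ?_
      simp only [Module.Basis.toMatrix_apply, OrthonormalBasis.coe_toBasis_repr_apply,
        EuclideanSpace.basisFun_repr]
      fun_prop }

/-! ### Hodge star and musical isomorphism of the structure induced by `L : V ≃ ℝ⁷`

An isomorphism `L : V → ℝ⁷` induces on `V` the inner product `L^* g_{ℝ⁷}`, the volume form
`L^*(e¹ ∧ ⋯ ∧ e⁷)` and the oriented orthonormal basis `L⁻¹ e₁, …, L⁻¹ e₇`. -/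

section Induced

variable {V : Type*} [AddCommGroup V] [Module ℝ V] [TopologicalSpace V]

/-- The induced oriented orthonormal basis `L⁻¹ e_i`. -/
def frame (L : V ≃L[ℝ] E7) (i : Fin 7) : V := L.symm (stdVec i)

/-- The Hodge star of the induced inner product and volume form: in an oriented orthonormal
basis, `(*η)(v) = 1/k! ∑_{i₁, …, i_k} η(e_{i₁}, …, e_{i_k}) vol(e_{i₁}, …, e_{i_k}, v)`,
so that `η ∧ *η' = ⟨η, η'⟩ vol`. -/
def hodgeStar [IsTopologicalAddGroup V] [ContinuousConstSMul ℝ V]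
    (L : V ≃L[ℝ] E7) {k l : ℕ} (h : k + l = 7)
    (η : V [⋀^Fin k]→L[ℝ] ℝ) : V [⋀^Fin l]→L[ℝ] ℝ :=
  ((k.factorial : ℝ))⁻¹ • ∑ I : Fin k → Fin 7, η (fun j => frame L (I j)) •
    insertVectors h (fun j => frame L (I j)) (stdVol.compContinuousLinearMap (L : V →L[ℝ] E7))

/-- The vector `α_♯` dual to the covector `α` with respect to the induced inner product:
`α_♯ = ∑ α(e_i) e_i` in an orthonormal basis. -/
def sharp (L : V ≃L[ℝ] E7) (α : V [⋀^Fin 1]→L[ℝ] ℝ) : V :=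
  ∑ i : Fin 7, α (fun _ => frame L i) • frame L i

end Induced

/-! ### Differential forms on a 7-manifold -/

section Manifold

variable (M : Type*) [TopologicalSpace M] [ChartedSpace E7 M]

/-- Differential forms of degree `k` on `M` (no regularity is built in). -/
abbrev DForm (k : ℕ) : Type _ :=
  ∀ x : M, TangentSpace (𝓡 7) x [⋀^Fin k]→L[ℝ] ℝ

variable {M}

/-- The coordinate expression of a form in the chart at `x₀`: the pull-back of the form by the
inverse of the chart. -/
def chartRep {k : ℕ} (x₀ : M) (ω : DForm M k) (y : E7) : E7 [⋀^Fin k]→L[ℝ] ℝ :=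
  (ω ((extChartAt (𝓡 7) x₀).symm y)).compContinuousLinearMap
    (mfderiv 𝓘(ℝ, E7) (𝓡 7) (extChartAt (𝓡 7) x₀).symm y)

/-- Forms of class `C^n`: the coordinate expressions are of class `C^n`. -/
def IsClass {k : ℕ} (n : ℕ∞) (ω : DForm M k) : Prop :=
  ∀ x₀ : M, ContDiffOn ℝ n (chartRep x₀ ω) (extChartAt (𝓡 7) x₀).target

/-- The exterior derivative, computed at `x` in the chart at `x`. -/
def extD {k : ℕ} (ω : DForm M k) : DForm M (k + 1) := fun x =>
  (extDeriv (chartRep x ω) (extChartAt (𝓡 7) x x)).compContinuousLinearMap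
    (mfderiv (𝓡 7) 𝓘(ℝ, E7) (extChartAt (𝓡 7) x) x)

/-- The differential of a function, as a one-form. -/
def dFun (f : M → ℝ) : DForm M 1 := fun x =>
  ContinuousAlternatingMap.ofSubsingleton ℝ (TangentSpace (𝓡 7) x) ℝ (0 : Fin 1)
    (mfderiv (𝓡 7) 𝓘(ℝ, ℝ) f x)

/-- The wedge product of differential forms. -/
def wedgeD {p q : ℕ} (α : DForm M p) (β : DForm M q) : DForm M (p + q) := fun x =>
  wedge (α x) (β x)

variable (M)

/-- A `G₂`-structure: a three-form whose value at each point is positive, that is, of the form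
`L^* σ_{ℝ⁷}` for an isomorphism `L` from the tangent space to `ℝ⁷`. -/
structure G2Structure where
  /-- the three-form -/
  form : DForm M 3
  /-- its values are positive three-forms -/
  positive : ∀ x : M, ∃ L : TangentSpace (𝓡 7) x ≃L[ℝ] E7,
    form x = stdForm.compContinuousLinearMap (L : TangentSpace (𝓡 7) x →L[ℝ] E7)

variable {M}

namespace G2Structure

variable (σ : G2Structure M)

/-- An inducing map of `σ` at `x`. Two inducing maps differ by an element of the stabilizer `G₂` of
`σ_{ℝ⁷}`, which lies in `SO(7)`; so the induced metric, orientation, Hodge star and duality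
do not depend on the choice. -/
def inducingMap (x : M) : TangentSpace (𝓡 7) x ≃L[ℝ] E7 := (σ.positive x).choose

/-- The Hodge star of the metric and orientation induced by `σ`. -/
def star {k : ℕ} (l : ℕ) (ω : DForm M k) (h : k + l = 7 := by norm_num) : DForm M l := fun x =>
  hodgeStar (σ.inducingMap x) h (ω x)

/-- The contraction `α_♯ ⌟ σ`, with `♯` taken with respect to the metric induced by `σ`. -/
def sharpContract (α : DForm M 1) : DForm M 2 := fun x =>
  contract (by norm_num) (sharp (σ.inducingMap x) (α x)) (σ.form x)

/-- The codifferential `d^* = (-1)^p * d *` on `p`-forms, `p = k + 1`, in dimension 7. -/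
def codiff {k : ℕ} (l : ℕ) (ω : DForm M (k + 1)) (h : k + 1 + l = 7 := by norm_num) : DForm M k :=
  (-1 : ℝ) ^ (k + 1) • σ.star k (extD (σ.star l ω h)) (by omega)

/-- The Hodge Laplacian `Δ = d d^* + d^* d` on three-forms. -/
def laplacian (θ : DForm M 3) : DForm M 3 :=
  extD (σ.codiff (k := 2) 4 θ) + σ.codiff (k := 3) 3 (extD θ)

/-- The adjoint torsion `τ = d^* σ = - * d * σ`. -/
def tau : DForm M 2 := σ.codiff (k := 2) 4 σ.form

/-- `d⁷₇ α = * d (α ∧ *σ)` on one-forms. -/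
def d77 (α : DForm M 1) : DForm M 1 := σ.star 1 (extD (wedgeD α (σ.star 4 σ.form)))

/-- `d̂⁷₇ α = * (dα ∧ *σ - α ∧ *τ)` on one-forms. -/
def d77Hat (α : DForm M 1) : DForm M 1 :=
  σ.star 1 ((wedgeD (extD α) (σ.star 4 σ.form) : DForm M 6)
    - (wedgeD α (σ.star 5 σ.tau) : DForm M 6))

/-- `ξ(γ) = γ + *(σ ∧ γ)` on two-forms. -/
def xi (γ : DForm M 2) : DForm M 2 := γ + σ.star 2 (wedgeD σ.form γ)

/-- `(f⁰, f¹, f³)` are the components of the three-form `γ` at `x` with respect to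
`Λ³ = Λ³₁ ⊕ Λ³₇ ⊕ Λ³₂₇`: `γ = f⁰ σ + *(f¹ ∧ σ) + f³` and `f³ ∈ Λ³₂₇`, that is,
`f³ ∧ σ = 0` and `f³ ∧ *σ = 0`. -/
def IsDecompositionAt (x : M) (γ : TangentSpace (𝓡 7) x [⋀^Fin 3]→L[ℝ] ℝ) (f0 : ℝ)
    (f1 : TangentSpace (𝓡 7) x [⋀^Fin 1]→L[ℝ] ℝ)
    (f3 : TangentSpace (𝓡 7) x [⋀^Fin 3]→L[ℝ] ℝ) : Prop :=
  γ = f0 • σ.form x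
      + hodgeStar (σ.inducingMap x) (k := 4) (l := 3) (by norm_num) (wedge f1 (σ.form x)) + f3
    ∧ wedge f3 (σ.form x) = 0
    ∧ wedge f3 (hodgeStar (σ.inducingMap x) (k := 3) (l := 4) (by norm_num) (σ.form x)) = 0

/-- The components `(f⁰, f¹, f³)` of a three-form `θ` at `x`. -/
def components (θ : DForm M 3) (x : M) : ℝ × (TangentSpace (𝓡 7) x [⋀^Fin 1]→L[ℝ] ℝ) ×
    (TangentSpace (𝓡 7) x [⋀^Fin 3]→L[ℝ] ℝ) :=
  Classical.epsilon fun t => σ.IsDecompositionAt x (θ x) t.1 t.2.1 t.2.2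

/-- The operator `H(θ) = * d * (4/3 f⁰ σ + *(f¹ ∧ σ) - f³)`, where `f⁰, f¹, f³` are the
components of `θ`. -/
def opH (θ : DForm M 3) : DForm M 2 :=
  σ.star 2 (extD (σ.star 4 (fun x =>
    ((4 / 3 : ℝ) * (σ.components θ x).1) • σ.form x
      + hodgeStar (σ.inducingMap x) (k := 4) (l := 3) (by norm_num)
          (wedge (σ.components θ x).2.1 (σ.form x))
      - (σ.components θ x).2.2 : DForm M 3)))

end G2Structure

end Manifold

end G2

end

open scoped Manifold

noncomputable section

namespace G2

/-! ### Index sums -/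

/-! The component f³ can be eliminated: (4/3)f⁰σ + *(f¹∧σ) - f³ equals (7/3)f⁰σ + 2*(f¹∧σ) - θ
(`smul_add_sub_eq`). Since ** = 1 in dimension seven, H(θ) + *d*θ is therefore (7/3)*d(f⁰*σ) +
2*d(f¹∧σ) (`opH_eq`), and only two Leibniz rules are needed. With *d*σ = -τ the first term is
(7/3)(*(df⁰∧*σ) - f⁰τ). With dσ = 0 the second is 2*(σ∧df¹) = 2ξ(df¹) - 2df¹.

It remains to express ξ(df¹) through d⁷₇f¹. Two pointwise identities do this: ξ(γ) = *(*(γ∧*σ)∧*σ)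
(`star_wedge_star_wedge`), and ξ = 3 on the forms *(α∧*σ) (`star_wedge_dual_add`). Because d*σ =
-*τ, the Leibniz rule gives d⁷₇f¹ = *(df¹∧*σ) + *(f¹∧*τ), whereas the variant with a hat has a minus
sign there. Hence *(d⁷₇f¹∧*σ) is ξ(df¹) plus a third of the ξ-term, and the hat reverses that sign.
The Laplacian formula follows by applying -d to *d*θ, using dθ = 0 and ddf¹ = 0.

The pointwise identities are checked in a frame carried by L to the standard basis. There σ and *σ
have integer coefficients, and everything reduces to finite contraction identities that the kernel
evaluates.

The analytic burden is that d is additive only on differentiable forms, while the inducing maps are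
chosen separately at each point. The star is nevertheless as regular as σ (`contDiffOn_hodgeStar`):
the seven-form (u⌟σ)∧(v⌟σ)∧σ = 6⟨u,v⟩vol recovers the metric and the volume from σ. The components
inherit regularity from f⁰ = (1/7)*(θ∧*σ) and f¹ = -(1/4)*(θ∧σ). -/

theorem sum_fin_cons {n : ℕ} {α : Type*} [Fintype α] (f : (Fin (n + 1) → α) → ℝ) :
    ∑ I, f I = ∑ i, ∑ J : Fin n → α, f (Matrix.vecCons i J) := by
  rw [← (Fin.consEquiv fun _ : Fin (n + 1) => α).sum_comp, Fintype.sum_prod_type]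
  rfl

theorem sum_fin_append {m n : ℕ} {α : Type*} [Fintype α] (f : (Fin (m + n) → α) → ℝ) :
    ∑ I, f I = ∑ I : Fin m → α, ∑ J : Fin n → α, f (Fin.append I J) := by
  rw [← (Fin.appendEquiv m n).sum_comp, Fintype.sum_prod_type]
  rfl

/-- Antisymmetrizing one factor of a pairing with an antisymmetric family. -/
theorem sum_antisymm_mul {n : ℕ} {α : Type*} [Fintype α] (m F : (Fin n → α) → ℝ)
    (hF : ∀ I (π : Equiv.Perm (Fin n)), F (I ∘ π) = (Equiv.Perm.sign π : ℤ) * F I) :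
    ∑ I, (∑ π : Equiv.Perm (Fin n), ((Equiv.Perm.sign π : ℤ) : ℝ) * m (I ∘ π)) * F I
      = (n.factorial : ℝ) * ∑ I, m I * F I := by
  simp only [Finset.sum_mul]
  rw [Finset.sum_comm]
  have h : ∀ π : Equiv.Perm (Fin n),
      ∑ I, ((Equiv.Perm.sign π : ℤ) : ℝ) * m (I ∘ π) * F I = ∑ I, m I * F I := by
    intro π
    -- Substituting I ∘ π⁻¹ for I turns m (I ∘ π) into m I, and the antisymmetry of F absorbs the
    -- sign; so all n! permutations contribute equally.
    rw [← (Equiv.arrowCongr π (Equiv.refl α)).sum_comp]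
    refine Finset.sum_congr rfl fun I _ => ?_
    have h1 : (Equiv.arrowCongr π (Equiv.refl α)) I ∘ π = I := by
      ext x; simp [Equiv.arrowCongr]
    have h2 := hF ((Equiv.arrowCongr π (Equiv.refl α)) I) π
    rw [h1] at h2 ⊢
    rw [h2]; ring
  rw [Finset.sum_congr rfl fun π _ => h π]
  simp [Finset.card_univ, Fintype.card_perm]

/-- A sum of a symmetric family supported on the orderings of an injective tuple. -/
theorem sum_eq_factorial_mul {k : ℕ} {α : Type*} [Fintype α] [DecidableEq α] (K : Fin k → α)
    (hK : Function.Injective K) (F : (Fin k → α) → ℝ)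
    (hperm : ∀ π : Equiv.Perm (Fin k), F (K ∘ π) = F K)
    (hsupp : ∀ I, F I ≠ 0 → Function.Injective I ∧ ∀ j, ∃ i, K i = I j) :
    ∑ I, F I = (k.factorial : ℝ) * F K := by
  have h : ∑ π : Equiv.Perm (Fin k), F K = ∑ I, F I := by
    -- A tuple in the support of F factors as K ∘ g with g injective, hence a permutation; so the
    -- support lies in the injective image of π ↦ K ∘ π.
    refine Finset.sum_of_injOn (fun π : Equiv.Perm (Fin k) => K ∘ π) ?_ (by simp) ?_ ?_
    · intro π _ ρ _ h
      ext x
      exact congrArg Fin.val (hK (congrFun h x))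
    · intro I _ hI
      by_contra h0
      obtain ⟨hinj, hr⟩ := hsupp I h0
      choose g hg using hr
      have hginj : Function.Injective g := by
        intro x y hxy
        apply hinj
        rw [← hg x, ← hg y, hxy]
      apply hI
      refine ⟨Equiv.ofBijective g (Finite.injective_iff_bijective.1 hginj), by simp, ?_⟩
      ext x
      simp [hg]
    · intro π _
      exact (hperm π).symm
  rw [← h]
  simp [Finset.card_univ, Fintype.card_perm]

/-! ### The permutation symbol -/

/-- The Levi-Civita symbol: the standard volume form on basis vectors. -/
def eps (I : Fin 7 → Fin 7) : ℝ := stdVol fun j => stdVec (I j)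

theorem stdVol_apply_eq_det (v : Fin 7 → E7) :
    stdVol v = (EuclideanSpace.basisFun (Fin 7) ℝ).toBasis.det v := rfl

theorem stdVec_eq_basisFun (i : Fin 7) :
    stdVec i = (EuclideanSpace.basisFun (Fin 7) ℝ).toBasis i := by
  simp [stdVec]

theorem eps_id : eps (fun i => i) = 1 := by
  rw [eps, stdVol_apply_eq_det]
  simp only [stdVec_eq_basisFun]
  exact (EuclideanSpace.basisFun (Fin 7) ℝ).toBasis.det_self

theorem eps_comp (I : Fin 7 → Fin 7) (π : Equiv.Perm (Fin 7)) :
    eps (I ∘ π) = (Equiv.Perm.sign π : ℤ) * eps I := by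
  have := stdVol.toAlternatingMap.map_perm (fun j => stdVec (I j)) π
  simp only [Units.smul_def, zsmul_eq_mul] at this
  exact this

theorem injective_of_eps_ne_zero {I : Fin 7 → Fin 7} (h : eps I ≠ 0) : Function.Injective I := by
  intro i j hij
  by_contra hne
  exact h (stdVol.map_eq_zero_of_eq _ (by simp only [hij]) hne)

theorem eps_perm (π : Equiv.Perm (Fin 7)) : eps π = (Equiv.Perm.sign π : ℤ) := by
  have := eps_comp (fun i => i) π
  rw [eps_id, mul_one] at this
  exact this

theorem eps_mul_self {I : Fin 7 → Fin 7} (h : Function.Injective I) : eps I * eps I = 1 := by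
  have h1 : I = Equiv.ofBijective I (Finite.injective_iff_bijective.1 h) := rfl
  rw [h1, eps_perm, ← Int.cast_mul, ← Units.val_mul, Int.units_mul_self]
  simp

/-- Rotations are powers of a cycle of odd length. This is why, in dimension seven, exchanging
complementary blocks of indices costs no sign and ** = 1 in every degree. -/
theorem sign_addRight_seven : ∀ k : Fin 7, Equiv.Perm.sign (Equiv.addRight k) = 1 := by decide

theorem stdVol_add (v : Fin 7 → E7) (k : Fin 7) : stdVol (fun j => v (j + k)) = stdVol v := by
  have := stdVol.toAlternatingMap.map_perm v (Equiv.addRight k)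
  rw [sign_addRight_seven, one_smul] at this
  exact this

theorem eps_add (I : Fin 7 → Fin 7) (k : Fin 7) : eps (fun j => I (j + k)) = eps I :=
  stdVol_add (fun j => stdVec (I j)) k

theorem append_comm_rotate {α : Type*} {k l : ℕ} (h : k + l = 7) (h' : l + k = 7) (I : Fin k → α)
    (J : Fin l → α) (j : Fin 7) :
    Fin.append J I (Fin.cast h'.symm j)
      = Fin.append I J (Fin.cast h.symm (j + Fin.ofNat 7 k)) := by
  obtain ⟨j, rfl⟩ : ∃ i, Fin.cast h' i = j := ⟨Fin.cast h'.symm j, rfl⟩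
  refine Fin.addCases (fun i => ?_) (fun i => ?_) j
  -- Exchanging the two blocks is the rotation by k modulo 7; for k = 7 the shift is 0, consistent
  -- with an empty second block.
  · have : Fin.cast h.symm (Fin.cast h' (Fin.castAdd k i) + Fin.ofNat 7 k) = Fin.natAdd k i := by
      ext
      have := i.2
      simp [Fin.val_add]
      omega
    rw [this]
    simp
  · have : Fin.cast h.symm (Fin.cast h' (Fin.natAdd l i) + Fin.ofNat 7 k) = Fin.castAdd l i := by
      ext
      have := i.2
      simp [Fin.val_add]
      omega
    rw [this]
    simp

theorem stdVol_append_comm {k l : ℕ} (h : k + l = 7) (h' : l + k = 7) (v : Fin k → E7)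
    (w : Fin l → E7) :
    stdVol (fun j => Fin.append w v (Fin.cast h'.symm j))
      = stdVol (fun j => Fin.append v w (Fin.cast h.symm j)) := by
  rw [← stdVol_add (fun j => Fin.append v w (Fin.cast h.symm j)) (Fin.ofNat 7 k)]
  exact congrArg stdVol (funext fun j => append_comm_rotate h h' v w j)

theorem eps_append_comm {k l : ℕ} (h : k + l = 7) (h' : l + k = 7) (I : Fin k → Fin 7)
    (J : Fin l → Fin 7) :
    eps (fun j => Fin.append J I (Fin.cast h'.symm j))
      = eps (fun j => Fin.append I J (Fin.cast h.symm j)) := by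
  rw [← eps_add (fun j => Fin.append I J (Fin.cast h.symm j)) (Fin.ofNat 7 k)]
  exact congrArg eps (funext fun j => append_comm_rotate h h' I J j)

/-- `eps` of the concatenation of two index tuples. -/
def epsAppend {k l : ℕ} (h : k + l = 7) (I : Fin k → Fin 7) (J : Fin l → Fin 7) : ℝ :=
  eps fun j => Fin.append I J (Fin.cast h.symm j)

theorem epsAppend_comm {k l : ℕ} (h : k + l = 7) (h' : l + k = 7) (I : Fin k → Fin 7)
    (J : Fin l → Fin 7) : epsAppend h I J = epsAppend h' J I :=
  (eps_append_comm h h' I J).symm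

theorem epsAppend_comp_right {k l : ℕ} (h : k + l = 7) (I : Fin k → Fin 7) (J : Fin l → Fin 7)
    (π : Equiv.Perm (Fin l)) :
    epsAppend h I (J ∘ π) = (Equiv.Perm.sign π : ℤ) * epsAppend h I J := by
  have h1 := (insertVectors h (fun j => stdVec (I j)) stdVol).toAlternatingMap.map_perm
    (fun j => stdVec (J j)) π
  simp only [Units.smul_def, zsmul_eq_mul] at h1
  have h2 : ∀ J : Fin l → Fin 7, epsAppend h I J
      = (insertVectors h (fun j => stdVec (I j)) stdVol) fun j => stdVec (J j) := by
    intro J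
    simp only [epsAppend, eps]
    show stdVol _ = stdVol _
    congr 1
    ext1 j
    exact (Fin.addCases (fun i => by simp) (fun i => by simp) (Fin.cast h.symm j))
  rw [h2, h2]
  exact h1

theorem epsAppend_comp_left {k l : ℕ} (h : k + l = 7) (I : Fin k → Fin 7) (J : Fin l → Fin 7)
    (π : Equiv.Perm (Fin k)) :
    epsAppend h (I ∘ π) J = (Equiv.Perm.sign π : ℤ) * epsAppend h I J := by
  rw [epsAppend_comm h (by omega), epsAppend_comp_right, epsAppend_comm h (by omega)]

theorem append_injective_of_epsAppend_ne_zero {k l : ℕ} (h : k + l = 7) {I : Fin k → Fin 7}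
    {J : Fin l → Fin 7} (h0 : epsAppend h I J ≠ 0) : Function.Injective (Fin.append I J) := by
  have := (injective_of_eps_ne_zero h0).comp (Fin.cast_injective h)
  exact this

theorem epsAppend_mul_self {k l : ℕ} (h : k + l = 7) {I : Fin k → Fin 7}
    {J : Fin l → Fin 7} (h0 : Function.Injective (Fin.append I J)) :
    epsAppend h I J * epsAppend h I J = 1 :=
  eps_mul_self (h0.comp (Fin.cast_injective h.symm))

/-! ### Coordinates of forms in an oriented orthonormal frame -/

section Coordinates

variable {V : Type*} [AddCommGroup V] [Module ℝ V] [TopologicalSpace V]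

/-- The basis underlying `frame`. -/
def frameBasis (L : V ≃L[ℝ] E7) : Module.Basis (Fin 7) ℝ V :=
  (EuclideanSpace.basisFun (Fin 7) ℝ).toBasis.map L.symm.toLinearEquiv

theorem frameBasis_apply (L : V ≃L[ℝ] E7) (i : Fin 7) : frameBasis L i = frame L i := by
  simp [frameBasis, frame, stdVec]

/-- The coordinates of a form in the frame of `L`. -/
def co {k : ℕ} (L : V ≃L[ℝ] E7) (η : V [⋀^Fin k]→L[ℝ] ℝ) (I : Fin k → Fin 7) : ℝ :=
  η fun j => frame L (I j)

/-- The restriction to injective index tuples matters for the double star, where a complementary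
tuple has to be chosen. -/
theorem ext_co_of_injective {k : ℕ} (L : V ≃L[ℝ] E7) {η ζ : V [⋀^Fin k]→L[ℝ] ℝ}
    (h : ∀ I, Function.Injective I → co L η I = co L ζ I) : η = ζ := by
  apply ContinuousAlternatingMap.toAlternatingMap_injective
  refine Module.Basis.ext_alternating (frameBasis L) fun I hI => ?_
  simp only [frameBasis_apply]
  exact h I hI

theorem ext_co {k : ℕ} (L : V ≃L[ℝ] E7) {η ζ : V [⋀^Fin k]→L[ℝ] ℝ}
    (h : ∀ I, co L η I = co L ζ I) : η = ζ :=
  ext_co_of_injective L fun I _ => h I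

theorem co_comp {k : ℕ} (L : V ≃L[ℝ] E7) (η : V [⋀^Fin k]→L[ℝ] ℝ) (I : Fin k → Fin 7)
    (π : Equiv.Perm (Fin k)) : co L η (I ∘ π) = (Equiv.Perm.sign π : ℤ) * co L η I := by
  have := η.toAlternatingMap.map_perm (fun j => frame L (I j)) π
  simp only [Units.smul_def, zsmul_eq_mul] at this
  exact this

@[simp]
theorem co_smul [ContinuousConstSMul ℝ V] {k : ℕ} (L : V ≃L[ℝ] E7) (c : ℝ)
    (η : V [⋀^Fin k]→L[ℝ] ℝ) (I : Fin k → Fin 7) : co L (c • η) I = c * co L η I := rfl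

@[simp]
theorem co_add {k : ℕ} (L : V ≃L[ℝ] E7) (η ζ : V [⋀^Fin k]→L[ℝ] ℝ) (I : Fin k → Fin 7) :
    co L (η + ζ) I = co L η I + co L ζ I := rfl

@[simp]
theorem co_sub {k : ℕ} (L : V ≃L[ℝ] E7) (η ζ : V [⋀^Fin k]→L[ℝ] ℝ) (I : Fin k → Fin 7) :
    co L (η - ζ) I = co L η I - co L ζ I := rfl

theorem co_wedge {p q : ℕ} (L : V ≃L[ℝ] E7) (α : V [⋀^Fin p]→L[ℝ] ℝ) (β : V [⋀^Fin q]→L[ℝ] ℝ)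
    (I : Fin (p + q) → Fin 7) :
    co L (wedge α β) I = ((p.factorial : ℝ) * (q.factorial : ℝ))⁻¹ *
      ∑ π : Equiv.Perm (Fin (p + q)), ((Equiv.Perm.sign π : ℤ) : ℝ) *
        (co L α (fun i => (I ∘ π) (Fin.castAdd q i)) *
          co L β (fun j => (I ∘ π) (Fin.natAdd p j))) := by
  simp only [co, wedge, ContinuousAlternatingMap.smul_apply,
    ContinuousMultilinearMap.alternatization_apply_apply, smul_eq_mul, Units.smul_def,
    zsmul_eq_mul]
  rfl

variable [IsTopologicalAddGroup V] [ContinuousConstSMul ℝ V]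

/-- L maps its frame to the standard basis, so the right-hand side involves L only through the
coordinates of η. Pointwise identities thereby reduce to index computations valid for every L. -/
theorem co_hodgeStar {k l : ℕ} (L : V ≃L[ℝ] E7) (h : k + l = 7) (η : V [⋀^Fin k]→L[ℝ] ℝ)
    (K : Fin l → Fin 7) :
    co L (hodgeStar L h η) K = ((k.factorial : ℝ))⁻¹ * ∑ I, co L η I * epsAppend h I K := by
  simp only [co, hodgeStar, ContinuousAlternatingMap.smul_apply, smul_eq_mul,
    ContinuousAlternatingMap.sum_apply]
  congr 1
  refine Finset.sum_congr rfl fun I _ => ?_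
  congr 1
  show stdVol _ = stdVol _
  congr 1
  ext1 j
  change L (Fin.append _ _ (Fin.cast h.symm j)) = stdVec (Fin.append I K (Fin.cast h.symm j))
  generalize Fin.cast h.symm j = i
  refine Fin.addCases (fun i => ?_) (fun i => ?_) i <;> simp [frame]

/-- Pairing with the antisymmetric symbol makes the alternation in the wedge product redundant; the
(p+q)! that this produces cancels the normalization of the star. -/
theorem co_hodgeStar_wedge_aux {p q l : ℕ} (L : V ≃L[ℝ] E7) (h : p + q + l = 7)
    (α : V [⋀^Fin p]→L[ℝ] ℝ) (β : V [⋀^Fin q]→L[ℝ] ℝ) (K : Fin l → Fin 7) :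
    co L (hodgeStar L h (wedge α β)) K = ((p.factorial : ℝ) * (q.factorial : ℝ))⁻¹ *
      ∑ I, ∑ J, co L α I * co L β J * epsAppend h (Fin.append I J) K := by
  have h1 := sum_antisymm_mul
    (fun I : Fin (p + q) → Fin 7 => co L α (fun i => I (Fin.castAdd q i)) *
          co L β (fun j => I (Fin.natAdd p j))) (fun I => epsAppend h I K)
    (fun I π => epsAppend_comp_left h I K π)
  simp only [co_hodgeStar, co_wedge]
  simp only [mul_assoc, ← Finset.mul_sum] at h1 ⊢
  rw [h1, sum_fin_append]
  simp only [Fin.append_left, Fin.append_right, Finset.mul_sum]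
  have : ((p + q).factorial : ℝ) ≠ 0 := by positivity
  field_simp

/-- `*(ω ∧ α)` through contraction of `*ω` with `α`. -/
theorem co_hodgeStar_wedge_right {p q l : ℕ} (L : V ≃L[ℝ] E7) (h : q + p + l = 7)
    (h' : q + (p + l) = 7)
    (ω : V [⋀^Fin q]→L[ℝ] ℝ) (α : V [⋀^Fin p]→L[ℝ] ℝ) (K : Fin l → Fin 7) :
    co L (hodgeStar L h (wedge ω α)) K = ((p.factorial : ℝ))⁻¹ *
      ∑ I, co L α I * co L (hodgeStar L h' ω) (Fin.append I K) := by
  rw [co_hodgeStar_wedge_aux]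
  simp only [co_hodgeStar, Finset.mul_sum]
  rw [Finset.sum_comm]
  refine Finset.sum_congr rfl fun I _ => Finset.sum_congr rfl fun J _ => ?_
  have : epsAppend h (Fin.append J I) K = epsAppend h' J (Fin.append I K) := by
    simp only [epsAppend, Fin.append_assoc]
    rfl
  rw [this, mul_inv]
  ring

/-- `*(α ∧ ω)` through contraction of `*ω` with `α`. -/
theorem co_hodgeStar_wedge_left {p q l : ℕ} (L : V ≃L[ℝ] E7) (h : p + q + l = 7)
    (h' : q + (l + p) = 7)
    (α : V [⋀^Fin p]→L[ℝ] ℝ) (ω : V [⋀^Fin q]→L[ℝ] ℝ) (K : Fin l → Fin 7) :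
    co L (hodgeStar L h (wedge α ω)) K = ((p.factorial : ℝ))⁻¹ *
      ∑ I, co L α I * co L (hodgeStar L h' ω) (Fin.append K I) := by
  rw [co_hodgeStar_wedge_aux]
  simp only [co_hodgeStar, Finset.mul_sum]
  refine Finset.sum_congr rfl fun I _ => Finset.sum_congr rfl fun J _ => ?_
  have : epsAppend h (Fin.append I J) K = epsAppend h' J (Fin.append K I) := by
    -- The block orders I, J, K and J, K, I differ by a rotation, so α moves into the last slots of
    -- *ω without a sign.
    have h1 : epsAppend h (Fin.append I J) K
        = epsAppend (by omega : p + (q + l) = 7) I (Fin.append J K) := by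
      simp only [epsAppend, Fin.append_assoc]
      rfl
    have h2 : epsAppend h' J (Fin.append K I)
        = epsAppend (by omega : q + l + p = 7) (Fin.append J K) I := by
      simp only [epsAppend, Fin.append_assoc]
      rfl
    rw [h1, h2, epsAppend_comm]
  rw [this, mul_inv]
  ring

theorem exists_complement {k l : ℕ} (h : k + l = 7) (K : Fin k → Fin 7)
    (hK : Function.Injective K) : ∃ J : Fin l → Fin 7, Function.Injective (Fin.append J K) := by
  classical
  have hc : ((Finset.univ.image K)ᶜ).card = l := by
    rw [Finset.card_compl, Finset.card_image_of_injective _ hK]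
    simp
    omega
  refine ⟨((Finset.univ.image K)ᶜ).orderEmbOfFin hc, Fin.append_injective_iff.2
    ⟨RelEmbedding.injective _, hK, ?_⟩⟩
  intro i j hij
  have := ((Finset.univ.image K)ᶜ).orderEmbOfFin_mem hc i
  rw [Finset.mem_compl] at this
  apply this
  rw [hij]
  simp

/-- Two tuples completing the same K have the same set of entries, namely the complement of K. -/
theorem exists_of_append_injective {k l : ℕ} (h : k + l = 7) {J₀ : Fin k → Fin 7}
    {K : Fin l → Fin 7} (h0 : Function.Injective (Fin.append J₀ K)) {J : Fin k → Fin 7}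
    (hJ : Function.Injective (Fin.append J K)) (j : Fin k) : ∃ i, J₀ i = J j := by
  have hb : Function.Surjective (Fin.append J₀ K) :=
    ((Fintype.bijective_iff_injective_and_card _).2 ⟨h0, by simp [h]⟩).2
  obtain ⟨x, hx⟩ := hb (J j)
  revert hx
  refine Fin.addCases (fun i => ?_) (fun i => ?_) x
  · intro hx; exact ⟨i, by simpa using hx⟩
  · intro hx
    exact absurd (by simpa using hx.symm) ((Fin.append_injective_iff.1 hJ).2.2 j i)

/-- For an injective K, only the orderings of a complementary tuple J₀ contribute to the outer sum,
and only those of K to the inner one. The factorials cancel, and the two remaining symbols agree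
because block exchange is even, so their product is 1. -/
theorem hodgeStar_hodgeStar {k l : ℕ} (L : V ≃L[ℝ] E7) (h : k + l = 7) (h' : l + k = 7)
    (η : V [⋀^Fin k]→L[ℝ] ℝ) : hodgeStar L h' (hodgeStar L h η) = η := by
  refine ext_co_of_injective L fun K hK => ?_
  obtain ⟨J₀, hJ₀⟩ := exists_complement h K hK
  have hKJ : Function.Injective (Fin.append K J₀) := by
    obtain ⟨h1, h2, h3⟩ := Fin.append_injective_iff.1 hJ₀
    exact Fin.append_injective_iff.2 ⟨h2, h1, fun i j => (h3 j i).symm⟩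
  rw [co_hodgeStar, sum_eq_factorial_mul J₀ (Fin.append_injective_iff.1 hJ₀).1, co_hodgeStar,
    sum_eq_factorial_mul K hK]
  · have h1 := epsAppend_mul_self h hKJ
    have h2 : (k.factorial : ℝ) ≠ 0 := by positivity
    have h3 : (l.factorial : ℝ) ≠ 0 := by positivity
    rw [epsAppend_comm h' h J₀ K]
    field_simp
    linear_combination co L η K * h1
  · intro π
    rw [co_comp, epsAppend_comp_left]
    have : ((Equiv.Perm.sign π : ℤ) : ℝ) * (Equiv.Perm.sign π : ℤ) = 1 := by
      rw [← Int.cast_mul, ← Units.val_mul, Int.units_mul_self]; simp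
    linear_combination co L η K * epsAppend h K J₀ * this
  · intro I hI
    have h1 := append_injective_of_epsAppend_ne_zero h (right_ne_zero_of_mul hI)
    exact ⟨(Fin.append_injective_iff.1 h1).1, exists_of_append_injective h hKJ h1⟩
  · intro π
    rw [co_comp, epsAppend_comp_left]
    have : ((Equiv.Perm.sign π : ℤ) : ℝ) * (Equiv.Perm.sign π : ℤ) = 1 := by
      rw [← Int.cast_mul, ← Units.val_mul, Int.units_mul_self]; simp
    linear_combination co L (hodgeStar L h η) J₀ * epsAppend h' J₀ K * this
  · intro I hI
    have h1 := append_injective_of_epsAppend_ne_zero h' (right_ne_zero_of_mul hI)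
    exact ⟨(Fin.append_injective_iff.1 h1).1, exists_of_append_injective h' hJ₀ h1⟩

end Coordinates

/-! ### Integer tables for the standard three-form and its dual -/

/-- The sign of `b - a`. -/
def pairSign (a b : Fin 7) : ℤ := if a < b then 1 else if b < a then -1 else 0

/-- The permutation symbol as a product of signs of differences. -/
def epsInt (a b c d e f g : Fin 7) : ℤ :=
  (pairSign a b * pairSign a c * pairSign a d * pairSign a e * pairSign a f * pairSign a g) *
  (pairSign b c * pairSign b d * pairSign b e * pairSign b f * pairSign b g) *
  (pairSign c d * pairSign c e * pairSign c f * pairSign c g) *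
  (pairSign d e * pairSign d f * pairSign d g) * (pairSign e f * pairSign e g) * pairSign f g

theorem epsInt_eq_prod (I : Fin 7 → Fin 7) :
    epsInt (I 0) (I 1) (I 2) (I 3) (I 4) (I 5) (I 6)
      = ∏ i, ∏ j ∈ Finset.Ioi i, pairSign (I i) (I j) := by
  have h : ∀ i : Fin 7, ∏ j ∈ Finset.Ioi i, pairSign (I i) (I j)
      = ∏ j, if i < j then pairSign (I i) (I j) else 1 := by
    intro i
    rw [Finset.prod_ite]
    simp [Finset.filter_lt_eq_Ioi]
  simp only [h, Fin.prod_univ_seven, epsInt]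
  simp

/-- The sign of a permutation is the product of the signs over pairs i < j, and a repeated index
kills both sides. The integer form is what the kernel can evaluate. -/
theorem eps_eq_epsInt (I : Fin 7 → Fin 7) :
    eps I = (epsInt (I 0) (I 1) (I 2) (I 3) (I 4) (I 5) (I 6) : ℝ) := by
  rw [epsInt_eq_prod]
  by_cases hI : Function.Injective I
  · have h1 : I = Equiv.ofBijective I (Finite.injective_iff_bijective.1 hI) := rfl
    rw [h1, eps_perm, Equiv.Perm.sign_eq_prod_prod_Ioi]
    congr 1
    simp only [Units.coe_prod]
    refine Finset.prod_congr rfl fun i _ => Finset.prod_congr rfl fun j hj => ?_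
    rw [Finset.mem_Ioi] at hj
    rw [← h1]
    have : I i ≠ I j := fun h => hj.ne (hI h)
    rcases lt_or_gt_of_ne this with h | h
    · simp [pairSign, h]
    · simp [pairSign, h, h.not_gt]
  · have h0 : eps I = 0 := by
      by_contra h
      exact hI (injective_of_eps_ne_zero h)
    rw [h0, eq_comm, Int.cast_eq_zero]
    simp only [Function.Injective, not_forall] at hI
    obtain ⟨i, j, hij, hne⟩ := hI
    rcases lt_or_gt_of_ne hne with h | h
    · exact Finset.prod_eq_zero (Finset.mem_univ i)
        (Finset.prod_eq_zero (Finset.mem_Ioi.2 h) (by simp [pairSign, hij]))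
    · exact Finset.prod_eq_zero (Finset.mem_univ j)
        (Finset.prod_eq_zero (Finset.mem_Ioi.2 h) (by simp [pairSign, hij]))

/-- The multiplication table of the cross product: `e_i × e_j = ± e_k` is encoded by `± (k + 1)`. -/
def crossTable : Fin 7 → Fin 7 → ℤ :=
  ![![0, 3, -2, 5, -4, 7, -6], ![-3, 0, 1, 6, -7, -4, 5], ![2, -1, 0, -7, -6, 5, 4],
    ![-5, -6, 7, 0, 1, 2, -3], ![4, 7, 6, -1, 0, -3, -2], ![-7, 4, -5, -2, 3, 0, 1],
    ![6, -5, -4, 3, 2, -1, 0]]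

/-- The components of the standard three-form. -/
def sInt (i j k : Fin 7) : ℤ :=
  if crossTable i j = (k : ℕ) + 1 then 1 else if crossTable i j = -((k : ℕ) + 1) then -1 else 0

/-- The components of the dual of the standard three-form. -/
def pInt (i j k l : Fin 7) : ℤ :=
  epsInt 0 1 2 i j k l + epsInt 0 3 4 i j k l + epsInt 0 5 6 i j k l + epsInt 1 3 5 i j k l
    - epsInt 1 4 6 i j k l - epsInt 2 3 6 i j k l - epsInt 2 4 5 i j k l

def deltaInt (i j : Fin 7) : ℤ := if i = j then 1 else 0

/-- The three-by-three minor of the identity matrix. -/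
def minorInt (a b c i j k : Fin 7) : ℤ :=
  deltaInt a i * (deltaInt b j * deltaInt c k - deltaInt b k * deltaInt c j)
    - deltaInt a j * (deltaInt b i * deltaInt c k - deltaInt b k * deltaInt c i)
    + deltaInt a k * (deltaInt b i * deltaInt c j - deltaInt b j * deltaInt c i)

/-- The bridge between the lookup table, which evaluates quickly, and the seven monomials that
define the standard form. -/
theorem sInt_eq : ∀ i j k, sInt i j k = minorInt 0 1 2 i j k + minorInt 0 3 4 i j k
    + minorInt 0 5 6 i j k + minorInt 1 3 5 i j k - minorInt 1 4 6 i j k - minorInt 2 3 6 i j k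
    - minorInt 2 4 5 i j k := by decide +kernel

/-- The fundamental contraction identity of the cross product: its failure to be the antisymmetrized
metric is exactly *σ. It becomes the formula for ξ. -/
theorem sum_sInt_mul_sInt : ∀ i j k l, ∑ m, sInt i j m * sInt m k l
    = deltaInt i k * deltaInt j l - deltaInt i l * deltaInt j k + pInt i j k l := by
  decide +kernel

theorem sum_sum_sInt_mul_sInt : ∀ m k, ∑ i, ∑ j, sInt m i j * sInt i j k = 6 * deltaInt m k := by
  decide +kernel

/-! ### The components of the standard three-form and its dual -/

theorem co_dx (a : Fin 7) (I : Fin 1 → Fin 7) :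
    co (.refl ℝ E7) (dx a) I = (deltaInt a (I 0) : ℝ) := by
  simp [co, dx, frame, stdVec, deltaInt]

theorem sum_perm_two {R : Type*} [AddCommMonoid R] (f : Equiv.Perm (Fin 2) → R) :
    ∑ π, f π = f 1 + f (Equiv.swap 0 1) := by
  have : (Finset.univ : Finset (Equiv.Perm (Fin 2))) = {1, Equiv.swap 0 1} := by decide
  rw [this, Finset.sum_pair (by decide)]

theorem sum_perm_three {R : Type*} [AddCommMonoid R] (f : Equiv.Perm (Fin 3) → R) :
    ∑ π, f π = f 1 + (f (Equiv.swap 0 1) + (f (Equiv.swap 0 2) + (f (Equiv.swap 1 2)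
      + (f (finRotate 3) + f ((finRotate 3)⁻¹))))) := by
  have : (Finset.univ : Finset (Equiv.Perm (Fin 3)))
      = {1, Equiv.swap 0 1, Equiv.swap 0 2, Equiv.swap 1 2, finRotate 3, (finRotate 3)⁻¹} := by
    decide
  rw [this, Finset.sum_insert (by decide), Finset.sum_insert (by decide),
    Finset.sum_insert (by decide), Finset.sum_insert (by decide), Finset.sum_pair (by decide)]

theorem co_wedge_dx_dx (b c : Fin 7) (I : Fin 2 → Fin 7) :
    co (.refl ℝ E7) (wedge (dx b) (dx c)) I
      = deltaInt b (I 0) * deltaInt c (I 1) - deltaInt b (I 1) * deltaInt c (I 0) := by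
  have h := co_wedge (.refl ℝ E7) (dx b) (dx c) I
  rw [h]
  simp only [co_dx]
  refine (congrArg _ (sum_perm_two _)).trans ?_
  simp
  ring

theorem co_wedge_dx_dx_dx (a b c : Fin 7) (I : Fin 3 → Fin 7) :
    co (.refl ℝ E7) (wedge (dx a) (wedge (dx b) (dx c))) I
      = (minorInt a b c (I 0) (I 1) (I 2) : ℝ) := by
  have h := co_wedge (.refl ℝ E7) (dx a) (wedge (dx b) (dx c)) I
  rw [h]
  simp only [co_dx, co_wedge_dx_dx]
  refine (congrArg _ (sum_perm_three _)).trans ?_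
  have e1 : Equiv.Perm.sign (finRotate 3) = 1 := by decide
  have e2 : (finRotate 3)⁻¹ 0 = 2 := by decide
  have e3 : (finRotate 3)⁻¹ 1 = 0 := by decide
  have e4 : (finRotate 3)⁻¹ 2 = 1 := by decide
  have e5 : finRotate 3 0 = 1 := by decide
  have e6 : finRotate 3 1 = 2 := by decide
  have e7 : finRotate 3 2 = 0 := by decide
  have e8 : (Fin.castAdd (1 + 1) (0 : Fin 1)) = (0 : Fin 3) := by decide
  have e9 : (Fin.natAdd 1 (0 : Fin 2)) = (1 : Fin 3) := by decide
  have e10 : (Fin.natAdd 1 (1 : Fin 2)) = (2 : Fin 3) := by decide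
  have f1 : Equiv.swap (0 : Fin 3) 1 2 = 2 := by decide
  have f2 : Equiv.swap (0 : Fin 3) 2 1 = 1 := by decide
  have f3 : Equiv.swap (1 : Fin 3) 2 0 = 0 := by decide
  have f4 : Equiv.Perm.sign (Equiv.swap (0 : Fin 3) 1) = -1 := by decide
  have f5 : Equiv.Perm.sign (Equiv.swap (0 : Fin 3) 2) = -1 := by decide
  have f6 : Equiv.Perm.sign (Equiv.swap (1 : Fin 3) 2) = -1 := by decide
  simp only [Function.comp, e8, e9, e10, Equiv.Perm.sign_inv, e1, e2, e3, e4, e5, e6, e7, f1, f2,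
    f3, f4, f5, f6, Equiv.swap_apply_left, Equiv.swap_apply_right, Equiv.Perm.coe_one, id_eq,
    Equiv.Perm.sign_one, Units.val_one, Units.val_neg, Int.cast_one, Int.cast_neg, minorInt]
  push_cast
  norm_num [Nat.factorial]
  ring

section Bilinear

variable {V : Type*} [AddCommGroup V] [Module ℝ V] [TopologicalSpace V] {p q : ℕ}

theorem wedge_add_right (α : V [⋀^Fin p]→L[ℝ] ℝ) (β γ : V [⋀^Fin q]→L[ℝ] ℝ) :
    wedge α (β + γ) = wedge α β + wedge α γ := by
  have : mulForms α (β + γ) = mulForms α β + mulForms α γ := by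
    ext v
    exact mul_add _ _ _
  rw [wedge, this, map_add, smul_add]
  rfl

theorem wedge_add_left (α γ : V [⋀^Fin p]→L[ℝ] ℝ) (β : V [⋀^Fin q]→L[ℝ] ℝ) :
    wedge (α + γ) β = wedge α β + wedge γ β := by
  have : mulForms (α + γ) β = mulForms α β + mulForms γ β := by
    ext v
    exact add_mul _ _ _
  rw [wedge, this, map_add, smul_add]
  rfl

theorem alternatization_smul {n : ℕ} (c : ℝ)
    (m : ContinuousMultilinearMap ℝ (fun _ : Fin n => V) ℝ) :
    ContinuousMultilinearMap.alternatization (c • m)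
      = c • ContinuousMultilinearMap.alternatization m := by
  ext v
  rw [ContinuousAlternatingMap.smul_apply,
    ContinuousMultilinearMap.alternatization_apply_apply,
    ContinuousMultilinearMap.alternatization_apply_apply, Finset.smul_sum]
  refine Finset.sum_congr rfl fun π _ => ?_
  rw [_root_.smul_apply, smul_comm]

theorem wedge_smul_right (α : V [⋀^Fin p]→L[ℝ] ℝ) (c : ℝ) (β : V [⋀^Fin q]→L[ℝ] ℝ) :
    wedge α (c • β) = c • wedge α β := by
  have : mulForms α (c • β) = c • mulForms α β := by
    ext v
    exact mul_left_comm _ _ _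
  rw [wedge, this, alternatization_smul, smul_comm]
  rfl

theorem wedge_smul_left (c : ℝ) (α : V [⋀^Fin p]→L[ℝ] ℝ) (β : V [⋀^Fin q]→L[ℝ] ℝ) :
    wedge (c • α) β = c • wedge α β := by
  have : mulForms (c • α) β = c • mulForms α β := by
    ext v
    exact mul_assoc _ _ _
  rw [wedge, this, alternatization_smul, smul_comm]
  rfl

theorem sub_eq_add_neg_one_smul (β γ : V [⋀^Fin p]→L[ℝ] ℝ) : β - γ = β + (-1 : ℝ) • γ := by
  ext v
  simp [sub_eq_add_neg]

end Bilinear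

theorem co_stdForm (I : Fin 3 → Fin 7) :
    co (.refl ℝ E7) stdForm I = (sInt (I 0) (I 1) (I 2) : ℝ) := by
  rw [sInt_eq, stdForm]
  simp only [sub_eq_add_neg_one_smul, wedge_add_right, wedge_smul_right]
  simp only [co_add, co_smul]
  have := co_wedge_dx_dx_dx
  simp only [Int.cast_add, Int.cast_sub, ← this _ _ _ I]
  ring

theorem hodgeStar_add {V : Type*} [AddCommGroup V] [Module ℝ V] [TopologicalSpace V]
    [IsTopologicalAddGroup V] [ContinuousConstSMul ℝ V] {k l : ℕ} (L : V ≃L[ℝ] E7)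
    (h : k + l = 7) (η ζ : V [⋀^Fin k]→L[ℝ] ℝ) :
    hodgeStar L h (η + ζ) = hodgeStar L h η + hodgeStar L h ζ := by
  refine ext_co L fun K => ?_
  simp only [co_add, co_hodgeStar, ← mul_add, ← Finset.sum_add_distrib, ← add_mul]

theorem hodgeStar_smul {V : Type*} [AddCommGroup V] [Module ℝ V] [TopologicalSpace V]
    [IsTopologicalAddGroup V] [ContinuousConstSMul ℝ V] {k l : ℕ} (L : V ≃L[ℝ] E7)
    (h : k + l = 7) (c : ℝ) (η : V [⋀^Fin k]→L[ℝ] ℝ) :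
    hodgeStar L h (c • η) = c • hodgeStar L h η := by
  refine ext_co L fun K => ?_
  simp only [co_smul, co_hodgeStar, mul_assoc, ← Finset.mul_sum]
  ring

theorem sum_fin_one {α : Type*} [Fintype α] (f : (Fin 1 → α) → ℝ) :
    ∑ I, f I = ∑ i, f ![i] := by
  rw [sum_fin_cons]
  refine Finset.sum_congr rfl fun i _ => ?_
  rw [Fintype.sum_unique]
  congr 2

theorem sum_fin_two {α : Type*} [Fintype α] (f : (Fin 2 → α) → ℝ) :
    ∑ I, f I = ∑ i, ∑ j, f ![i, j] := by
  rw [sum_fin_cons]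
  simp only [sum_fin_one]

theorem sum_fin_three {α : Type*} [Fintype α] (f : (Fin 3 → α) → ℝ) :
    ∑ I, f I = ∑ i, ∑ j, ∑ k, f ![i, j, k] := by
  rw [sum_fin_cons]
  simp only [sum_fin_two]

theorem co_hodgeStar_wedge_dx_dx_dx (a b c : Fin 7) (I : Fin 4 → Fin 7) :
    co (.refl ℝ E7) (hodgeStar (.refl ℝ E7) (k := 3) (l := 4) (by norm_num)
      (wedge (dx a) (wedge (dx b) (dx c)))) I
      = (epsInt a b c (I 0) (I 1) (I 2) (I 3) : ℝ) := by
  have e1 : ∀ (i : Fin 7) (J : Fin 6 → Fin 7), epsAppend (k := 1) (l := 6) (by norm_num) ![i] J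
      = epsInt i (J 0) (J 1) (J 2) (J 3) (J 4) (J 5) := by
    intro i J
    rw [epsAppend, eps_eq_epsInt]
    rfl
  have h1 : ∀ J : Fin 6 → Fin 7, co (.refl ℝ E7) (hodgeStar (.refl ℝ E7) (k := 1) (l := 6)
      (by norm_num) (dx c)) J = (epsInt c (J 0) (J 1) (J 2) (J 3) (J 4) (J 5) : ℝ) := by
    intro J
    rw [co_hodgeStar, sum_fin_one]
    simp only [co_dx, e1]
    simp [deltaInt]
  have h2 : ∀ J : Fin 5 → Fin 7, co (.refl ℝ E7) (hodgeStar (.refl ℝ E7) (k := 2) (l := 5)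
      (by norm_num) (wedge (dx b) (dx c))) J
        = (epsInt c (J 0) (J 1) (J 2) (J 3) (J 4) b : ℝ) := by
    intro J
    rw [co_hodgeStar_wedge_left (p := 1) (q := 1) (l := 5) _ _ (by norm_num), sum_fin_one]
    have := fun i => h1 (Fin.append J ![i])
    simp only [co_dx]
    refine (congrArg _ (Finset.sum_congr rfl fun i _ => congrArg _ (this i))).trans ?_
    simp [deltaInt]
    rfl
  have h3 : co (.refl ℝ E7) (hodgeStar (.refl ℝ E7) (k := 3) (l := 4)
      (by norm_num) (wedge (dx a) (wedge (dx b) (dx c)))) I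
        = (epsInt c (I 0) (I 1) (I 2) (I 3) a b : ℝ) := by
    refine (co_hodgeStar_wedge_left (p := 1) (q := 2) (l := 4) _ _ (by norm_num) _ _ _).trans ?_
    rw [sum_fin_one]
    have := fun i => h2 (Fin.append I ![i])
    simp only [co_dx]
    refine (congrArg _ (Finset.sum_congr rfl fun i _ => congrArg _ (this i))).trans ?_
    simp [deltaInt]
    rfl
  rw [h3]
  -- Peeling off the three factors leaves the index order c, I, a, b; a rotation by two brings it to
  -- a, b, c, I.
  have h4 := eps_add ![a, b, c, I 0, I 1, I 2, I 3] 2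
  rw [eps_eq_epsInt, eps_eq_epsInt] at h4
  exact h4

theorem co_hodgeStar_stdForm (I : Fin 4 → Fin 7) :
    co (.refl ℝ E7) (hodgeStar (.refl ℝ E7) (k := 3) (l := 4) (by norm_num) stdForm) I
      = (pInt (I 0) (I 1) (I 2) (I 3) : ℝ) := by
  rw [pInt, stdForm]
  simp only [sub_eq_add_neg_one_smul, wedge_add_right, wedge_smul_right, hodgeStar_add, hodgeStar_smul]
  simp only [co_add, co_smul]
  have := co_hodgeStar_wedge_dx_dx_dx
  simp only [Int.cast_add, Int.cast_sub, ← this _ _ _ I]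
  ring

/-! ### Contraction identities -/

theorem pInt_comm : ∀ i j k l, pInt i j k l = pInt k l i j := by decide +kernel

/-- A cyclic shift of four slots is odd, unlike the shift of three slots in `sInt_rotate`. -/
theorem pInt_move : ∀ m i j k, pInt m i j k = -pInt i j k m := by decide +kernel

theorem sInt_rotate : ∀ i j k, sInt i j k = sInt j k i := by decide +kernel

theorem sum_sInt_mul_pInt : ∀ m, ∑ i, ∑ j, ∑ k, sInt i j k * pInt m i j k = 0 := by
  decide +kernel

/-- With the factor 1/2! of the two-form contraction, this says that *(σ∧·) acts as 2 on the forms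
u⌟σ; hence the eigenvalue 3 of ξ. -/
theorem sum_sum_sInt_mul_pInt : ∀ m k l, ∑ i, ∑ j, sInt m i j * pInt i j k l = 4 * sInt m k l := by
  decide +kernel

/-- Divided by 3!, the constant gives the -4 relating f¹ to *(θ∧σ). The sign comes from the free
index being last in one factor and first in the other. -/
theorem sum_pInt_mul_pInt : ∀ m n, ∑ i, ∑ j, ∑ k, pInt i j k m * pInt n i j k
    = -24 * deltaInt m n := by
  decide +kernel

theorem sum_sInt_mul_self : ∑ i, ∑ j, ∑ k, sInt i j k * sInt i j k = 42 := by
  decide +kernel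

/-! ### Pointwise identities for σ and *σ in an adapted frame -/

section Pointwise

variable {V : Type*} [AddCommGroup V] [Module ℝ V] [TopologicalSpace V] (L : V ≃L[ℝ] E7)

/-- The three-form induced by `L`. -/
def inducedForm : V [⋀^Fin 3]→L[ℝ] ℝ := stdForm.compContinuousLinearMap (L : V →L[ℝ] E7)

theorem co_inducedForm (I : Fin 3 → Fin 7) :
    co L (inducedForm L) I = (sInt (I 0) (I 1) (I 2) : ℝ) := by
  rw [← co_stdForm]
  simp [co, inducedForm, frame, Function.comp_def]

theorem co_smul_add [ContinuousConstSMul ℝ V] {k : ℕ} {η ζ : V [⋀^Fin k]→L[ℝ] ℝ} (c : ℝ) {K : Fin k → Fin 7} {a b : ℝ}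
    (hη : co L η K = a) (hζ : co L ζ K = b) : co L (c • η + ζ) K = c * a + b := by
  rw [co_add, co_smul, hη, hζ]

variable [IsTopologicalAddGroup V] [ContinuousConstSMul ℝ V]

/-- The Hodge dual of the three-form induced by `L`. -/
def inducedDual : V [⋀^Fin 4]→L[ℝ] ℝ :=
  hodgeStar L (k := 3) (l := 4) (by norm_num) (inducedForm L)

theorem co_inducedDual (I : Fin 4 → Fin 7) :
    co L (inducedDual L) I = (pInt (I 0) (I 1) (I 2) (I 3) : ℝ) := by
  rw [inducedDual, ← co_hodgeStar_stdForm, co_hodgeStar, co_hodgeStar]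
  simp only [co_inducedForm, co_stdForm]

variable (α : V [⋀^Fin 1]→L[ℝ] ℝ) (γ : V [⋀^Fin 2]→L[ℝ] ℝ) (θ : V [⋀^Fin 3]→L[ℝ] ℝ)

theorem star_inducedDual :
    hodgeStar L (k := 4) (l := 3) (by norm_num) (inducedDual L) = (inducedForm L) :=
  hodgeStar_hodgeStar L _ _ _

theorem co_star_wedge_dual_one (I : Fin 2 → Fin 7) :
    co L (hodgeStar L (k := 5) (l := 2) (by norm_num) (wedge α (inducedDual L))) I
      = ∑ i, co L α ![i] * (sInt (I 0) (I 1) i : ℝ) := by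
  refine (co_hodgeStar_wedge_left (p := 1) (q := 4) (l := 2) L (by norm_num) (by norm_num)
    α (inducedDual L) I).trans ?_
  rw [sum_fin_one]
  have h : ∀ i, co L (hodgeStar L (k := 4) (l := 3) (by norm_num) (inducedDual L)) (Fin.append I ![i])
      = (sInt (I 0) (I 1) i : ℝ) := by
    intro i
    rw [star_inducedDual, co_inducedForm]
    rfl
  refine (congrArg _ (Finset.sum_congr rfl fun i _ => congrArg _ (h i))).trans ?_
  simp

theorem star_wedge_dual_comm :
    hodgeStar L (k := 5) (l := 2) (by norm_num) (wedge (inducedDual L) α)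
      = hodgeStar L (k := 5) (l := 2) (by norm_num) (wedge α (inducedDual L)) := by
  refine ext_co L fun I => ?_
  rw [co_star_wedge_dual_one]
  refine (co_hodgeStar_wedge_right (p := 1) (q := 4) (l := 2) L (by norm_num) (by norm_num)
    (inducedDual L) α I).trans ?_
  rw [sum_fin_one]
  have h : ∀ i, co L (hodgeStar L (k := 4) (l := 3) (by norm_num) (inducedDual L)) (Fin.append ![i] I)
      = (sInt (I 0) (I 1) i : ℝ) := by
    intro i
    rw [star_inducedDual, co_inducedForm, sInt_rotate]
    rfl
  refine (congrArg _ (Finset.sum_congr rfl fun i _ => congrArg _ (h i))).trans ?_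
  simp

theorem co_star_wedge_dual_two (I : Fin 1 → Fin 7) :
    co L (hodgeStar L (k := 6) (l := 1) (by norm_num) (wedge γ (inducedDual L))) I
      = 2⁻¹ * ∑ i, ∑ j, co L γ ![i, j] * (sInt (I 0) i j : ℝ) := by
  refine (co_hodgeStar_wedge_left (p := 2) (q := 4) (l := 1) L (by norm_num) (by norm_num)
    γ (inducedDual L) I).trans ?_
  rw [sum_fin_two]
  have h : ∀ i j, co L (hodgeStar L (k := 4) (l := 3) (by norm_num) (inducedDual L)) (Fin.append I ![i, j])
      = (sInt (I 0) i j : ℝ) := by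
    intro i j
    rw [star_inducedDual, co_inducedForm]
    rfl
  refine (congrArg _ (Finset.sum_congr rfl fun i _ => Finset.sum_congr rfl fun j _ =>
    congrArg _ (h i j))).trans ?_
  simp

theorem co_star_wedge_two (I : Fin 2 → Fin 7) :
    co L (hodgeStar L (k := 5) (l := 2) (by norm_num) (wedge (inducedForm L) γ)) I
      = 2⁻¹ * ∑ i, ∑ j, co L γ ![i, j] * (pInt i j (I 0) (I 1) : ℝ) := by
  refine (co_hodgeStar_wedge_right (p := 2) (q := 3) (l := 2) L (by norm_num) (by norm_num)
    (inducedForm L) γ I).trans ?_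
  rw [sum_fin_two]
  have h : ∀ i j, co L (inducedDual L) (Fin.append ![i, j] I) = (pInt i j (I 0) (I 1) : ℝ) := by
    intro i j
    rw [co_inducedDual]
    rfl
  refine (congrArg _ (Finset.sum_congr rfl fun i _ => Finset.sum_congr rfl fun j _ =>
    congrArg _ (h i j))).trans ?_
  simp

theorem star_wedge_two_comm :
    hodgeStar L (k := 5) (l := 2) (by norm_num) (wedge γ (inducedForm L))
      = hodgeStar L (k := 5) (l := 2) (by norm_num) (wedge (inducedForm L) γ) := by
  refine ext_co L fun I => ?_
  rw [co_star_wedge_two]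
  refine (co_hodgeStar_wedge_left (p := 2) (q := 3) (l := 2) L (by norm_num) (by norm_num)
    γ (inducedForm L) I).trans ?_
  rw [sum_fin_two]
  have h : ∀ i j, co L (inducedDual L) (Fin.append I ![i, j]) = (pInt i j (I 0) (I 1) : ℝ) := by
    intro i j
    rw [co_inducedDual, pInt_comm]
    rfl
  refine (congrArg _ (Finset.sum_congr rfl fun i _ => Finset.sum_congr rfl fun j _ =>
    congrArg _ (h i j))).trans ?_
  simp

theorem co_star_wedge_one (I : Fin 3 → Fin 7) :
    co L (hodgeStar L (k := 4) (l := 3) (by norm_num) (wedge α (inducedForm L))) I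
      = ∑ i, co L α ![i] * (pInt (I 0) (I 1) (I 2) i : ℝ) := by
  refine (co_hodgeStar_wedge_left (p := 1) (q := 3) (l := 3) L (by norm_num) (by norm_num)
    α (inducedForm L) I).trans ?_
  rw [sum_fin_one]
  have h : ∀ i, co L (inducedDual L) (Fin.append I ![i]) = (pInt (I 0) (I 1) (I 2) i : ℝ) := by
    intro i
    rw [co_inducedDual]
    rfl
  refine (congrArg _ (Finset.sum_congr rfl fun i _ => congrArg _ (h i))).trans ?_
  simp

theorem co_star_wedge_three (I : Fin 1 → Fin 7) :
    co L (hodgeStar L (k := 6) (l := 1) (by norm_num) (wedge θ (inducedForm L))) I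
      = 6⁻¹ * ∑ i, ∑ j, ∑ k, co L θ ![i, j, k] * (pInt (I 0) i j k : ℝ) := by
  refine (co_hodgeStar_wedge_left (p := 3) (q := 3) (l := 1) L (by norm_num) (by norm_num)
    θ (inducedForm L) I).trans ?_
  rw [sum_fin_three]
  have h : ∀ i j k, co L (inducedDual L) (Fin.append I ![i, j, k]) = (pInt (I 0) i j k : ℝ) := by
    intro i j k
    rw [co_inducedDual]
    rfl
  refine (congrArg _ (Finset.sum_congr rfl fun i _ => Finset.sum_congr rfl fun j _ =>
    Finset.sum_congr rfl fun k _ => congrArg _ (h i j k))).trans ?_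
  simp [Nat.factorial]

theorem co_star_wedge_dual_three (I : Fin 0 → Fin 7) :
    co L (hodgeStar L (k := 7) (l := 0) (by norm_num) (wedge θ (inducedDual L))) I
      = 6⁻¹ * ∑ i, ∑ j, ∑ k, co L θ ![i, j, k] * (sInt i j k : ℝ) := by
  refine (co_hodgeStar_wedge_left (p := 3) (q := 4) (l := 0) L (by norm_num) (by norm_num)
    θ (inducedDual L) I).trans ?_
  rw [sum_fin_three]
  have h : ∀ i j k, co L (hodgeStar L (k := 4) (l := 3) (by norm_num) (inducedDual L)) (Fin.append I ![i, j, k])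
      = (sInt i j k : ℝ) := by
    intro i j k
    rw [star_inducedDual, co_inducedForm]
    rfl
  refine (congrArg _ (Finset.sum_congr rfl fun i _ => Finset.sum_congr rfl fun j _ =>
    Finset.sum_congr rfl fun k _ => congrArg _ (h i j k))).trans ?_
  simp [Nat.factorial]

/-- `α_♯ ⌟ σ = *(α ∧ *σ)`. -/
theorem contract_sharp :
    contract (k := 2) (by norm_num) (sharp L α) (inducedForm L)
      = hodgeStar L (k := 5) (l := 2) (by norm_num) (wedge α (inducedDual L)) := by
  refine ext_co L fun I => ?_
  rw [co_star_wedge_dual_one]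
  have h : ∀ u : V, co L (contract (k := 2) (by norm_num) u (inducedForm L)) I
      = (inducedForm L).toAlternatingMap ![u, frame L (I 0), frame L (I 1)] := by
    intro u
    show (inducedForm L) _ = (inducedForm L) _
    congr 1
    ext x
    fin_cases x <;> rfl
  rw [h]
  have h2 : ∀ u : V, (inducedForm L).toAlternatingMap ![u, frame L (I 0), frame L (I 1)]
      = (inducedForm L).toAlternatingMap.toMultilinearMap.toLinearMap
        ![0, frame L (I 0), frame L (I 1)] 0 u := by
    intro u
    show (inducedForm L) _ = (inducedForm L) _
    congr 1
    ext x
    fin_cases x <;> simp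
  rw [h2, sharp, map_sum]
  refine Finset.sum_congr rfl fun i _ => ?_
  rw [map_smul, smul_eq_mul, ← h2]
  have h3 : co L α ![i] = α fun _ => frame L i := by
    simp only [co]
    congr 1
    ext x
    fin_cases x
    rfl
  rw [h3, sInt_rotate, sInt_rotate]
  congr 1
  refine Eq.trans ?_ (co_inducedForm L ![i, I 0, I 1])
  show (inducedForm L) _ = (inducedForm L) _
  congr 1
  ext x
  fin_cases x <;> rfl

/-- `*(*(γ ∧ *σ) ∧ *σ) = γ + *(σ ∧ γ)`. -/
theorem star_wedge_star_wedge :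
    hodgeStar L (k := 5) (l := 2) (by norm_num)
      (wedge (hodgeStar L (k := 6) (l := 1) (by norm_num) (wedge γ (inducedDual L))) (inducedDual L))
      = γ + hodgeStar L (k := 5) (l := 2) (by norm_num) (wedge (inducedForm L) γ) := by
  refine ext_co L fun I => ?_
  rw [co_star_wedge_dual_one, co_add, co_star_wedge_two]
  simp only [co_star_wedge_dual_two]
  -- Contracted with γ, the two delta terms give 2γ by antisymmetry, which the factor 1/2 reduces to
  -- γ; the remaining term is *(σ∧γ).
  have key : ∀ i j, ∑ m, (sInt m i j : ℝ) * sInt (I 0) (I 1) m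
      = deltaInt (I 0) i * deltaInt (I 1) j - deltaInt (I 0) j * deltaInt (I 1) i
        + pInt i j (I 0) (I 1) := by
    intro i j
    rw [pInt_comm]
    have := sum_sInt_mul_sInt (I 0) (I 1) i j
    simp only [mul_comm (sInt (I 0) (I 1) _)] at this
    exact_mod_cast this
  have h1 : co L γ I = co L γ ![I 0, I 1] := by
    congr 1
    ext x
    fin_cases x <;> rfl
  have h2 : co L γ ![I 1, I 0] = -co L γ ![I 0, I 1] := by
    have := co_comp L γ ![I 0, I 1] (Equiv.swap 0 1)
    rw [Equiv.Perm.sign_swap (by decide)] at this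
    have h3 : (![I 0, I 1] ∘ ⇑(Equiv.swap 0 1) : Fin 2 → Fin 7) = ![I 1, I 0] := by
      ext x
      fin_cases x <;> rfl
    rw [h3] at this
    simpa using this
  calc ∑ m, (2⁻¹ * ∑ i, ∑ j, co L γ ![i, j] * (sInt (![m] 0) i j : ℝ)) * sInt (I 0) (I 1) m
      = 2⁻¹ * ∑ i, ∑ j, co L γ ![i, j] * ∑ m, (sInt m i j : ℝ) * sInt (I 0) (I 1) m := by
        simp only [Finset.mul_sum, Finset.sum_mul]
        rw [Finset.sum_comm]
        refine Finset.sum_congr rfl fun i _ => ?_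
        rw [Finset.sum_comm]
        refine Finset.sum_congr rfl fun j _ => Finset.sum_congr rfl fun m _ => ?_
        rw [Matrix.cons_val_zero]
        ring
    _ = _ := by
        simp only [key, mul_add, mul_sub, Finset.sum_add_distrib, Finset.sum_sub_distrib]
        simp only [deltaInt, Int.cast_ite, Int.cast_one, Int.cast_zero, mul_ite, mul_one, mul_zero,
          Finset.sum_ite_eq, Finset.mem_univ, if_true, Finset.sum_ite_irrel,
          Finset.sum_const_zero]
        rw [h1, h2]
        ring

/-- `*(α ∧ *σ)` lies in the eigenspace of `ξ` with eigenvalue three. -/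
theorem star_wedge_dual_add :
    hodgeStar L (k := 5) (l := 2) (by norm_num) (wedge α (inducedDual L))
      + hodgeStar L (k := 5) (l := 2) (by norm_num)
        (wedge (inducedForm L) (hodgeStar L (k := 5) (l := 2) (by norm_num) (wedge α (inducedDual L))))
      = (3 : ℝ) • hodgeStar L (k := 5) (l := 2) (by norm_num) (wedge α (inducedDual L)) := by
  refine ext_co L fun I => ?_
  rw [co_smul, co_add, co_star_wedge_two]
  simp only [co_star_wedge_dual_one]
  -- The 4 is halved by the star formula and added to the identity: 1 + 2 = 3.
  have key : ∀ m, ∑ i, ∑ j, (sInt i j m : ℝ) * pInt i j (I 0) (I 1)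
      = 4 * sInt (I 0) (I 1) m := by
    intro m
    have := sum_sum_sInt_mul_pInt m (I 0) (I 1)
    simp only [sInt_rotate m] at this
    exact_mod_cast this
  have h : ∑ i, ∑ j, (∑ m, co L α ![m] * (sInt (![i, j] 0) (![i, j] 1) m : ℝ))
      * pInt i j (I 0) (I 1)
      = ∑ m, co L α ![m] * ∑ i, ∑ j, (sInt i j m : ℝ) * pInt i j (I 0) (I 1) := by
    simp only [Finset.mul_sum, Finset.sum_mul]
    symm
    rw [Finset.sum_comm]
    refine Finset.sum_congr rfl fun i _ => ?_
    rw [Finset.sum_comm]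
    refine Finset.sum_congr rfl fun j _ => Finset.sum_congr rfl fun m _ => ?_
    rw [Matrix.cons_val_zero, Matrix.cons_val_one, Matrix.cons_val_zero]
    ring
  rw [h]
  simp only [key]
  simp only [mul_left_comm _ (4 : ℝ), ← Finset.mul_sum]
  ring

theorem co_star_wedge_add {p q l : ℕ} (h : p + q + l = 7) (η : V [⋀^Fin p]→L[ℝ] ℝ)
    {ζ : V [⋀^Fin p]→L[ℝ] ℝ} {β : V [⋀^Fin q]→L[ℝ] ℝ} (hζ : wedge ζ β = 0) (I : Fin l → Fin 7) :
    co L (hodgeStar L h (wedge (η + ζ) β)) I = co L (hodgeStar L h (wedge η β)) I := by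
  rw [wedge_add_left, hζ, add_zero]

variable (f0 : ℝ) (f1 : V [⋀^Fin 1]→L[ℝ] ℝ) (f3 : V [⋀^Fin 3]→L[ℝ] ℝ)

/-- The first component of a three-form is determined by `*(θ ∧ *σ)`. -/
theorem co_star_wedge_dual_decomposition (h3 : wedge f3 (inducedDual L) = 0) (I : Fin 0 → Fin 7) :
    co L (hodgeStar L (k := 7) (l := 0) (by norm_num) (wedge (f0 • inducedForm L
      + hodgeStar L (k := 4) (l := 3) (by norm_num) (wedge f1 (inducedForm L)) + f3)
        (inducedDual L))) I = 7 * f0 := by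
  have h0 := co_star_wedge_add L (p := 3) (q := 4) (l := 0) (by norm_num) (f0 • inducedForm L
    + hodgeStar L (k := 4) (l := 3) (by norm_num) (wedge f1 (inducedForm L))) h3 I
  refine h0.trans ?_
  have hc : ∀ K : Fin 3 → Fin 7, co L (f0 • inducedForm L
      + hodgeStar L (k := 4) (l := 3) (by norm_num) (wedge f1 (inducedForm L))) K
        = f0 * (sInt (K 0) (K 1) (K 2) : ℝ)
          + ∑ m, co L f1 ![m] * (pInt (K 0) (K 1) (K 2) m : ℝ) :=
    fun K => co_smul_add L f0 (co_inducedForm L K) (co_star_wedge_one L f1 K)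
  generalize f0 • inducedForm L
    + hodgeStar L (k := 4) (l := 3) (by norm_num) (wedge f1 (inducedForm L)) = η at hc ⊢
  refine (co_star_wedge_dual_three L η I).trans ?_
  simp only [hc, add_mul, Finset.sum_add_distrib]
  -- The value 42 = 3! · 7 counts the orderings of the seven monomials of σ; division by 3! leaves
  -- |σ|² = 7.
  have h1 : ∑ i, ∑ j, ∑ k, f0 * (sInt (![i, j, k] 0) (![i, j, k] 1) (![i, j, k] 2) : ℝ)
      * sInt i j k = f0 * 42 := by
    have : (∑ i, ∑ j, ∑ k, (sInt i j k : ℝ) * sInt i j k) = 42 := by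
      exact_mod_cast sum_sInt_mul_self
    rw [← this]
    simp only [Finset.mul_sum, ← mul_assoc]
    rfl
  -- The summands σ and *(f¹∧σ) are orthogonal, so f¹ does not contribute.
  have h2 : ∑ i, ∑ j, ∑ k, (∑ m, co L f1 ![m]
      * (pInt (![i, j, k] 0) (![i, j, k] 1) (![i, j, k] 2) m : ℝ)) * sInt i j k = 0 := by
    have key : ∀ m, ∑ i, ∑ j, ∑ k, (pInt i j k m : ℝ) * sInt i j k = 0 := by
      intro m
      have := sum_sInt_mul_pInt m
      simp only [mul_comm (sInt _ _ _), pInt_move m] at this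
      simp only [neg_mul, Finset.sum_neg_distrib, neg_eq_zero] at this
      exact_mod_cast this
    have h : ∑ i, ∑ j, ∑ k, (∑ m, co L f1 ![m] * (pInt i j k m : ℝ)) * sInt i j k
        = ∑ m, co L f1 ![m] * ∑ i, ∑ j, ∑ k, (pInt i j k m : ℝ) * sInt i j k := by
      simp only [Finset.mul_sum, Finset.sum_mul]
      symm
      rw [Finset.sum_comm]
      refine Finset.sum_congr rfl fun i _ => ?_
      rw [Finset.sum_comm]
      refine Finset.sum_congr rfl fun j _ => ?_
      rw [Finset.sum_comm]
      refine Finset.sum_congr rfl fun k _ => Finset.sum_congr rfl fun m _ => ?_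
      ring
    refine Eq.trans h ?_
    simp [key]
  rw [h1, h2]
  ring

/-- The second component of a three-form is determined by `*(θ ∧ σ)`. -/
theorem star_wedge_decomposition (h3 : wedge f3 (inducedForm L) = 0) :
    hodgeStar L (k := 6) (l := 1) (by norm_num) (wedge (f0 • inducedForm L
      + hodgeStar L (k := 4) (l := 3) (by norm_num) (wedge f1 (inducedForm L)) + f3)
        (inducedForm L)) = (-4 : ℝ) • f1 := by
  refine ext_co L fun I => ?_
  have h0 := co_star_wedge_add L (p := 3) (q := 3) (l := 1) (by norm_num) (f0 • inducedForm L
    + hodgeStar L (k := 4) (l := 3) (by norm_num) (wedge f1 (inducedForm L))) h3 I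
  refine h0.trans ?_
  have hc : ∀ K : Fin 3 → Fin 7, co L (f0 • inducedForm L
      + hodgeStar L (k := 4) (l := 3) (by norm_num) (wedge f1 (inducedForm L))) K
        = f0 * (sInt (K 0) (K 1) (K 2) : ℝ)
          + ∑ m, co L f1 ![m] * (pInt (K 0) (K 1) (K 2) m : ℝ) :=
    fun K => co_smul_add L f0 (co_inducedForm L K) (co_star_wedge_one L f1 K)
  generalize f0 • inducedForm L
    + hodgeStar L (k := 4) (l := 3) (by norm_num) (wedge f1 (inducedForm L)) = η at hc ⊢
  refine (co_star_wedge_three L η I).trans ?_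
  simp only [hc, add_mul, Finset.sum_add_distrib]
  have h1 : ∑ i, ∑ j, ∑ k, f0 * (sInt (![i, j, k] 0) (![i, j, k] 1) (![i, j, k] 2) : ℝ)
      * pInt (I 0) i j k = 0 := by
    have : (∑ i, ∑ j, ∑ k, (sInt i j k : ℝ) * pInt (I 0) i j k) = 0 := by
      exact_mod_cast sum_sInt_mul_pInt (I 0)
    rw [← mul_zero f0, ← this]
    simp only [Finset.mul_sum, ← mul_assoc]
    rfl
  -- The prefactor 1/6 turns -24 into the -4 of the statement.
  have h2 : ∑ i, ∑ j, ∑ k, (∑ m, co L f1 ![m]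
      * (pInt (![i, j, k] 0) (![i, j, k] 1) (![i, j, k] 2) m : ℝ)) * pInt (I 0) i j k
      = -24 * co L f1 I := by
    have key : ∀ m, ∑ i, ∑ j, ∑ k, (pInt i j k m : ℝ) * pInt (I 0) i j k
        = -24 * deltaInt m (I 0) := by
      intro m
      exact_mod_cast sum_pInt_mul_pInt m (I 0)
    have h : ∑ i, ∑ j, ∑ k, (∑ m, co L f1 ![m] * (pInt i j k m : ℝ)) * pInt (I 0) i j k
        = ∑ m, co L f1 ![m] * ∑ i, ∑ j, ∑ k, (pInt i j k m : ℝ) * pInt (I 0) i j k := by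
      simp only [Finset.mul_sum, Finset.sum_mul]
      symm
      rw [Finset.sum_comm]
      refine Finset.sum_congr rfl fun i _ => ?_
      rw [Finset.sum_comm]
      refine Finset.sum_congr rfl fun j _ => ?_
      rw [Finset.sum_comm]
      refine Finset.sum_congr rfl fun k _ => Finset.sum_congr rfl fun m _ => ?_
      ring
    refine Eq.trans h ?_
    have h4 : co L f1 I = co L f1 ![I 0] := by
      congr 1
      ext x
      fin_cases x
      rfl
    simp only [key, h4]
    simp only [deltaInt, Int.cast_ite, Int.cast_one, Int.cast_zero, mul_ite, mul_one, mul_zero,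
      Finset.sum_ite_eq', Finset.mem_univ, if_true]
    ring
  rw [h1, h2, co_smul]
  ring

end Pointwise

/-! ### Exterior derivatives in coordinates -/

section Antisymmetric

variable {n : ℕ}

/-- A family indexed by tuples that changes by the sign under permutations of the tuple. -/
def IsAntisymm (F : (Fin n → Fin 7) → ℝ) : Prop :=
  ∀ I (π : Equiv.Perm (Fin n)), F (I ∘ π) = (Equiv.Perm.sign π : ℤ) * F I

theorem isAntisymm_epsAppend {l : ℕ} (h : n + l = 7) (K : Fin l → Fin 7) :
    IsAntisymm fun I => epsAppend h I K :=
  fun I π => epsAppend_comp_left h I K π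

/-- Moving an entry from position p to the front is a cycle of length p + 1. -/
theorem IsAntisymm.insertNth {F : (Fin (n + 1) → Fin 7) → ℝ} (hF : IsAntisymm F)
    (p : Fin (n + 1)) (i : Fin 7) (J : Fin n → Fin 7) :
    F (p.insertNth i J) = (-1) ^ (p : ℕ) * F (Matrix.vecCons i J) := by
  have h := hF (Matrix.vecCons i J) p.cycleRange
  have e : (Matrix.vecCons i J) ∘ p.cycleRange = p.insertNth i J := by
    ext x
    refine congrArg Fin.val ?_
    revert x
    rw [Fin.forall_iff_succAbove p]
    constructor
    · simp
    · intro x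
      simp
  rw [e, Fin.sign_cycleRange] at h
  rw [h]
  simp

theorem IsAntisymm.vecCons {F : (Fin (n + 1) → Fin 7) → ℝ} (hF : IsAntisymm F) (i : Fin 7) :
    IsAntisymm fun J => F (Matrix.vecCons i J) := by
  intro J π
  have h := hF (Matrix.vecCons i J) (Equiv.Perm.decomposeFin.symm (0, π))
  rw [Equiv.Perm.decomposeFin.symm_sign] at h
  simp only [if_true, one_mul] at h
  refine Eq.trans (congrArg F ?_) h
  funext x
  refine Fin.cases ?_ (fun x => ?_) x <;> simp

theorem sum_co_wedge_mul {p q : ℕ} (α : E7 [⋀^Fin p]→L[ℝ] ℝ) (β : E7 [⋀^Fin q]→L[ℝ] ℝ)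
    {F : (Fin (p + q) → Fin 7) → ℝ} (hF : IsAntisymm F) :
    ∑ I, co (.refl ℝ E7) (wedge α β) I * F I
      = ((p + q).factorial : ℝ) * ((p.factorial : ℝ) * (q.factorial : ℝ))⁻¹ *
        ∑ I, ∑ J, co (.refl ℝ E7) α I * co (.refl ℝ E7) β J * F (Fin.append I J) := by
  have h1 := sum_antisymm_mul
    (fun I : Fin (p + q) → Fin 7 => co (.refl ℝ E7) α (fun i => I (Fin.castAdd q i)) *
          co (.refl ℝ E7) β (fun j => I (Fin.natAdd p j))) F hF
  simp only [co_wedge]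
  simp only [mul_assoc, ← Finset.mul_sum] at h1 ⊢
  rw [h1, sum_fin_append]
  simp only [Fin.append_left, Fin.append_right, Finset.mul_sum]
  refine Finset.sum_congr rfl fun I _ => Finset.sum_congr rfl fun J _ => ?_
  ring

/-- The partial derivative of a coordinate of a form. -/
def dco {k : ℕ} (ω : E7 → E7 [⋀^Fin k]→L[ℝ] ℝ) (y : E7) (i : Fin 7) (J : Fin k → Fin 7) : ℝ :=
  fderiv ℝ (fun z => co (.refl ℝ E7) (ω z) J) y (stdVec i)

/-- The exterior derivative is an alternating sum over the slot p that carries the differentiation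
index. Against an antisymmetric F, moving this index to the front cancels the sign (-1)^p, so the n
+ 1 terms agree. -/
theorem sum_co_extDeriv_mul {ω : E7 → E7 [⋀^Fin n]→L[ℝ] ℝ} {y : E7} (hω : DifferentiableAt ℝ ω y)
    {F : (Fin (n + 1) → Fin 7) → ℝ} (hF : IsAntisymm F) :
    ∑ I, co (.refl ℝ E7) (extDeriv ω y) I * F I
      = (n + 1) * ∑ i, ∑ J, dco ω y i J * F (Matrix.vecCons i J) := by
  have h1 : ∀ I, co (.refl ℝ E7) (extDeriv ω y) I
      = ∑ p : Fin (n + 1), (-1) ^ (p : ℕ) * dco ω y (I p) (p.removeNth I) := by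
    intro I
    rw [co, extDeriv_apply hω]
    simp only [zsmul_eq_mul]
    refine Finset.sum_congr rfl fun p _ => ?_
    simp [dco, co, frame, Fin.removeNth]
    rfl
  simp only [h1, Finset.sum_mul]
  rw [Finset.sum_comm]
  have h2 : ∀ p : Fin (n + 1), ∑ I, (-1) ^ (p : ℕ) * dco ω y (I p) (p.removeNth I) * F I
      = ∑ i, ∑ J, dco ω y i J * F (Matrix.vecCons i J) := by
    intro p
    rw [← (Fin.insertNthEquiv (fun _ => Fin 7) p).sum_comp, Fintype.sum_prod_type]
    refine Finset.sum_congr rfl fun i _ => Finset.sum_congr rfl fun J _ => ?_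
    have e : (Fin.insertNthEquiv (fun _ => Fin 7) p) (i, J) = p.insertNth i J := rfl
    rw [e, hF.insertNth, Fin.insertNth_apply_same, Fin.removeNth_insertNth]
    have : ((-1 : ℝ) ^ (p : ℕ)) * (-1) ^ (p : ℕ) = 1 := by
      rw [← mul_pow]; simp
    linear_combination dco ω y i J * F (Matrix.vecCons i J) * this
  rw [Finset.sum_congr rfl fun p _ => h2 p]
  simp

theorem co_hodgeStar_extDeriv {k l : ℕ} (h : k + 1 + l = 7) {ω : E7 → E7 [⋀^Fin k]→L[ℝ] ℝ} {y : E7}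
    (hω : DifferentiableAt ℝ ω y) (K : Fin l → Fin 7) :
    co (.refl ℝ E7) (hodgeStar (.refl ℝ E7) h (extDeriv ω y)) K
      = (k.factorial : ℝ)⁻¹ * ∑ i, ∑ J, dco ω y i J * epsAppend h (Matrix.vecCons i J) K := by
  rw [co_hodgeStar, sum_co_extDeriv_mul hω (isAntisymm_epsAppend h K), Nat.factorial_succ]
  push_cast
  have : (k.factorial : ℝ) ≠ 0 := by positivity
  field_simp

end Antisymmetric

/-! ### Regularity through coordinates -/

section Regularity

variable {k l : ℕ}

theorem frame_refl (i : Fin 7) : frame (.refl ℝ E7) i = stdVec i := rfl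

/-- Unfolding ** = 1 writes η as a combination of fixed forms whose coefficients are linear in its
coordinates. This reduces regularity of a form-valued map to that of scalar functions. The
complementary degree l witnesses k ≤ 7, here and in the regularity lemmas built on this. -/
theorem eq_sum_co (h : k + l = 7) (η : E7 [⋀^Fin k]→L[ℝ] ℝ) :
    η = (l.factorial : ℝ)⁻¹ • ∑ J : Fin l → Fin 7,
      ((k.factorial : ℝ)⁻¹ * ∑ I, co (.refl ℝ E7) η I * epsAppend h I J) •
        insertVectors (h ▸ Nat.add_comm l k : l + k = 7) (fun j => stdVec (J j)) stdVol := by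
  have h' : l + k = 7 := by omega
  have h1 := hodgeStar_hodgeStar (.refl ℝ E7) h h' η
  rw [hodgeStar] at h1
  have h2 : stdVol.compContinuousLinearMap ((ContinuousLinearEquiv.refl ℝ E7 : E7 ≃L[ℝ] E7) :
      E7 →L[ℝ] E7) = stdVol := by
    ext v
    rw [ContinuousAlternatingMap.compContinuousLinearMap_apply]
    exact congrArg stdVol (funext fun i => rfl)
  simp only [frame_refl, h2] at h1
  refine h1.symm.trans ?_
  congr 1
  refine Finset.sum_congr rfl fun J _ => ?_
  rw [← co_hodgeStar, co]
  simp only [frame_refl]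

theorem contDiffOn_iff_co (h : k + l = 7) {n : WithTop ℕ∞} {ω : E7 → E7 [⋀^Fin k]→L[ℝ] ℝ}
    {U : Set E7} :
    ContDiffOn ℝ n ω U ↔ ∀ I, ContDiffOn ℝ n (fun y => co (.refl ℝ E7) (ω y) I) U := by
  constructor
  · intro hω I
    exact (ContinuousAlternatingMap.apply ℝ E7 ℝ _ : _ →L[ℝ] ℝ).contDiff.comp_contDiffOn hω
  · intro hω
    rw [show ω = fun y => _ from funext fun y => eq_sum_co h (ω y)]
    refine ContDiffOn.const_smul _ (ContDiffOn.sum fun J _ =>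
      ContDiffOn.fun_smul ?_ contDiffOn_const)
    refine contDiffOn_const.mul (ContDiffOn.sum fun I _ => (hω I).mul contDiffOn_const)

theorem differentiableAt_iff_co (h : k + l = 7) {ω : E7 → E7 [⋀^Fin k]→L[ℝ] ℝ} {y : E7} :
    DifferentiableAt ℝ ω y ↔ ∀ I, DifferentiableAt ℝ (fun z => co (.refl ℝ E7) (ω z) I) y := by
  constructor
  · intro hω I
    exact (ContinuousAlternatingMap.apply ℝ E7 ℝ _ : _ →L[ℝ] ℝ).differentiableAt.comp _ hω
  · intro hω
    rw [show ω = fun y => _ from funext fun y => eq_sum_co h (ω y)]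
    have h1 : ∀ J : Fin l → Fin 7, DifferentiableAt ℝ (fun z =>
        (k.factorial : ℝ)⁻¹ * ∑ I, co (.refl ℝ E7) (ω z) I * epsAppend h I J) y := fun J =>
      DifferentiableAt.const_mul (DifferentiableAt.fun_sum fun I _ => (hω I).mul_const _) _
    have h2 := DifferentiableAt.fun_sum (u := Finset.univ) fun J _ => (h1 J).smul_const
      (insertVectors (h ▸ Nat.add_comm l k : l + k = 7) (fun j => stdVec (J j)) stdVol)
    exact h2.const_smul (l.factorial : ℝ)⁻¹

end Regularity

section Regularity

variable {k l : ℕ}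

variable {p q : ℕ}

theorem contDiffOn_wedge (h : p + k = 7) (h' : q + l = 7) {m : ℕ} (hm : p + q + m = 7)
    {n : WithTop ℕ∞} {α : E7 → E7 [⋀^Fin p]→L[ℝ] ℝ}
    {β : E7 → E7 [⋀^Fin q]→L[ℝ] ℝ} {U : Set E7} (hα : ContDiffOn ℝ n α U)
    (hβ : ContDiffOn ℝ n β U) : ContDiffOn ℝ n (fun y => wedge (α y) (β y)) U := by
  rw [contDiffOn_iff_co h] at hα
  rw [contDiffOn_iff_co h'] at hβ
  rw [contDiffOn_iff_co hm]
  intro I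
  simp only [co_wedge]
  exact contDiffOn_const.mul (ContDiffOn.sum fun π _ => contDiffOn_const.mul ((hα _).mul (hβ _)))

theorem differentiableAt_wedge (h : p + k = 7) (h' : q + l = 7) {m : ℕ} (hm : p + q + m = 7)
    {α : E7 → E7 [⋀^Fin p]→L[ℝ] ℝ}
    {β : E7 → E7 [⋀^Fin q]→L[ℝ] ℝ} {y : E7} (hα : DifferentiableAt ℝ α y)
    (hβ : DifferentiableAt ℝ β y) : DifferentiableAt ℝ (fun y => wedge (α y) (β y)) y := by
  rw [differentiableAt_iff_co h] at hα
  rw [differentiableAt_iff_co h'] at hβ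
  rw [differentiableAt_iff_co hm]
  intro I
  simp only [co_wedge]
  exact DifferentiableAt.const_mul (DifferentiableAt.fun_sum fun π _ =>
    ((hα _).mul (hβ _)).const_mul _) _

end Regularity

/-! ### Leibniz rules -/

theorem epsAppend_assoc {p q l : ℕ} (h : p + q + l = 7) (h' : p + (q + l) = 7) (I : Fin p → Fin 7)
    (J : Fin q → Fin 7) (K : Fin l → Fin 7) :
    epsAppend h (Fin.append I J) K = epsAppend h' I (Fin.append J K) := by
  simp only [epsAppend, Fin.append_assoc]
  rfl

/-- Allows the Leibniz rules to be tested after the star, where both d and ∧ become unalternated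
sums against `epsAppend`. -/
theorem hodgeStar_injective {k l : ℕ} (h : k + l = 7) {η ζ : E7 [⋀^Fin k]→L[ℝ] ℝ}
    (H : hodgeStar (.refl ℝ E7) h η = hodgeStar (.refl ℝ E7) h ζ) : η = ζ := by
  have h' : l + k = 7 := by omega
  rw [← hodgeStar_hodgeStar (.refl ℝ E7) h h' η, H, hodgeStar_hodgeStar]

theorem differentiableAt_co {k : ℕ} {ω : E7 → E7 [⋀^Fin k]→L[ℝ] ℝ} {y : E7}
    (hω : DifferentiableAt ℝ ω y) (I : Fin k → Fin 7) :
    DifferentiableAt ℝ (fun z => co (.refl ℝ E7) (ω z) I) y := by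
  exact (ContinuousAlternatingMap.apply ℝ E7 ℝ _ : _ →L[ℝ] ℝ).differentiableAt.comp _ hω

/-- Both sides are derivatives of the same function: `sum_co_wedge_mul` holds at every point, so the
product rule and uniqueness of the derivative give the claim. -/
theorem sum_dco_wedge_mul {p q : ℕ} {α : E7 → E7 [⋀^Fin p]→L[ℝ] ℝ} {β : E7 → E7 [⋀^Fin q]→L[ℝ] ℝ}
    {y : E7} (hα : DifferentiableAt ℝ α y) (hβ : DifferentiableAt ℝ β y)
    (hw : DifferentiableAt ℝ (fun z => wedge (α z) (β z)) y)
    {F : (Fin (p + q) → Fin 7) → ℝ} (hF : IsAntisymm F) (i : Fin 7) :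
    ∑ J, dco (fun z => wedge (α z) (β z)) y i J * F J
      = ((p + q).factorial : ℝ) * ((p.factorial : ℝ) * (q.factorial : ℝ))⁻¹ *
        ∑ I, ∑ J, (dco α y i I * co (.refl ℝ E7) (β y) J
          + co (.refl ℝ E7) (α y) I * dco β y i J) * F (Fin.append I J) := by
  have h1 : HasFDerivAt (fun z => ∑ J, co (.refl ℝ E7) (wedge (α z) (β z)) J * F J)
      (∑ J, F J • fderiv ℝ (fun z => co (.refl ℝ E7) (wedge (α z) (β z)) J) y) y :=
    HasFDerivAt.fun_sum fun J _ => (differentiableAt_co hw J).hasFDerivAt.mul_const _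
  have h2 : HasFDerivAt (fun z => ((p + q).factorial : ℝ) *
        ((p.factorial : ℝ) * (q.factorial : ℝ))⁻¹ *
        ∑ I, ∑ J, co (.refl ℝ E7) (α z) I * co (.refl ℝ E7) (β z) J * F (Fin.append I J))
      ((((p + q).factorial : ℝ) * ((p.factorial : ℝ) * (q.factorial : ℝ))⁻¹) •
        ∑ I, ∑ J, F (Fin.append I J) •
          (co (.refl ℝ E7) (α y) I • fderiv ℝ (fun z => co (.refl ℝ E7) (β z) J) y
            + co (.refl ℝ E7) (β y) J • fderiv ℝ (fun z => co (.refl ℝ E7) (α z) I) y)) y :=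
    (HasFDerivAt.fun_sum fun I _ => HasFDerivAt.fun_sum fun J _ =>
      ((differentiableAt_co hα I).hasFDerivAt.mul
        (differentiableAt_co hβ J).hasFDerivAt).mul_const _).const_mul _
  simp only [sum_co_wedge_mul _ _ hF] at h1
  have h3 := congrArg (fun T : E7 →L[ℝ] ℝ => T (stdVec i)) (h1.unique h2)
  simp only [_root_.sum_apply, _root_.smul_apply, _root_.add_apply, smul_eq_mul] at h3
  simp only [dco]
  rw [Finset.sum_congr rfl fun J _ => mul_comm _ (F J), h3]
  congr 1
  refine Finset.sum_congr rfl fun I _ => Finset.sum_congr rfl fun J _ => ?_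
  ring

theorem hodgeStar_sub {V : Type*} [AddCommGroup V] [Module ℝ V] [TopologicalSpace V]
    [IsTopologicalAddGroup V] [ContinuousConstSMul ℝ V] {k l : ℕ} (L : V ≃L[ℝ] E7)
    (h : k + l = 7) (η ζ : V [⋀^Fin k]→L[ℝ] ℝ) :
    hodgeStar L h (η - ζ) = hodgeStar L h η - hodgeStar L h ζ := by
  refine ext_co L fun K => ?_
  simp only [co_sub, co_hodgeStar, ← mul_sub, ← Finset.sum_sub_distrib, ← sub_mul]

/-- In each product-rule term the differentiation index stands first. For dα∧β it only has to be
regrouped (`hsymm`); for α∧dβ it has to pass the index of α, which produces the minus sign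
(`hswap`). Both are index bookkeeping, settled by evaluation once q and l are numerals. -/
theorem co_hodgeStar_extDeriv_wedge {q l : ℕ} (h : 1 + q + 1 + l = 7) (h₁ : 1 + 1 + q + l = 7)
    (h₂ : 1 + (q + 1) + l = 7) {α : E7 → E7 [⋀^Fin 1]→L[ℝ] ℝ} {β : E7 → E7 [⋀^Fin q]→L[ℝ] ℝ}
    {y : E7} (hα : DifferentiableAt ℝ α y) (hβ : DifferentiableAt ℝ β y) (K : Fin l → Fin 7)
    (hsymm : ∀ (i : Fin 7) (I : Fin 1 → Fin 7) (J : Fin q → Fin 7),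
      epsAppend h (Matrix.vecCons i (Fin.append I J)) K
        = epsAppend h₁ (Fin.append (Matrix.vecCons i I) J) K)
    (hswap : ∀ (i : Fin 7) (I : Fin 1 → Fin 7) (J : Fin q → Fin 7),
      epsAppend h (Matrix.vecCons i (Fin.append I J)) K
        = -epsAppend h₂ (Fin.append I (Matrix.vecCons i J)) K) :
    co (.refl ℝ E7) (hodgeStar (.refl ℝ E7) h (extDeriv (fun z => wedge (α z) (β z)) y)) K
      = co (.refl ℝ E7) (hodgeStar (.refl ℝ E7) h₁ (wedge (extDeriv α y) (β y))) K
        - co (.refl ℝ E7) (hodgeStar (.refl ℝ E7) h₂ (wedge (α y) (extDeriv β y))) K := by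
  have hw : DifferentiableAt ℝ (fun z => wedge (α z) (β z)) y :=
    differentiableAt_wedge (p := 1) (k := 6) (l := 2 + l) (by omega) (by omega)
      (by omega : 1 + q + (1 + l) = 7) hα hβ
  rw [co_hodgeStar_extDeriv h hw, co_hodgeStar_wedge_aux, co_hodgeStar_wedge_aux]
  simp only [fun i => sum_dco_wedge_mul hα hβ hw ((isAntisymm_epsAppend h K).vecCons i) i]
  -- The 2 counts the slots of dα that can carry the differentiation index; in `e2` the
  -- corresponding count is q + 1.
  have e1 : ∑ I, ∑ J, co (.refl ℝ E7) (extDeriv α y) I * co (.refl ℝ E7) (β y) J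
      * epsAppend h₁ (Fin.append I J) K
      = 2 * ∑ i, ∑ I, ∑ J, dco α y i I * co (.refl ℝ E7) (β y) J
        * epsAppend h₁ (Fin.append (Matrix.vecCons i I) J) K := by
    rw [Finset.sum_comm]
    have hJ : ∀ J, ∑ I, co (.refl ℝ E7) (extDeriv α y) I * co (.refl ℝ E7) (β y) J
        * epsAppend h₁ (Fin.append I J) K = co (.refl ℝ E7) (β y) J * (2 * ∑ i, ∑ I,
          dco α y i I * epsAppend h₁ (Fin.append (Matrix.vecCons i I) J) K) := by
      intro J
      have h' : 1 + 1 + (q + l) = 7 := by omega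
      have := sum_co_extDeriv_mul hα (isAntisymm_epsAppend h' (Fin.append J K))
      simp only [← epsAppend_assoc h₁ h'] at this
      norm_num at this
      rw [← this, Finset.mul_sum]
      refine Finset.sum_congr rfl fun I _ => ?_
      ring
    simp only [hJ, mul_left_comm _ (2 : ℝ), ← Finset.mul_sum]
    congr 1
    simp only [Finset.mul_sum]
    rw [Finset.sum_comm]
    refine Finset.sum_congr rfl fun i _ => ?_
    rw [Finset.sum_comm]
    refine Finset.sum_congr rfl fun I _ => Finset.sum_congr rfl fun J _ => ?_
    ring
  have e2 : ∑ I, ∑ J, co (.refl ℝ E7) (α y) I * co (.refl ℝ E7) (extDeriv β y) J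
      * epsAppend h₂ (Fin.append I J) K
      = (q + 1) * ∑ i, ∑ I, ∑ J, co (.refl ℝ E7) (α y) I * dco β y i J
        * epsAppend h₂ (Fin.append I (Matrix.vecCons i J)) K := by
    have hI : ∀ I, ∑ J, co (.refl ℝ E7) (α y) I * co (.refl ℝ E7) (extDeriv β y) J
        * epsAppend h₂ (Fin.append I J) K = co (.refl ℝ E7) (α y) I * ((q + 1) * ∑ i, ∑ J,
          dco β y i J * epsAppend h₂ (Fin.append I (Matrix.vecCons i J)) K) := by
      intro I
      have h' : 1 + (q + 1 + l) = 7 := by omega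
      have h'' : q + 1 + l + 1 = 7 := by omega
      -- The block of dβ has to stand first for antisymmetry to apply, so I, J, K is rotated to J,
      -- K, I.
      have h''' : q + 1 + (l + 1) = 7 := by omega
      have := sum_co_extDeriv_mul hβ (isAntisymm_epsAppend h''' (Fin.append K I))
      simp only [← epsAppend_assoc h'' h''', epsAppend_comm h'' h', ← epsAppend_assoc h₂ h'] at this
      rw [← this, Finset.mul_sum]
      refine Finset.sum_congr rfl fun I _ => ?_
      ring
    simp only [hI, mul_left_comm _ ((q : ℝ) + 1), ← Finset.mul_sum]
    congr 1
    simp only [Finset.mul_sum]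
    rw [Finset.sum_comm]
    refine Finset.sum_congr rfl fun i _ => Finset.sum_congr rfl fun I _ =>
      Finset.sum_congr rfl fun J _ => ?_
    ring
  rw [e1, e2]
  simp only [← hsymm, add_mul, Finset.sum_add_distrib, mul_add, ← Finset.mul_sum]
  have e3 : ∀ i I J, epsAppend h₂ (Fin.append I (Matrix.vecCons i J)) K
      = -epsAppend h (Matrix.vecCons i (Fin.append I J)) K := by
    intro i I J
    rw [hswap, neg_neg]
  simp only [e3, mul_neg, Finset.sum_neg_distrib]
  have f1 : ((1 + q).factorial : ℝ) ≠ 0 := by positivity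
  have f2 : (q.factorial : ℝ) ≠ 0 := by positivity
  rw [Nat.factorial_succ q]
  push_cast
  have f3 : (q : ℝ) + 1 ≠ 0 := by positivity
  norm_num [Nat.factorial]
  field_simp
  ring

theorem epsAppend_congr {k l k' l' : ℕ} {h : k + l = 7} {h' : k' + l' = 7} {I : Fin k → Fin 7}
    {J : Fin l → Fin 7} {I' : Fin k' → Fin 7} {J' : Fin l' → Fin 7}
    (H : ∀ x, Fin.append I J (Fin.cast h.symm x) = Fin.append I' J' (Fin.cast h'.symm x)) :
    epsAppend h I J = epsAppend h' I' J' :=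
  congrArg eps (funext H)

theorem epsAppend_congr_swap {k l k' l' : ℕ} {h : k + l = 7} {h' : k' + l' = 7} {I : Fin k → Fin 7}
    {J : Fin l → Fin 7} {I' : Fin k' → Fin 7} {J' : Fin l' → Fin 7}
    (H : ∀ x, Fin.append I J (Fin.cast h.symm x)
      = Fin.append I' J' (Fin.cast h'.symm (Equiv.swap 0 1 x))) :
    epsAppend h I J = -epsAppend h' I' J' := by
  have h1 := eps_comp (fun x => Fin.append I' J' (Fin.cast h'.symm x)) (Equiv.swap 0 1)
  rw [Equiv.Perm.sign_swap (by decide)] at h1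
  refine (congrArg eps (funext H)).trans (h1.trans ?_)
  simp [epsAppend]

/-- Stated for abstract forms of one degree, so that forms in degrees such as 1 + 1 + 3 and 1 + (3 +
1), which agree by evaluation, can be supplied together. -/
theorem co_hodgeStar_sub_eq {k l : ℕ} (h : k + l = 7) {η ζ : E7 [⋀^Fin k]→L[ℝ] ℝ}
    {K : Fin l → Fin 7} {a b : ℝ} (hη : co (.refl ℝ E7) (hodgeStar (.refl ℝ E7) h η) K = a)
    (hζ : co (.refl ℝ E7) (hodgeStar (.refl ℝ E7) h ζ) K = b) :
    co (.refl ℝ E7) (hodgeStar (.refl ℝ E7) h (η - ζ)) K = a - b := by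
  rw [hodgeStar_sub, co_sub, hη, hζ]

theorem co_hodgeStar_add_smul_eq {k l : ℕ} (h : k + l = 7) {η ζ : E7 [⋀^Fin k]→L[ℝ] ℝ} (c : ℝ)
    {K : Fin l → Fin 7} {a b : ℝ} (hη : co (.refl ℝ E7) (hodgeStar (.refl ℝ E7) h η) K = a)
    (hζ : co (.refl ℝ E7) (hodgeStar (.refl ℝ E7) h ζ) K = b) :
    co (.refl ℝ E7) (hodgeStar (.refl ℝ E7) h (η + c • ζ)) K = a + c * b := by
  rw [hodgeStar_add, hodgeStar_smul, co_add, co_smul, hη, hζ]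

/-- The Leibniz rule for the product of a one-form and a three-form. -/
theorem extDeriv_wedge_one_three {α : E7 → E7 [⋀^Fin 1]→L[ℝ] ℝ} {β : E7 → E7 [⋀^Fin 3]→L[ℝ] ℝ}
    {y : E7} (hα : DifferentiableAt ℝ α y) (hβ : DifferentiableAt ℝ β y) :
    extDeriv (fun z => (wedge (α z) (β z) : E7 [⋀^Fin 4]→L[ℝ] ℝ)) y
      = (wedge (extDeriv α y) (β y) : E7 [⋀^Fin 5]→L[ℝ] ℝ)
        - (wedge (α y) (extDeriv β y) : E7 [⋀^Fin 5]→L[ℝ] ℝ) := by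
  refine hodgeStar_injective (k := 5) (l := 2) (by norm_num) (ext_co (.refl ℝ E7) fun K => ?_)
  refine Eq.trans (co_hodgeStar_extDeriv_wedge (q := 3) (l := 2) (by norm_num) (by norm_num)
    (by norm_num) hα hβ K (fun i I J => epsAppend_congr fun x => ?_)
    (fun i I J => epsAppend_congr_swap fun x => ?_)) ?_
  · fin_cases x <;> rfl
  · fin_cases x <;> rfl
  refine (co_hodgeStar_sub_eq (k := 5) (l := 2) (by norm_num) ?_ ?_).symm
  · rfl
  · rfl

/-- The Leibniz rule for the product of a one-form and a four-form. -/
theorem extDeriv_wedge_one_four {α : E7 → E7 [⋀^Fin 1]→L[ℝ] ℝ} {β : E7 → E7 [⋀^Fin 4]→L[ℝ] ℝ}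
    {y : E7} (hα : DifferentiableAt ℝ α y) (hβ : DifferentiableAt ℝ β y) :
    extDeriv (fun z => (wedge (α z) (β z) : E7 [⋀^Fin 5]→L[ℝ] ℝ)) y
      = (wedge (extDeriv α y) (β y) : E7 [⋀^Fin 6]→L[ℝ] ℝ)
        - (wedge (α y) (extDeriv β y) : E7 [⋀^Fin 6]→L[ℝ] ℝ) := by
  refine hodgeStar_injective (k := 6) (l := 1) (by norm_num) (ext_co (.refl ℝ E7) fun K => ?_)
  refine Eq.trans (co_hodgeStar_extDeriv_wedge (q := 4) (l := 1) (by norm_num) (by norm_num)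
    (by norm_num) hα hβ K (fun i I J => epsAppend_congr fun x => ?_)
    (fun i I J => epsAppend_congr_swap fun x => ?_)) ?_
  · fin_cases x <;> rfl
  · fin_cases x <;> rfl
  refine (co_hodgeStar_sub_eq (k := 6) (l := 1) (by norm_num) ?_ ?_).symm
  · rfl
  · rfl

/-- The Leibniz rule for the product of a function and a four-form. -/
theorem extDeriv_smul_four {f : E7 → ℝ} {ω : E7 → E7 [⋀^Fin 4]→L[ℝ] ℝ}
    {y : E7} (hf : DifferentiableAt ℝ f y) (hω : DifferentiableAt ℝ ω y) :
    extDeriv (fun z => f z • ω z) y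
      = (wedge (ContinuousAlternatingMap.ofSubsingleton ℝ E7 ℝ (0 : Fin 1) (fderiv ℝ f y)) (ω y) :
          E7 [⋀^Fin 5]→L[ℝ] ℝ) + f y • extDeriv ω y := by
  refine hodgeStar_injective (k := 5) (l := 2) (by norm_num) (ext_co (.refl ℝ E7) fun K => ?_)
  -- The scalar product rule; the first term becomes df∧ω and the second f dω.
  have hd : ∀ i J, dco (fun z => f z • ω z) y i J
      = fderiv ℝ f y (stdVec i) * co (.refl ℝ E7) (ω y) J + f y * dco ω y i J := by
    intro i J
    have h1 := fderiv_fun_mul hf (differentiableAt_co hω J)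
    simp only [dco, co_smul]
    rw [h1]
    simp
    ring
  have h1 := co_hodgeStar_extDeriv (l := 2) (by norm_num) (hf.smul hω) K
  have h2 := co_hodgeStar_extDeriv (l := 2) (by norm_num) hω K
  refine h1.trans ?_
  refine Eq.trans ?_ (co_hodgeStar_add_smul_eq (k := 5) (l := 2) (by norm_num) (f y)
    (co_hodgeStar_wedge_aux (p := 1) (q := 4) (l := 2) (.refl ℝ E7) (by norm_num) _ (ω y) K)
    h2).symm
  rw [sum_fin_one]
  have hA : ∀ i, co (.refl ℝ E7) (ContinuousAlternatingMap.ofSubsingleton ℝ E7 ℝ (0 : Fin 1)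
      (fderiv ℝ f y)) ![i] = fderiv ℝ f y (stdVec i) := by
    intro i
    rfl
  have hB : ∀ (i : Fin 7) (J : Fin 4 → Fin 7),
      epsAppend (k := 5) (l := 2) (by norm_num) (Matrix.vecCons i J) K
        = epsAppend (k := 1 + 4) (l := 2) (by norm_num) (Fin.append ![i] J) K :=
    fun i J => epsAppend_congr fun x => by fin_cases x <;> rfl
  have hd' : ∀ i J, dco (f • ω) y i J
      = fderiv ℝ f y (stdVec i) * co (.refl ℝ E7) (ω y) J + f y * dco ω y i J := hd
  simp only [hA, hd', hB, add_mul, Finset.sum_add_distrib, mul_add]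
  rw [Nat.factorial_one, Nat.cast_one, one_mul]
  refine congrArg _ ?_
  simp only [Finset.mul_sum]
  refine Finset.sum_congr rfl fun I _ => Finset.sum_congr rfl fun J _ => ?_
  ring

/-! ### Naturality -/

section Naturality

variable {V W : Type*} [AddCommGroup V] [Module ℝ V] [TopologicalSpace V]
  [AddCommGroup W] [Module ℝ W] [TopologicalSpace W] {p q k l : ℕ}

theorem wedge_compContinuousLinearMap (A : W →L[ℝ] V) (α : V [⋀^Fin p]→L[ℝ] ℝ)
    (β : V [⋀^Fin q]→L[ℝ] ℝ) :
    (wedge α β).compContinuousLinearMap A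
      = wedge (α.compContinuousLinearMap A) (β.compContinuousLinearMap A) := by
  ext v
  simp only [wedge, ContinuousAlternatingMap.smul_apply,
    ContinuousAlternatingMap.compContinuousLinearMap_apply,
    ContinuousMultilinearMap.alternatization_apply_apply]
  rfl

/-- The frame of the composite is the pull-back of the frame of L. Naturality of the star is then
immediate from its coordinate formula. -/
theorem co_trans (A : W ≃L[ℝ] V) (L : V ≃L[ℝ] E7) (η : V [⋀^Fin k]→L[ℝ] ℝ) (I : Fin k → Fin 7) :
    co (A.trans L) (η.compContinuousLinearMap (A : W →L[ℝ] V)) I = co L η I := by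
  simp [co, frame, Function.comp_def]

theorem inducedForm_trans (A : W ≃L[ℝ] V) (L : V ≃L[ℝ] E7) :
    inducedForm (A.trans L) = (inducedForm L).compContinuousLinearMap (A : W →L[ℝ] V) := by
  ext v
  rfl

variable [IsTopologicalAddGroup V] [ContinuousConstSMul ℝ V] [IsTopologicalAddGroup W]
  [ContinuousConstSMul ℝ W]

theorem hodgeStar_compContinuousLinearMap (A : W ≃L[ℝ] V) (L : V ≃L[ℝ] E7) (h : k + l = 7)
    (η : V [⋀^Fin k]→L[ℝ] ℝ) :
    (hodgeStar L h η).compContinuousLinearMap (A : W →L[ℝ] V)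
      = hodgeStar (A.trans L) h (η.compContinuousLinearMap (A : W →L[ℝ] V)) := by
  refine ext_co (A.trans L) fun K => ?_
  simp only [co_trans, co_hodgeStar]

end Naturality

/-! ### The metric and the volume form in terms of the three-form -/

section Gram

variable {V : Type*} [AddCommGroup V] [Module ℝ V] [TopologicalSpace V]

/-- The seven-form `(u ⌟ σ) ∧ (v ⌟ σ) ∧ σ`. -/
def gramForm (s : V [⋀^Fin 3]→L[ℝ] ℝ) (u v : V) : V [⋀^Fin 7]→L[ℝ] ℝ :=
  wedge (contract (k := 2) (by norm_num) u s)
    (wedge (contract (k := 2) (by norm_num) v s) s : V [⋀^Fin 5]→L[ℝ] ℝ)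

theorem co_contract (L : V ≃L[ℝ] E7) (s : V [⋀^Fin 3]→L[ℝ] ℝ) (u : V) (I : Fin 2 → Fin 7) :
    co L (contract (k := 2) (by norm_num) u s) I = s ![u, frame L (I 0), frame L (I 1)] := by
  show s _ = s _
  congr 1
  ext x
  fin_cases x <;> rfl

theorem eq_sum_frame (L : V ≃L[ℝ] E7) (u : V) : u = ∑ i, (L u) i • frame L i := by
  apply L.injective
  rw [map_sum]
  simp only [map_smul, frame, ContinuousLinearEquiv.apply_symm_apply]
  ext j
  simp [stdVec, Finset.sum_apply, Pi.single_apply]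

theorem co_contract_inducedForm (L : V ≃L[ℝ] E7) (u : V) (I : Fin 2 → Fin 7) :
    co L (contract (k := 2) (by norm_num) u (inducedForm L)) I
      = ∑ i, (L u) i * (sInt i (I 0) (I 1) : ℝ) := by
  rw [co_contract]
  have h2 : ∀ u : V, (inducedForm L) ![u, frame L (I 0), frame L (I 1)]
      = (inducedForm L).toAlternatingMap.toMultilinearMap.toLinearMap
        ![0, frame L (I 0), frame L (I 1)] 0 u := by
    intro u
    show (inducedForm L) _ = (inducedForm L) _
    congr 1
    ext x
    fin_cases x <;> simp
  rw [h2]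
  conv_lhs => rw [eq_sum_frame L u]
  rw [map_sum]
  refine Finset.sum_congr rfl fun i _ => ?_
  rw [map_smul, smul_eq_mul, ← h2]
  congr 1
  refine Eq.trans ?_ (co_inducedForm L ![i, I 0, I 1])
  show (inducedForm L) _ = (inducedForm L) _
  congr 1
  ext x
  fin_cases x <;> rfl

variable [IsTopologicalAddGroup V] [ContinuousConstSMul ℝ V]

/-- `(u ⌟ σ) ∧ (v ⌟ σ) ∧ σ = 6 ⟨u, v⟩ vol`. -/
theorem co_hodgeStar_gramForm (L : V ≃L[ℝ] E7) (u v : V) (I : Fin 0 → Fin 7) :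
    co L (hodgeStar L (k := 7) (l := 0) (by norm_num) (gramForm (inducedForm L) u v)) I
      = 6 * ∑ i, (L u) i * (L v) i := by
  refine (co_hodgeStar_wedge_left (p := 2) (q := 5) (l := 0) L (by norm_num) (by norm_num)
    _ _ I).trans ?_
  rw [sum_fin_two]
  have h : ∀ i j, co L (hodgeStar L (k := 5) (l := 2) (by norm_num)
      (wedge (contract (k := 2) (by norm_num) v (inducedForm L)) (inducedForm L)))
        (Fin.append I ![i, j]) = 2 * ∑ b, (L v) b * (sInt b i j : ℝ) := by
    intro i j
    rw [star_wedge_two_comm, co_star_wedge_two]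
    simp only [co_contract_inducedForm]
    have e0 : Fin.append I ![i, j] 0 = i := rfl
    have e1 : Fin.append I ![i, j] 1 = j := rfl
    rw [e0, e1]
    have key : ∀ b, ∑ c, ∑ d, (sInt b c d : ℝ) * pInt c d i j = 4 * sInt b i j := by
      intro b
      exact_mod_cast sum_sum_sInt_mul_pInt b i j
    have hs : ∑ c, ∑ d, (∑ b, (L v) b * (sInt b (![c, d] 0) (![c, d] 1) : ℝ)) * pInt c d i j
        = ∑ b, (L v) b * ∑ c, ∑ d, (sInt b c d : ℝ) * pInt c d i j := by
      simp only [Finset.mul_sum, Finset.sum_mul]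
      symm
      rw [Finset.sum_comm]
      refine Finset.sum_congr rfl fun c _ => ?_
      rw [Finset.sum_comm]
      refine Finset.sum_congr rfl fun d _ => Finset.sum_congr rfl fun b _ => ?_
      rw [Matrix.cons_val_zero, Matrix.cons_val_one, Matrix.cons_val_zero]
      ring
    rw [hs]
    simp only [key, mul_left_comm _ (4 : ℝ), ← Finset.mul_sum]
    ring
  refine (congrArg _ (Finset.sum_congr rfl fun i _ => Finset.sum_congr rfl fun j _ =>
    congrArg _ (h i j))).trans ?_
  simp only [co_contract_inducedForm]
  -- The final constant is (1/2) · 2 · 6 = 6, where the 2 is the eigenvalue of *(σ∧·) on v⌟σ.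
  have key : ∀ a b, ∑ i, ∑ j, (sInt a i j : ℝ) * sInt b i j = 6 * deltaInt a b := by
    intro a b
    have := sum_sum_sInt_mul_sInt a b
    simp only [← sInt_rotate b] at this
    exact_mod_cast this
  have hs : ∑ i, ∑ j, (∑ a, (L u) a * (sInt a (![i, j] 0) (![i, j] 1) : ℝ))
      * (2 * ∑ b, (L v) b * (sInt b i j : ℝ))
      = 2 * ∑ a, (L u) a * ∑ b, (L v) b * ∑ i, ∑ j, (sInt a i j : ℝ) * sInt b i j := by
    simp only [Finset.mul_sum, Finset.sum_mul]
    symm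
    rw [Finset.sum_congr rfl fun a _ => Finset.sum_comm]
    rw [Finset.sum_comm]
    refine Finset.sum_congr rfl fun i _ => ?_
    rw [Finset.sum_congr rfl fun a _ => Finset.sum_comm]
    rw [Finset.sum_comm]
    refine Finset.sum_congr rfl fun j _ => ?_
    rw [Finset.sum_comm]
    refine Finset.sum_congr rfl fun b _ => Finset.sum_congr rfl fun a _ => ?_
    rw [Matrix.cons_val_zero, Matrix.cons_val_one, Matrix.cons_val_zero]
    ring
  rw [hs]
  simp only [key]
  simp only [deltaInt, Int.cast_ite, Int.cast_one, Int.cast_zero, mul_ite, mul_one, mul_zero,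
    Finset.sum_ite_eq, Finset.mem_univ, if_true, Nat.factorial]
  simp only [← mul_assoc, ← Finset.sum_mul]
  norm_num
  ring

/-- A seven-form is determined by its Hodge dual. -/
theorem apply_eq_co_hodgeStar_mul (L : V ≃L[ℝ] E7) (η : V [⋀^Fin 7]→L[ℝ] ℝ) (v : Fin 7 → V) :
    η v = co L (hodgeStar L (k := 7) (l := 0) (by norm_num) η) Fin.elim0
      * stdVol fun j => L (v j) := by
  conv_lhs => rw [← hodgeStar_hodgeStar L (k := 7) (l := 0) (by norm_num) (by norm_num) η]
  generalize hodgeStar L (k := 7) (l := 0) (by norm_num) η = c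
  rw [hodgeStar]
  simp only [ContinuousAlternatingMap.smul_apply,
    Fintype.sum_unique, Nat.factorial_zero, Nat.cast_one, inv_one, one_smul, smul_eq_mul]
  refine congrArg₂ (· * ·) (congrArg c (Subsingleton.elim _ _)) ?_
  refine congrArg stdVol (funext fun j => ?_)
  fin_cases j <;> rfl

end Gram

/-! ### Regularity of the Hodge star -/

section StarRegularity

/-- The matrix of an isomorphism of `ℝ⁷`. -/
def isoMatrix (A : E7 ≃L[ℝ] E7) : Matrix (Fin 7) (Fin 7) ℝ :=
  Matrix.of fun i a => A (stdVec a) i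

theorem isoMatrix_apply (A : E7 ≃L[ℝ] E7) (i a : Fin 7) : isoMatrix A i a = A (stdVec a) i := rfl

theorem isoMatrix_mul (A : E7 ≃L[ℝ] E7) : isoMatrix A * isoMatrix A.symm = 1 := by
  ext i j
  have h1 := congrArg (fun u => A u i) (eq_sum_frame (.refl ℝ E7) (A.symm (stdVec j)))
  simp only [map_sum, map_smul, ContinuousLinearEquiv.apply_symm_apply, frame_refl] at h1
  have h2 : (1 : Matrix (Fin 7) (Fin 7) ℝ) i j = stdVec j i := by
    simp [stdVec, Matrix.one_apply]
  rw [h2, h1, Matrix.mul_apply]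
  simp [isoMatrix_apply, mul_comm]

theorem stdVol_stdVec : stdVol stdVec = 1 := by
  rw [stdVol_apply_eq_det, ← Module.Basis.det_self (EuclideanSpace.basisFun (Fin 7) ℝ).toBasis]
  exact congrArg _ (funext stdVec_eq_basisFun)

theorem stdVol_iso (A : E7 ≃L[ℝ] E7) : stdVol (fun a => A (stdVec a)) = (isoMatrix A).det := by
  rw [stdVol_apply_eq_det, Module.Basis.det_apply]
  congr 1

/-- The left side is polynomial in the coefficients of the three-form, the right side is 6 det(A)
times the Gram matrix AᵀA. All regularity of the metric comes from this equality. -/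
theorem gramForm_iso (A : E7 ≃L[ℝ] E7) (a b : Fin 7) :
    gramForm (inducedForm A) (stdVec a) (stdVec b) stdVec
      = 6 * (isoMatrix A).det * ((isoMatrix A).transpose * isoMatrix A) a b := by
  rw [apply_eq_co_hodgeStar_mul A, co_hodgeStar_gramForm, stdVol_iso, Matrix.mul_apply]
  simp only [isoMatrix_apply, Matrix.transpose_apply]
  ring

theorem insertVectors_apply {V : Type*} [AddCommGroup V] [Module ℝ V] [TopologicalSpace V]
    {k l m : ℕ} (h : k + l = m) (a : Fin k → V) (ω : V [⋀^Fin m]→L[ℝ] ℝ) (v : Fin l → V) :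
    insertVectors h a ω v = ω fun i => Fin.append a v (Fin.cast h.symm i) := rfl

theorem sum_smul_apply {k : ℕ} (m : MultilinearMap ℝ (fun _ : Fin k => E7) ℝ)
    (c : Fin k → Fin 7 → ℝ) (e : Fin 7 → E7) :
    m (fun x => ∑ a, c x a • e a) = ∑ a : Fin k → Fin 7, (∏ x, c x (a x)) * m fun x => e (a x) := by
  rw [MultilinearMap.map_sum]
  refine Finset.sum_congr rfl fun a _ => ?_
  rw [MultilinearMap.map_smul_univ, smul_eq_mul]

/-- Expanding the frame A⁻¹e_i in the standard basis and summing over the frame leaves only A⁻¹A⁻ᵀ,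
the inverse metric. So the star depends on A only through det A and this matrix. -/
theorem co_hodgeStar_iso {k l : ℕ} (h : k + l = 7) (A : E7 ≃L[ℝ] E7) (η : E7 [⋀^Fin k]→L[ℝ] ℝ)
    (K : Fin l → Fin 7) :
    co (.refl ℝ E7) (hodgeStar A h η) K = (isoMatrix A).det * (k.factorial : ℝ)⁻¹ *
      ∑ I : Fin k → Fin 7, ∑ J : Fin k → Fin 7,
        (∏ x, (isoMatrix A.symm * (isoMatrix A.symm).transpose) (I x) (J x)) *
          (co (.refl ℝ E7) η I * epsAppend h J K) := by
  have hf : ∀ i, frame A i = ∑ a, isoMatrix A.symm a i • stdVec a :=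
    fun i => eq_sum_frame (.refl ℝ E7) (A.symm (stdVec i))
  have hη : ∀ I : Fin k → Fin 7, η (fun x => frame A (I x))
      = ∑ a : Fin k → Fin 7, (∏ x, isoMatrix A.symm (a x) (I x)) * co (.refl ℝ E7) η a := by
    intro I
    simp only [hf]
    exact sum_smul_apply η.toAlternatingMap.toMultilinearMap
      (fun x c => isoMatrix A.symm c (I x)) stdVec
  have hv : ∀ I : Fin k → Fin 7,
      stdVol (fun j => Fin.append (fun x => frame A (I x)) (fun x => stdVec (K x))
        (Fin.cast h.symm j))
      = ∑ b : Fin k → Fin 7, (∏ x, isoMatrix A.symm (b x) (I x)) * epsAppend h b K := by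
    intro I
    have h' : l + k = 7 := by omega
    have hc : ∀ v : Fin k → E7, stdVol (fun j => Fin.append v (fun x => stdVec (K x))
        (Fin.cast h.symm j)) = insertVectors h' (fun x => stdVec (K x)) stdVol v :=
      fun v => by rw [insertVectors_apply, stdVol_append_comm h' h]
    have he : ∀ b, epsAppend h b K
        = insertVectors h' (fun x => stdVec (K x)) stdVol (fun x => stdVec (b x)) := by
      intro b
      rw [← hc]
      refine congrArg stdVol (funext fun j => ?_)
      change stdVec (Fin.append b K (Fin.cast h.symm j))
        = Fin.append _ (fun x => stdVec (K x)) (Fin.cast h.symm j)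
      generalize Fin.cast h.symm j = i
      refine Fin.addCases (fun i => ?_) (fun i => ?_) i <;> simp
    simp only [hc, he, hf]
    exact sum_smul_apply (insertVectors h' (fun x => stdVec (K x)) stdVol).toMultilinearMap
      (fun x c => isoMatrix A.symm c (I x)) stdVec
  -- Seven-forms make up a line, so the pulled-back volume is a multiple of the standard one; the
  -- factor is read off on the standard basis.
  have hd : ∀ v : Fin 7 → E7, stdVol (fun j => A (v j)) = (isoMatrix A).det * stdVol v := by
    intro v
    generalize hω : stdVol.compContinuousLinearMap (A : E7 →L[ℝ] E7) = ω
    have h0 : ∀ v : Fin 7 → E7, ω v = stdVol fun j => A (v j) := fun v => by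
      rw [← hω, ContinuousAlternatingMap.compContinuousLinearMap_apply]
      exact congrArg stdVol rfl
    have h1 : ∀ v : Fin 7 → E7, ω v = co (.refl ℝ E7)
        (hodgeStar (.refl ℝ E7) (k := 7) (l := 0) (by norm_num) ω) Fin.elim0 * stdVol v :=
      fun v => apply_eq_co_hodgeStar_mul (.refl ℝ E7) ω v
    have h2 := h1 stdVec
    rw [h0, stdVol_iso, stdVol_stdVec, mul_one] at h2
    rw [← h0, h1, h2]
  have hs : co (.refl ℝ E7) (hodgeStar A h η) K = (k.factorial : ℝ)⁻¹ * ∑ I : Fin k → Fin 7,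
      η (fun x => frame A (I x)) * ((isoMatrix A).det *
        stdVol (fun j => Fin.append (fun x => frame A (I x)) (fun x => stdVec (K x))
        (Fin.cast h.symm j))) := by
    simp only [← hd]
    simp only [co, hodgeStar, ContinuousAlternatingMap.smul_apply, smul_eq_mul,
      ContinuousAlternatingMap.sum_apply, insertVectors_apply,
      ContinuousAlternatingMap.compContinuousLinearMap_apply, frame_refl]
    refine congrArg _ (Finset.sum_congr rfl fun I _ => congrArg _ (congrArg stdVol ?_))
    funext j
    simp
  rw [hs]
  simp only [hη, hv]
  have hp : ∀ I J : Fin k → Fin 7,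
      ∏ x, (isoMatrix A.symm * (isoMatrix A.symm).transpose) (I x) (J x)
        = ∑ K : Fin k → Fin 7, (∏ x, isoMatrix A.symm (I x) (K x))
          * ∏ x, isoMatrix A.symm (J x) (K x) := by
    intro I J
    simp only [Matrix.mul_apply, Matrix.transpose_apply]
    rw [Finset.prod_univ_sum]
    simp only [Fintype.piFinset_univ, Finset.prod_mul_distrib]
  simp only [hp, Finset.sum_mul_sum, mul_left_comm _ (isoMatrix A).det]
  rw [← Finset.mul_sum, mul_left_comm, mul_assoc]
  refine congrArg _ (congrArg _ ?_)
  simp only [Finset.sum_mul]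
  rw [Finset.sum_comm]
  refine Finset.sum_congr rfl fun a _ => ?_
  rw [Finset.sum_comm]
  refine Finset.sum_congr rfl fun b _ => Finset.sum_congr rfl fun I _ => ?_
  ring

variable {n : WithTop ℕ∞} {U : Set E7}

theorem contDiffOn_det {G : E7 → Matrix (Fin 7) (Fin 7) ℝ}
    (hG : ∀ i j, ContDiffOn ℝ n (fun y => G y i j) U) : ContDiffOn ℝ n (fun y => (G y).det) U := by
  simp only [Matrix.det_apply']
  exact ContDiffOn.sum fun π _ => contDiffOn_const.mul (contDiffOn_prod fun i _ => hG _ _)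

theorem contDiffOn_adjugate {G : E7 → Matrix (Fin 7) (Fin 7) ℝ}
    (hG : ∀ i j, ContDiffOn ℝ n (fun y => G y i j) U) (i j : Fin 7) :
    ContDiffOn ℝ n (fun y => (G y).adjugate i j) U := by
  simp only [Matrix.adjugate_apply]
  refine contDiffOn_det fun a b => ?_
  by_cases h : a = j
  · subst h
    simpa using contDiffOn_const
  · simpa [Matrix.updateRow_ne h] using hG a b

theorem contDiffOn_apply {k : ℕ} {ω : E7 → E7 [⋀^Fin k]→L[ℝ] ℝ} (hω : ContDiffOn ℝ n ω U)
    (v : Fin k → E7) : ContDiffOn ℝ n (fun y => ω y v) U := by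
  exact (ContinuousAlternatingMap.apply ℝ E7 ℝ v : _ →L[ℝ] ℝ).contDiff.comp_contDiffOn hω

theorem contDiffOn_gramForm {s : E7 → E7 [⋀^Fin 3]→L[ℝ] ℝ} (hs : ContDiffOn ℝ n s U) (u v : E7) :
    ContDiffOn ℝ n (fun y => gramForm (s y) u v stdVec) U := by
  have h1 : ∀ u : E7, ContDiffOn ℝ n
      (fun y => (contract (k := 2) (by norm_num) u (s y) : E7 [⋀^Fin 2]→L[ℝ] ℝ)) U := by
    intro u
    rw [contDiffOn_iff_co (l := 5) (by norm_num)]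
    intro I
    simp only [co_contract]
    exact contDiffOn_apply hs _
  have h2 := contDiffOn_wedge (p := 2) (q := 3) (k := 5) (l := 4) (m := 2) (by norm_num)
    (by norm_num) (by norm_num) (h1 v) hs
  have h3 : ContDiffOn ℝ n (fun y => gramForm (s y) u v) U :=
    contDiffOn_wedge (p := 2) (q := 5) (k := 5) (l := 2) (m := 0) (by norm_num)
    (by norm_num) (by norm_num) (h1 u) h2
  exact contDiffOn_apply h3 _

theorem isoMatrix_det_ne_zero (A : E7 ≃L[ℝ] E7) : (isoMatrix A).det ≠ 0 := by
  intro h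
  have := congrArg Matrix.det (isoMatrix_mul A)
  rw [Matrix.det_mul, h, zero_mul, Matrix.det_one] at this
  exact zero_ne_one this

theorem contDiffOn_gram {A : E7 → E7 ≃L[ℝ] E7} {s : E7 → E7 [⋀^Fin 3]→L[ℝ] ℝ}
    (hs : ContDiffOn ℝ n s U) (hA : ∀ y, s y = inducedForm (A y)) (a b : Fin 7) :
    ContDiffOn ℝ n (fun y => 6 * (isoMatrix (A y)).det *
      ((isoMatrix (A y)).transpose * isoMatrix (A y)) a b) U := by
  have h : (fun y => 6 * (isoMatrix (A y)).det *
      ((isoMatrix (A y)).transpose * isoMatrix (A y)) a b)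
      = fun y => gramForm (s y) (stdVec a) (stdVec b) stdVec := by
    funext y
    have h1 := gramForm_iso (A y) a b
    rw [← hA y] at h1
    exact h1.symm
  rw [h]
  exact contDiffOn_gramForm hs (stdVec a) (stdVec b)

/-- With d = det A, the regular 7×7 matrix 6d·AᵀA has determinant 6⁷d⁷d² = 6⁷d⁹, so d is a ninth
root of a regular nonvanishing function. -/
theorem contDiffOn_isoMatrix_det {A : E7 → E7 ≃L[ℝ] E7} {s : E7 → E7 [⋀^Fin 3]→L[ℝ] ℝ}
    (hs : ContDiffOn ℝ n s U) (hA : ∀ y, s y = inducedForm (A y)) :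
    ContDiffOn ℝ n (fun y => (isoMatrix (A y)).det) U := by
  have h1 : ContDiffOn ℝ n (fun y => (Matrix.of fun a b : Fin 7 => 6 * (isoMatrix (A y)).det *
      ((isoMatrix (A y)).transpose * isoMatrix (A y)) a b).det) U :=
    contDiffOn_det fun a b => by
      simp only [Matrix.of_apply]
      exact contDiffOn_gram hs hA a b
  have h2 : ∀ y, (Matrix.of fun a b : Fin 7 => 6 * (isoMatrix (A y)).det *
      ((isoMatrix (A y)).transpose * isoMatrix (A y)) a b).det
        = 6 ^ 7 * (isoMatrix (A y)).det ^ 9 := by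
    intro y
    have : (Matrix.of fun a b : Fin 7 => 6 * (isoMatrix (A y)).det *
        ((isoMatrix (A y)).transpose * isoMatrix (A y)) a b)
          = (6 * (isoMatrix (A y)).det) • ((isoMatrix (A y)).transpose * isoMatrix (A y)) := by
      ext a b
      rfl
    rw [this, Matrix.det_smul, Matrix.det_mul, Matrix.det_transpose]
    simp only [Fintype.card_fin]
    ring
  simp only [h2] at h1
  have h3 : ContDiffOn ℝ n (fun y => (isoMatrix (A y)).det ^ 9) U := by
    have := (contDiffOn_const (c := ((6 : ℝ) ^ 7)⁻¹)).mul h1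
    refine this.congr fun y _ => ?_
    rw [← mul_assoc, inv_mul_cancel₀ (by norm_num), one_mul]
  -- The root is extracted as d = d⁹/d⁸ with d⁸ = ((d⁹)²)^(4/9). Squaring first makes the base
  -- positive, since d may be negative.
  have h4 : ContDiffOn ℝ n (fun y => (isoMatrix (A y)).det ^ 9
      / (((isoMatrix (A y)).det ^ 9) ^ 2) ^ (4 / 9 : ℝ)) U := by
    refine h3.fun_div ((h3.pow 2).rpow_const_of_ne fun y _ => ?_) fun y _ => ?_
    · exact pow_ne_zero _ (pow_ne_zero _ (isoMatrix_det_ne_zero _))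
    · have := isoMatrix_det_ne_zero (A y)
      have : 0 < ((isoMatrix (A y)).det ^ 9) ^ 2 := by positivity
      exact (Real.rpow_pos_of_pos this _).ne'
  refine h4.congr fun y _ => ?_
  have h5 := isoMatrix_det_ne_zero (A y)
  generalize (isoMatrix (A y)).det = d at h5
  have h6 : ((d ^ 9) ^ 2) ^ (4 / 9 : ℝ) = d ^ 8 := by
    have e : (d ^ 9) ^ 2 = (d ^ 2) ^ (9 : ℝ) := by
      rw [← pow_mul, show (9 : ℝ) = ((9 : ℕ) : ℝ) by norm_num, Real.rpow_natCast, ← pow_mul]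
    rw [e, ← Real.rpow_mul (by positivity), show (9 : ℝ) * (4 / 9) = ((4 : ℕ) : ℝ) by norm_num,
      Real.rpow_natCast, ← pow_mul]
  rw [h6]
  field_simp

/-- Dividing by 6 det A gives the metric AᵀA; its inverse is the adjugate divided by (det A)². -/
theorem contDiffOn_inverse_metric {A : E7 → E7 ≃L[ℝ] E7} {s : E7 → E7 [⋀^Fin 3]→L[ℝ] ℝ}
    (hs : ContDiffOn ℝ n s U) (hA : ∀ y, s y = inducedForm (A y)) (i j : Fin 7) :
    ContDiffOn ℝ n (fun y =>
      (isoMatrix (A y).symm * (isoMatrix (A y).symm).transpose) i j) U := by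
  have hD := contDiffOn_isoMatrix_det hs hA
  have hG : ∀ a b, ContDiffOn ℝ n
      (fun y => ((isoMatrix (A y)).transpose * isoMatrix (A y)) a b) U := by
    intro a b
    refine ((contDiffOn_gram hs hA a b).fun_div (contDiffOn_const.mul hD)
      fun y _ => mul_ne_zero (by norm_num : (6 : ℝ) ≠ 0) (isoMatrix_det_ne_zero (A y))).congr
      fun y _ => ?_
    have := isoMatrix_det_ne_zero (A y)
    field_simp
  have h2 : ContDiffOn ℝ n (fun y => ((isoMatrix (A y)).transpose * isoMatrix (A y)).adjugate i j
      / (isoMatrix (A y)).det ^ 2) U := (contDiffOn_adjugate hG i j).fun_div (hD.pow 2)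
    fun y _ => pow_ne_zero 2 (isoMatrix_det_ne_zero (A y))
  refine h2.congr fun y _ => ?_
  have hPQ := isoMatrix_mul (A y)
  have hQP := mul_eq_one_comm.1 hPQ
  have hd := isoMatrix_det_ne_zero (A y)
  generalize isoMatrix (A y) = P at *
  generalize isoMatrix (A y).symm = Q at *
  have hinv : (P.transpose * P) * (Q * Q.transpose) = 1 := by
    rw [Matrix.mul_assoc, ← Matrix.mul_assoc P, hPQ, Matrix.one_mul, ← Matrix.transpose_mul, hQP,
      Matrix.transpose_one]
  have h3 := Matrix.inv_eq_right_inv hinv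
  rw [← h3, Matrix.inv_def, Matrix.smul_apply, Matrix.det_mul, Matrix.det_transpose,
    Ring.inverse_eq_inv', smul_eq_mul]
  field_simp

/-- No continuity of y ↦ A y is assumed: the determinant and the inverse metric are already regular
as functions of the three-form. -/
theorem contDiffOn_hodgeStar {k l : ℕ} (h : k + l = 7) {A : E7 → E7 ≃L[ℝ] E7}
    {s : E7 → E7 [⋀^Fin 3]→L[ℝ] ℝ} (hs : ContDiffOn ℝ n s U) (hA : ∀ y, s y = inducedForm (A y))
    {ω : E7 → E7 [⋀^Fin k]→L[ℝ] ℝ}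
    (hω : ContDiffOn ℝ n ω U) : ContDiffOn ℝ n (fun y => hodgeStar (A y) h (ω y)) U := by
  rw [contDiffOn_iff_co (h ▸ Nat.add_comm l k : l + k = 7)]
  rw [contDiffOn_iff_co h] at hω
  intro K
  simp only [co_hodgeStar_iso]
  refine ((contDiffOn_isoMatrix_det hs hA).mul contDiffOn_const).mul
    (ContDiffOn.sum fun I _ => ContDiffOn.sum fun J _ => ?_)
  exact (contDiffOn_prod fun x _ => contDiffOn_inverse_metric hs hA _ _).mul
    ((hω I).mul contDiffOn_const)

end StarRegularity

/-! ### Forms on the manifold: charts, regularity and exterior derivative -/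

section Charts

variable {M : Type*} [TopologicalSpace M] [ChartedSpace E7 M]

theorem sub_eq_sub_apply {k : ℕ} {α β : DForm M k} {x : M} {η ζ : E7 [⋀^Fin k]→L[ℝ] ℝ}
    (hη : η = α x) (hζ : ζ = β x) : η - ζ = (α - β) x := by
  rw [hη, hζ]
  rfl

theorem wedge_chartRep {p q : ℕ} {α : DForm M p} {β : DForm M q} {x : M}
    {η : E7 [⋀^Fin p]→L[ℝ] ℝ} {ζ : E7 [⋀^Fin q]→L[ℝ] ℝ} (hη : η = α x) (hζ : ζ = β x) :
    wedge η ζ = wedgeD α β x := by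
  rw [hη, hζ]
  rfl

/-- All tangent spaces are copies of ℝ⁷, so values at propositionally equal points can be compared
on the same vectors. -/
theorem DForm.apply_congr {k : ℕ} (ω : DForm M k) {x x' : M} (h : x = x') (v : Fin k → E7) :
    (ω x : E7 [⋀^Fin k]→L[ℝ] ℝ) v = (ω x' : E7 [⋀^Fin k]→L[ℝ] ℝ) v := by
  subst h
  rfl

/-- The pull-back of a form on `M` by a map from `ℝ⁷`. -/
def pullback {k : ℕ} (ω : DForm M k) (g : E7 → M) (y : E7) : E7 [⋀^Fin k]→L[ℝ] ℝ :=
  (ω (g y)).compContinuousLinearMap (mfderiv 𝓘(ℝ, E7) (𝓡 7) g y)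

theorem pullback_congr {k : ℕ} (ω : DForm M k) {g g' : E7 → M} {y : E7}
    (h : g =ᶠ[nhds y] g') : pullback ω g y = pullback ω g' y := by
  ext v
  have h1 : mfderiv 𝓘(ℝ, E7) (𝓡 7) g y = (mfderiv 𝓘(ℝ, E7) (𝓡 7) g' y : E7 →L[ℝ] E7) :=
    h.mfderiv_eq
  have h2 : (fun i => (mfderiv 𝓘(ℝ, E7) (𝓡 7) g y : E7 →L[ℝ] E7) (v i))
    = fun i => (mfderiv 𝓘(ℝ, E7) (𝓡 7) g' y : E7 →L[ℝ] E7) (v i) := by rw [h1]; rfl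
  exact (ω.apply_congr h.eq_of_nhds _).trans (congrArg (ω (g' y)) h2)

theorem pullback_comp {k : ℕ} (ω : DForm M k) {g : E7 → M} {f : E7 → E7} {y : E7}
    (hg : MDifferentiableAt 𝓘(ℝ, E7) (𝓡 7) g (f y)) (hf : DifferentiableAt ℝ f y) :
    pullback ω (g ∘ f) y = (pullback ω g (f y)).compContinuousLinearMap (fderiv ℝ f y) := by
  ext v
  have h1 := mfderiv_comp y hg hf.mdifferentiableAt
  rw [mfderiv_eq_fderiv] at h1
  have h2 : (fun i => (mfderiv 𝓘(ℝ, E7) (𝓡 7) (g ∘ f) y : E7 →L[ℝ] E7) (v i))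
    = fun i => (mfderiv 𝓘(ℝ, E7) (𝓡 7) g (f y) : E7 →L[ℝ] E7) (fderiv ℝ f y (v i)) := by
    rw [h1]; rfl
  exact congrArg (ω (g (f y))) h2

theorem chartRep_eq_pullback {k : ℕ} (x₀ : M) (ω : DForm M k) :
    chartRep x₀ ω = pullback ω (extChartAt (𝓡 7) x₀).symm := rfl

theorem chartRep_wedge {p q : ℕ} (x₀ : M) (α : DForm M p) (β : DForm M q) :
    chartRep x₀ (wedgeD α β) = fun y => wedge (chartRep x₀ α y) (chartRep x₀ β y) :=
  funext fun _ => wedge_compContinuousLinearMap _ _ _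

theorem chartRep_add {k : ℕ} (x₀ : M) (α β : DForm M k) :
    chartRep x₀ (α + β) = chartRep x₀ α + chartRep x₀ β := rfl

theorem chartRep_smul {k : ℕ} (x₀ : M) (c : ℝ) (α : DForm M k) :
    chartRep x₀ (c • α) = c • chartRep x₀ α := rfl

theorem chartRep_fun_smul {k : ℕ} (x₀ : M) (f : M → ℝ) (α : DForm M k) :
    chartRep x₀ (fun x => f x • α x)
      = fun y => f ((extChartAt (𝓡 7) x₀).symm y) • chartRep x₀ α y := rfl

theorem isOpen_target (x₀ : M) : IsOpen (extChartAt (𝓡 7) x₀).target := by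
  simpa using isOpen_extChartAt_target (I := 𝓡 7) x₀

theorem IsClass.contDiffAt {k : ℕ} {n : ℕ∞} {ω : DForm M k} (hω : IsClass n ω) (x₀ : M) {y : E7}
    (hy : y ∈ (extChartAt (𝓡 7) x₀).target) : ContDiffAt ℝ n (chartRep x₀ ω) y :=
  (hω x₀).contDiffAt ((isOpen_target x₀).mem_nhds hy)

theorem IsClass.differentiableAt {k : ℕ} {ω : DForm M k} (hω : IsClass 1 ω) (x₀ : M) {y : E7}
    (hy : y ∈ (extChartAt (𝓡 7) x₀).target) : DifferentiableAt ℝ (chartRep x₀ ω) y :=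
  (hω.contDiffAt x₀ hy).differentiableAt one_ne_zero

theorem IsClass.of_le {k : ℕ} {m n : ℕ∞} {ω : DForm M k} (hω : IsClass n ω) (h : m ≤ n) :
    IsClass m ω := fun x₀ => (hω x₀).of_le (by exact_mod_cast h)

theorem IsClass.add {k : ℕ} {n : ℕ∞} {α β : DForm M k} (hα : IsClass n α) (hβ : IsClass n β) :
    IsClass n (α + β) := fun x₀ => (hα x₀).add (hβ x₀)

theorem IsClass.sub {k : ℕ} {n : ℕ∞} {α β : DForm M k} (hα : IsClass n α) (hβ : IsClass n β) :
    IsClass n (α - β) := fun x₀ => (hα x₀).sub (hβ x₀)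

theorem IsClass.const_smul {k : ℕ} {n : ℕ∞} {α : DForm M k} (c : ℝ) (hα : IsClass n α) :
    IsClass n (c • α) := fun x₀ => (hα x₀).const_smul c

theorem IsClass.wedge {p q k l m : ℕ} (h : p + k = 7) (h' : q + l = 7) (hm : p + q + m = 7)
    {n : ℕ∞} {α : DForm M p} {β : DForm M q} (hα : IsClass n α) (hβ : IsClass n β) :
    IsClass n (wedgeD α β) := fun x₀ => by
  rw [chartRep_wedge]
  exact contDiffOn_wedge h h' hm (hα x₀) (hβ x₀)

/-- Functions of class `C^n`: the coordinate expressions are of class `C^n`. -/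
def IsClassFun (n : ℕ∞) (f : M → ℝ) : Prop :=
  ∀ x₀ : M, ContDiffOn ℝ n (fun y => f ((extChartAt (𝓡 7) x₀).symm y)) (extChartAt (𝓡 7) x₀).target

theorem IsClass.isClassFun {n : ℕ∞} {ω : DForm M 0} (hω : IsClass n ω) :
    IsClassFun n fun x => ω x Fin.elim0 := fun x₀ => by
  refine (contDiffOn_apply (hω x₀) Fin.elim0).congr fun y _ => ?_
  exact congrArg (ω _) (Subsingleton.elim _ _)

theorem IsClass.fun_smul {k : ℕ} {n : ℕ∞} {f : M → ℝ} {ω : DForm M k} (hf : IsClassFun n f)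
    (hω : IsClass n ω) : IsClass n (fun x => f x • ω x : DForm M k) :=
  fun x₀ => (hf x₀).fun_smul (hω x₀)

theorem G2Structure.form_eq (σ : G2Structure M) (x : M) :
    σ.form x = inducedForm (σ.inducingMap x) := (σ.positive x).choose_spec

variable [IsManifold (𝓡 7) ((⊤ : ℕ∞) : WithTop ℕ∞) M]

variable (M) in
theorem isManifold_one : IsManifold (𝓡 7) 1 M :=
  IsManifold.of_le (n := ((⊤ : ℕ∞) : WithTop ℕ∞)) (by exact_mod_cast le_top)

/-- The chart at x has the identity as its derivative at x, so no change of vectors occurs there. -/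
theorem chartRep_self {k : ℕ} (x : M) (ω : DForm M k) :
    chartRep x ω (extChartAt (𝓡 7) x x) = (ω x : E7 [⋀^Fin k]→L[ℝ] ℝ) := by
  have := isManifold_one M
  ext v
  have h1 := mfderivWithin_range_extChartAt_symm (I := 𝓡 7) (x := x)
  rw [ModelWithCorners.Boundaryless.range_eq_univ, mfderivWithin_univ] at h1
  have h2 : (fun i => (mfderiv 𝓘(ℝ, E7) (𝓡 7) (extChartAt (𝓡 7) x).symm (extChartAt (𝓡 7) x x) :
      E7 →L[ℝ] E7) (v i)) = v := by rw [h1]; rfl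
  exact (ω.apply_congr (extChartAt_to_inv x) _).trans
    (congrArg (ω x : E7 [⋀^Fin k]→L[ℝ] ℝ) h2)

theorem extD_apply {k : ℕ} (ω : DForm M k) (x : M) :
    (extD ω x : E7 [⋀^Fin (k + 1)]→L[ℝ] ℝ)
      = extDeriv (chartRep x ω) (extChartAt (𝓡 7) x x) := by
  have := isManifold_one M
  ext v
  have h1 := mfderiv_extChartAt_self (I := 𝓡 7) (x := x)
  have h2 : (fun i => (mfderiv (𝓡 7) 𝓘(ℝ, E7) (extChartAt (𝓡 7) x) x :
      E7 →L[ℝ] E7) (v i)) = v := by rw [h1]; rfl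
  exact congrArg (extDeriv (chartRep x ω) (extChartAt (𝓡 7) x x)) h2

theorem exists_chartEquiv (x₀ : M) {y : E7} (hy : y ∈ (extChartAt (𝓡 7) x₀).target) :
    ∃ A : E7 ≃L[ℝ] TangentSpace (𝓡 7) ((extChartAt (𝓡 7) x₀).symm y),
      (A : E7 →L[ℝ] _) = mfderiv 𝓘(ℝ, E7) (𝓡 7) (extChartAt (𝓡 7) x₀).symm y := by
  have := isManifold_one M
  have h := isInvertible_mfderivWithin_extChartAt_symm (I := 𝓡 7) hy
  rw [ModelWithCorners.Boundaryless.range_eq_univ, mfderivWithin_univ] at h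
  exact h

theorem contDiffAt_transition (x₀ x : M) {y : E7} (hy : y ∈ (extChartAt (𝓡 7) x₀).target)
    (hx : (extChartAt (𝓡 7) x₀).symm y ∈ (extChartAt (𝓡 7) x).source) :
    ContDiffAt ℝ ((⊤ : ℕ∞) : WithTop ℕ∞)
      (extChartAt (𝓡 7) x ∘ (extChartAt (𝓡 7) x₀).symm) y := by
  have h := contDiffWithinAt_ext_coord_change (I := 𝓡 7) (n := ((⊤ : ℕ∞) : WithTop ℕ∞)) x x₀
    (y := y) (by
      rw [PartialEquiv.trans_source, PartialEquiv.symm_source]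
      exact ⟨hy, hx⟩)
  rwa [ModelWithCorners.Boundaryless.range_eq_univ, contDiffWithinAt_univ] at h

theorem mdifferentiableAt_chart_symm (x₀ : M) {y : E7} (hy : y ∈ (extChartAt (𝓡 7) x₀).target) :
    MDifferentiableAt 𝓘(ℝ, E7) (𝓡 7) (extChartAt (𝓡 7) x₀).symm y := by
  have := isManifold_one M
  have h := mdifferentiableWithinAt_extChartAt_symm (I := 𝓡 7) hy
  rwa [ModelWithCorners.Boundaryless.range_eq_univ, mdifferentiableWithinAt_univ] at h

/-- Independence of the chart: `extD` uses a different chart at each point, and this shows that any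
single chart computes it. The two coordinate expressions differ by pull-back along the transition
map, with which `extDeriv` commutes. -/
theorem chartRep_extD {k : ℕ} {ω : DForm M k} (hω : IsClass 1 ω) (x₀ : M) {y : E7}
    (hy : y ∈ (extChartAt (𝓡 7) x₀).target) :
    chartRep x₀ (extD ω) y = extDeriv (chartRep x₀ ω) y := by
  have := isManifold_one M
  set x := (extChartAt (𝓡 7) x₀).symm y with hx
  set ψ : E7 → E7 := extChartAt (𝓡 7) x ∘ (extChartAt (𝓡 7) x₀).symm with hψ
  have hU : ∀ᶠ z in nhds y, z ∈ (extChartAt (𝓡 7) x₀).target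
      ∧ (extChartAt (𝓡 7) x₀).symm z ∈ (extChartAt (𝓡 7) x).source := by
    refine Filter.Eventually.and ((isOpen_target x₀).mem_nhds hy) ?_
    exact (mdifferentiableAt_chart_symm x₀ hy).continuousAt (extChartAt_source_mem_nhds x)
  have hψd : ∀ᶠ z in nhds y, DifferentiableAt ℝ ψ z :=
    hU.mono fun z hz => (contDiffAt_transition x₀ x hz.1 hz.2).differentiableAt (by simp)
  have h1 : chartRep x₀ ω =ᶠ[nhds y]
      fun z => (chartRep x ω (ψ z)).compContinuousLinearMap (fderiv ℝ ψ z) := by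
    filter_upwards [hU.eventually_nhds, hψd] with z hz hd
    rw [chartRep_eq_pullback, chartRep_eq_pullback, ← pullback_comp ω _ hd]
    · refine pullback_congr ω ?_
      filter_upwards [hz] with w hw
      exact ((extChartAt (𝓡 7) x).left_inv hw.2).symm
    · exact mdifferentiableAt_chart_symm x ((extChartAt (𝓡 7) x).map_source hz.self_of_nhds.2)
  have hψy : ψ y = extChartAt (𝓡 7) x x := rfl
  have h2 := hω.differentiableAt x (mem_extChartAt_target (I := 𝓡 7) x)
  -- By the chain rule, because the chart at x has identity derivative at its own base point.
  have h3 : fderiv ℝ ψ y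
      = (mfderiv 𝓘(ℝ, E7) (𝓡 7) (extChartAt (𝓡 7) x₀).symm y : E7 →L[ℝ] E7) := by
    have h4 := mfderiv_comp y (mdifferentiableAt_extChartAt (I := 𝓡 7) (x := x) (y := x)
      (mem_chart_source E7 x)) (mdifferentiableAt_chart_symm x₀ hy)
    have h5 : (mfderiv (𝓡 7) 𝓘(ℝ, E7) (extChartAt (𝓡 7) x) x : E7 →L[ℝ] E7) = .id ℝ E7 :=
      mfderiv_extChartAt_self (I := 𝓡 7) (x := x)
    rw [← mfderiv_eq_fderiv]
    exact h4.trans (congrArg (fun D : E7 →L[ℝ] E7 => D.comp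
      (mfderiv 𝓘(ℝ, E7) (𝓡 7) (extChartAt (𝓡 7) x₀).symm y : E7 →L[ℝ] E7)) h5)
  rw [h1.extDeriv_eq, extDeriv_pullback (f := ψ) h2
    (contDiffAt_transition x₀ x hy (mem_extChartAt_source x)) (by
      rw [minSmoothness_of_isRCLikeNormedField]
      exact WithTop.coe_le_coe.2 (le_top : (2 : ℕ∞) ≤ ⊤)), h3]
  exact congrArg (fun η : E7 [⋀^Fin (k + 1)]→L[ℝ] ℝ => η.compContinuousLinearMap
    (mfderiv 𝓘(ℝ, E7) (𝓡 7) (extChartAt (𝓡 7) x₀).symm y : E7 →L[ℝ] E7)) (extD_apply ω x)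

theorem extDeriv_eq_extD {k : ℕ} (ω : DForm M k) (x : M) :
    extDeriv (chartRep x ω) (extChartAt (𝓡 7) x x) = (extD ω x : E7 [⋀^Fin (k + 1)]→L[ℝ] ℝ) :=
  (extD_apply ω x).symm

theorem IsClass.extD {k : ℕ} {n : ℕ∞} {ω : DForm M k} (hω : IsClass (n + 1) ω) :
    IsClass n (extD ω) := fun x₀ => by
  have h1 := (hω x₀).fderiv_of_isOpen (m := n) (isOpen_target x₀) (by norm_cast)
  have h2 := (ContinuousAlternatingMap.alternatizeUncurryFinCLM ℝ E7 ℝ :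
    (E7 →L[ℝ] E7 [⋀^Fin k]→L[ℝ] ℝ) →L[ℝ] _).contDiff.comp_contDiffOn h1
  exact h2.congr fun y hy => chartRep_extD (hω.of_le le_add_self) x₀ hy

/-- The outer derivative sees a whole neighbourhood, so dω must be known in one fixed chart near the
point; this is what `chartRep_extD` supplies. -/
theorem extD_extD {k : ℕ} {ω : DForm M k} (hω : IsClass 2 ω) : extD (extD ω) = 0 := by
  funext x
  refine (extD_apply _ x).trans ?_
  have hx := mem_extChartAt_target (I := 𝓡 7) x
  have h1 : chartRep x (extD ω) =ᶠ[nhds (extChartAt (𝓡 7) x x)] extDeriv (chartRep x ω) := by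
    filter_upwards [(isOpen_target x).mem_nhds hx] with y hy
    exact chartRep_extD (hω.of_le one_le_two) x hy
  rw [h1.extDeriv_eq]
  exact extDeriv_extDeriv_apply (hω.contDiffAt x hx) (by simp)

theorem extD_add {k : ℕ} {α β : DForm M k} (hα : IsClass 1 α) (hβ : IsClass 1 β) :
    extD (α + β) = extD α + extD β := by
  funext x
  have hx := mem_extChartAt_target (I := 𝓡 7) x
  refine (extD_apply _ x).trans ?_
  rw [chartRep_add, extDeriv_add (hα.differentiableAt x hx) (hβ.differentiableAt x hx),
    extDeriv_eq_extD, extDeriv_eq_extD]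
  rfl

theorem extD_smul {k : ℕ} (c : ℝ) (α : DForm M k) : extD (c • α) = c • extD α := by
  funext x
  refine (extD_apply _ x).trans ?_
  rw [chartRep_smul, extDeriv_smul, extDeriv_eq_extD]
  rfl

theorem extD_sub {k : ℕ} {α β : DForm M k} (hα : IsClass 1 α) (hβ : IsClass 1 β) :
    extD (α - β) = extD α - extD β := by
  have h := extD_add hα (hβ.const_smul (-1))
  rw [extD_smul] at h
  have e : ∀ {j : ℕ} (γ δ : DForm M j), γ - δ = γ + (-1 : ℝ) • δ := fun γ δ =>
    funext fun x => sub_eq_add_neg_one_smul (γ x) (δ x)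
  rwa [e, e]

theorem extD_wedgeD_three {α : DForm M 1} {β : DForm M 3} (hα : IsClass 1 α) (hβ : IsClass 1 β) :
    extD (wedgeD α β : DForm M 4)
      = (wedgeD (extD α) β : DForm M 5) - (wedgeD α (extD β) : DForm M 5) := by
  funext x
  have hx := mem_extChartAt_target (I := 𝓡 7) x
  refine (extD_apply _ x).trans ?_
  rw [chartRep_wedge]
  refine (extDeriv_wedge_one_three (hα.differentiableAt x hx) (hβ.differentiableAt x hx)).trans ?_
  exact sub_eq_sub_apply (wedge_chartRep (extDeriv_eq_extD α x) (chartRep_self x β))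
    (wedge_chartRep (chartRep_self x α) (extDeriv_eq_extD β x))

theorem extD_wedgeD_four {α : DForm M 1} {β : DForm M 4} (hα : IsClass 1 α) (hβ : IsClass 1 β) :
    extD (wedgeD α β : DForm M 5)
      = (wedgeD (extD α) β : DForm M 6) - (wedgeD α (extD β) : DForm M 6) := by
  funext x
  have hx := mem_extChartAt_target (I := 𝓡 7) x
  refine (extD_apply _ x).trans ?_
  rw [chartRep_wedge]
  refine (extDeriv_wedge_one_four (hα.differentiableAt x hx) (hβ.differentiableAt x hx)).trans ?_
  exact sub_eq_sub_apply (wedge_chartRep (extDeriv_eq_extD α x) (chartRep_self x β))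
    (wedge_chartRep (chartRep_self x α) (extDeriv_eq_extD β x))

theorem dFun_eq {f : M → ℝ} (hf : IsClassFun 1 f) (x : M) :
    dFun f x = (ContinuousAlternatingMap.ofSubsingleton ℝ E7 ℝ (0 : Fin 1)
      (fderiv ℝ (fun y => f ((extChartAt (𝓡 7) x).symm y)) (extChartAt (𝓡 7) x x)) :
        E7 [⋀^Fin 1]→L[ℝ] ℝ) := by
  have := isManifold_one M
  have hx := mem_extChartAt_target (I := 𝓡 7) x
  have h1 : DifferentiableAt ℝ (fun y => f ((extChartAt (𝓡 7) x).symm y)) (extChartAt (𝓡 7) x x) :=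
    ((hf x).contDiffAt ((isOpen_target x).mem_nhds hx)).differentiableAt one_ne_zero
  have h2 : f =ᶠ[nhds x] (fun y => f ((extChartAt (𝓡 7) x).symm y)) ∘ extChartAt (𝓡 7) x := by
    filter_upwards [extChartAt_source_mem_nhds (I := 𝓡 7) x] with z hz
    exact congrArg f ((extChartAt (𝓡 7) x).left_inv hz).symm
  have h3 := mfderiv_comp x h1.mdifferentiableAt (mdifferentiableAt_extChartAt (I := 𝓡 7) (x := x)
    (y := x) (mem_chart_source E7 x))
  rw [mfderiv_extChartAt_self (I := 𝓡 7) (x := x), mfderiv_eq_fderiv] at h3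
  have h4 : mfderiv (𝓡 7) 𝓘(ℝ, ℝ) f x
      = (fderiv ℝ (fun y => f ((extChartAt (𝓡 7) x).symm y)) (extChartAt (𝓡 7) x x) :
        E7 →L[ℝ] ℝ) := h2.mfderiv_eq.trans h3
  exact congrArg (ContinuousAlternatingMap.ofSubsingleton ℝ E7 ℝ (0 : Fin 1)) h4

theorem extD_fun_smul {f : M → ℝ} {ω : DForm M 4} (hf : IsClassFun 1 f) (hω : IsClass 1 ω) :
    extD (fun x => f x • ω x : DForm M 4)
      = (wedgeD (dFun f) ω : DForm M 5) + (fun x => f x • extD ω x : DForm M 5) := by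
  funext x
  have hx := mem_extChartAt_target (I := 𝓡 7) x
  refine (extD_apply _ x).trans ?_
  rw [chartRep_fun_smul]
  refine (extDeriv_smul_four (((hf x).contDiffAt
    ((isOpen_target x).mem_nhds hx)).differentiableAt one_ne_zero)
    (hω.differentiableAt x hx)).trans ?_
  rw [extDeriv_eq_extD, chartRep_self, ← dFun_eq hf, extChartAt_to_inv]
  exact congrArg₂ (fun a b : E7 [⋀^Fin 5]→L[ℝ] ℝ => a + b) rfl rfl

namespace G2Structure

variable (σ : G2Structure M)

theorem isClass_star {k l : ℕ} (h : k + l = 7) {n : ℕ∞} {ω : DForm M k} (hσ : IsClass n σ.form)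
    (hω : IsClass n ω) : IsClass n (σ.star l ω h) := fun x₀ => by
  have h1 : ∀ y, ∃ B : E7 ≃L[ℝ] E7, y ∈ (extChartAt (𝓡 7) x₀).target →
      chartRep x₀ σ.form y = inducedForm B
        ∧ chartRep x₀ (σ.star l ω h) y = hodgeStar B h (chartRep x₀ ω y) := by
    intro y
    by_cases hy : y ∈ (extChartAt (𝓡 7) x₀).target
    · obtain ⟨A, hA⟩ := exists_chartEquiv x₀ hy
      refine ⟨A.trans (σ.inducingMap _), fun _ => ⟨?_, ?_⟩⟩
      · rw [inducedForm_trans, ← σ.form_eq, hA]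
        rfl
      · rw [chartRep, chartRep, ← hA]
        exact hodgeStar_compContinuousLinearMap A _ h _
    -- A dummy value off the chart domain, so that B is defined everywhere.
    · exact ⟨.refl ℝ E7, fun h => absurd h hy⟩
  choose B hB using h1
  -- The three-form is taken to be the one induced by B, so that it matches B at every point; on the
  -- chart domain it is σ.
  have h2 : ContDiffOn ℝ n (fun y => inducedForm (B y)) (extChartAt (𝓡 7) x₀).target :=
    (hσ x₀).congr fun y hy => ((hB y hy).1).symm
  exact (contDiffOn_hodgeStar h h2 (fun _ => rfl) (hω x₀)).congr fun y hy => (hB y hy).2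

end G2Structure

end Charts

/-! ### Recovering the components of a three-form -/

section Decomposition

variable {V : Type*} [AddCommGroup V] [Module ℝ V] [TopologicalSpace V]

theorem co_zero_form (L : V ≃L[ℝ] E7) (η : V [⋀^Fin 0]→L[ℝ] ℝ) (I : Fin 0 → Fin 7) :
    co L η I = η Fin.elim0 :=
  congrArg η (Subsingleton.elim _ _)

variable [IsTopologicalAddGroup V] [ContinuousConstSMul ℝ V] {L : V ≃L[ℝ] E7} {s γ f3 : V [⋀^Fin 3]→L[ℝ] ℝ} {f0 : ℝ}
  {f1 : V [⋀^Fin 1]→L[ℝ] ℝ}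

theorem scalar_eq_of_decomposition
    (h : γ = f0 • inducedForm L
      + hodgeStar L (k := 4) (l := 3) (by norm_num) (wedge f1 (inducedForm L)) + f3)
    (h3 : wedge f3 (inducedDual L) = 0) {η : V [⋀^Fin 0]→L[ℝ] ℝ}
    (hη : η = hodgeStar L (k := 7) (l := 0) (by norm_num) (wedge γ (inducedDual L))) :
    f0 = 7⁻¹ * η Fin.elim0 := by
  have h4 := co_star_wedge_dual_decomposition L f0 f1 f3 h3 Fin.elim0
  rw [← h, ← hη, co_zero_form] at h4
  rw [h4]
  ring

theorem covector_eq_of_decomposition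
    (h : γ = f0 • inducedForm L
      + hodgeStar L (k := 4) (l := 3) (by norm_num) (wedge f1 (inducedForm L)) + f3)
    (h2 : wedge f3 (inducedForm L) = 0) {η : V [⋀^Fin 1]→L[ℝ] ℝ}
    (hη : η = hodgeStar L (k := 6) (l := 1) (by norm_num) (wedge γ (inducedForm L))) :
    f1 = (-(4 : ℝ)⁻¹) • η := by
  have h4 := star_wedge_decomposition L f0 f1 f3 h2
  rw [← h, ← hη] at h4
  rw [h4, smul_smul]
  norm_num

/-- The scalar and the covector are given by formulas in γ alone, and the third component is what
remains. -/
theorem unique_of_decomposition {f0' : ℝ} {f1' : V [⋀^Fin 1]→L[ℝ] ℝ} {f3' : V [⋀^Fin 3]→L[ℝ] ℝ}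
    (h : γ = f0 • inducedForm L
      + hodgeStar L (k := 4) (l := 3) (by norm_num) (wedge f1 (inducedForm L)) + f3)
    (h2 : wedge f3 (inducedForm L) = 0) (h3 : wedge f3 (inducedDual L) = 0)
    (h' : γ = f0' • inducedForm L
      + hodgeStar L (k := 4) (l := 3) (by norm_num) (wedge f1' (inducedForm L)) + f3')
    (h2' : wedge f3' (inducedForm L) = 0) (h3' : wedge f3' (inducedDual L) = 0) :
    f0 = f0' ∧ f1 = f1' ∧ f3 = f3' := by
  have e0 := (scalar_eq_of_decomposition h h3 rfl).trans
    (scalar_eq_of_decomposition h' h3' rfl).symm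
  have e1 := (covector_eq_of_decomposition h h2 rfl).trans
    (covector_eq_of_decomposition h' h2' rfl).symm
  subst e0 e1
  exact ⟨rfl, rfl, add_left_cancel (h.symm.trans h')⟩

theorem add_star_wedge_eq_smul {s : V [⋀^Fin 3]→L[ℝ] ℝ} {α : V [⋀^Fin 1]→L[ℝ] ℝ}
    {ζ η : V [⋀^Fin 2]→L[ℝ] ℝ} (hs : s = inducedForm L)
    (hζ : ζ = hodgeStar L (k := 5) (l := 2) (by norm_num) (wedge α (inducedDual L)))
    (hη : η = hodgeStar L (k := 5) (l := 2) (by norm_num) (wedge s ζ)) : ζ + η = (3 : ℝ) • ζ := by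
  have h := star_wedge_dual_add L α
  rw [← hζ, ← hs, ← hη] at h
  exact h

theorem eq_add_of_star_wedge_star_wedge {s : V [⋀^Fin 3]→L[ℝ] ℝ} {ψ : V [⋀^Fin 4]→L[ℝ] ℝ}
    {γ ζ η : V [⋀^Fin 2]→L[ℝ] ℝ} (hs : s = inducedForm L) (hψ : ψ = inducedDual L)
    (hζ : ζ = hodgeStar L (k := 5) (l := 2) (by norm_num) (wedge (hodgeStar L (k := 6) (l := 1)
      (by norm_num) (wedge γ ψ)) ψ))
    (hη : η = hodgeStar L (k := 5) (l := 2) (by norm_num) (wedge s γ)) : ζ = γ + η := by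
  have h := star_wedge_star_wedge L γ
  rw [← hψ, ← hs, ← hζ, ← hη] at h
  exact h

end Decomposition

/-- Eliminates f³ = θ - f⁰σ - *(f¹∧σ): the coefficients become 4/3 + 1 = 7/3 and 1 + 1 = 2. The
weights in H are what makes -*d*θ split off. -/
theorem smul_add_sub_eq {W : Type*} [AddCommGroup W] [Module ℝ W] {s t y z w : W} {a : ℝ}
    (h : t = a • s + y + w) (hz : z = y) :
    (4 / 3 * a) • s + y - w = (7 / 3 : ℝ) • (a • s) + (2 : ℝ) • z - t := by
  rw [h, hz]
  module

/-! ### Algebraic identities for forms on a manifold with G₂-structure -/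

namespace G2Structure

section Pointwise

variable {M : Type*} [TopologicalSpace M] [ChartedSpace E7 M] (σ : G2Structure M)

theorem _root_.G2.DForm.eq_smul {k : ℕ} {α β : DForm M k} {c : ℝ}
    (h : ∀ x, ∃ η, η = β x ∧ α x = c • η) : α = c • β := by
  funext x
  obtain ⟨η, rfl, hη⟩ := h x
  exact hη

theorem xi_apply {γ : DForm M 2} {x : M} {η : TangentSpace (𝓡 7) x [⋀^Fin 2]→L[ℝ] ℝ}
    (h : ∀ p, σ.star 2 (wedgeD σ.form γ) p x = η) : σ.xi γ x = γ x + η := by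
  rw [xi, Pi.add_apply, h]

theorem star_star {k l : ℕ} (h : k + l = 7) (h' : l + k = 7) (ω : DForm M k) :
    σ.star k (σ.star l ω h) h' = ω :=
  funext fun _ => hodgeStar_hodgeStar _ h h' _

theorem star_add {k l : ℕ} (h : k + l = 7) (α β : DForm M k) :
    σ.star l (α + β) h = σ.star l α h + σ.star l β h :=
  funext fun _ => hodgeStar_add _ h _ _

theorem star_sub {k l : ℕ} (h : k + l = 7) (α β : DForm M k) :
    σ.star l (α - β) h = σ.star l α h - σ.star l β h :=
  funext fun _ => hodgeStar_sub _ h _ _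

theorem star_smul {k l : ℕ} (h : k + l = 7) (c : ℝ) (α : DForm M k) :
    σ.star l (c • α) h = c • σ.star l α h :=
  funext fun _ => hodgeStar_smul _ h _ _

theorem star_fun_smul {k l : ℕ} (h : k + l = 7) (f : M → ℝ) (α : DForm M k) :
    σ.star l (fun x => f x • α x) h = fun x => f x • σ.star l α h x :=
  funext fun _ => hodgeStar_smul _ h _ _

theorem star_form (x : M) : σ.star 4 σ.form (by norm_num) x = inducedDual (σ.inducingMap x) := by
  rw [star, σ.form_eq]
  rfl

theorem star_wedgeD_dual_comm (α : DForm M 1) :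
    σ.star 2 (wedgeD (σ.star 4 σ.form) α) = σ.star 2 (wedgeD α (σ.star 4 σ.form)) := by
  funext x
  have h := star_wedge_dual_comm (σ.inducingMap x) (α x)
  simp only [← σ.star_form] at h
  exact h

theorem star_wedgeD_two_comm (γ : DForm M 2) :
    σ.star 2 (wedgeD γ σ.form) = σ.star 2 (wedgeD σ.form γ) := by
  funext x
  have h := star_wedge_two_comm (σ.inducingMap x) (γ x)
  simp only [← σ.form_eq] at h
  exact h

theorem sharpContract_eq (α : DForm M 1) :
    σ.sharpContract α = σ.star 2 (wedgeD α (σ.star 4 σ.form)) := by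
  funext x
  have h := contract_sharp (σ.inducingMap x) (α x)
  simp only [← σ.form_eq, ← σ.star_form] at h
  exact h

theorem star_wedgeD_star_wedgeD_dual (γ : DForm M 2) :
    σ.star 2 (wedgeD (σ.star 1 (wedgeD γ (σ.star 4 σ.form))) (σ.star 4 σ.form)) = σ.xi γ :=
  funext fun x => (eq_add_of_star_wedge_star_wedge (σ.form_eq x) (σ.star_form x) rfl rfl).trans
    (σ.xi_apply fun _ => rfl).symm

theorem xi_apply_eq_smul {x : M} {γ : DForm M 2} {α : TangentSpace (𝓡 7) x [⋀^Fin 1]→L[ℝ] ℝ}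
    (hγ : γ x = hodgeStar (σ.inducingMap x) (k := 5) (l := 2) (by norm_num)
      (wedge α (inducedDual (σ.inducingMap x)))) : σ.xi γ x = (3 : ℝ) • γ x :=
  (σ.xi_apply fun _ => rfl).trans (add_star_wedge_eq_smul (σ.form_eq x) hγ rfl)

theorem xi_star_wedgeD_dual (α : DForm M 1) :
    σ.xi (σ.star 2 (wedgeD α (σ.star 4 σ.form)))
      = (3 : ℝ) • σ.star 2 (wedgeD α (σ.star 4 σ.form)) := by
  refine DForm.eq_smul fun x => ⟨_, rfl, σ.xi_apply_eq_smul (α := α x) ?_⟩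
  rw [← star_form]
  rfl

theorem wedgeD_add_left {p q : ℕ} (α β : DForm M p) (γ : DForm M q) :
    wedgeD (α + β) γ = wedgeD α γ + wedgeD β γ :=
  funext fun _ => wedge_add_left _ _ _

theorem wedgeD_sub_left {p q : ℕ} (α β : DForm M p) (γ : DForm M q) :
    wedgeD (α - β) γ = wedgeD α γ - wedgeD β γ :=
  funext fun x => by
    have h1 := wedge_add_left (α x) ((-1 : ℝ) • β x) (γ x)
    rw [wedge_smul_left, ← sub_eq_add_neg_one_smul, ← sub_eq_add_neg_one_smul] at h1
    exact h1

theorem isDecompositionAt_iff {x : M} {γ : TangentSpace (𝓡 7) x [⋀^Fin 3]→L[ℝ] ℝ}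
    {f0 : ℝ} {f1 : TangentSpace (𝓡 7) x [⋀^Fin 1]→L[ℝ] ℝ}
    {f3 : TangentSpace (𝓡 7) x [⋀^Fin 3]→L[ℝ] ℝ} : σ.IsDecompositionAt x γ f0 f1 f3 ↔
    γ = f0 • inducedForm (σ.inducingMap x) + hodgeStar (σ.inducingMap x) (k := 4) (l := 3)
      (by norm_num) (wedge f1 (inducedForm (σ.inducingMap x))) + f3
    ∧ wedge f3 (inducedForm (σ.inducingMap x)) = 0
    ∧ wedge f3 (inducedDual (σ.inducingMap x)) = 0 := by
  rw [IsDecompositionAt, σ.form_eq, inducedDual]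

/-- Uniqueness of the decomposition makes the choice in `components` irrelevant. -/
theorem components_eq {θ : DForm M 3} {x : M} {f0 : ℝ}
    {f1 : TangentSpace (𝓡 7) x [⋀^Fin 1]→L[ℝ] ℝ}
    {f3 : TangentSpace (𝓡 7) x [⋀^Fin 3]→L[ℝ] ℝ} (h : σ.IsDecompositionAt x (θ x) f0 f1 f3) :
    σ.components θ x = (f0, f1, f3) := by
  have hc : σ.IsDecompositionAt x (θ x) (σ.components θ x).1 (σ.components θ x).2.1
      (σ.components θ x).2.2 := Classical.epsilon_spec (p := fun t : ℝ ×
        (TangentSpace (𝓡 7) x [⋀^Fin 1]→L[ℝ] ℝ) × (TangentSpace (𝓡 7) x [⋀^Fin 3]→L[ℝ] ℝ) =>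
          σ.IsDecompositionAt x (θ x) t.1 t.2.1 t.2.2) ⟨(f0, f1, f3), h⟩
  rw [isDecompositionAt_iff] at h hc
  obtain ⟨h0, h1, h3⟩ := unique_of_decomposition hc.1 hc.2.1 hc.2.2 h.1 h.2.1 h.2.2
  exact Prod.ext h0 (Prod.ext h1 h3)

theorem scalar_eq {θ : DForm M 3} {f0 : M → ℝ} {f1 : DForm M 1} {f3 : DForm M 3}
    (hdec : ∀ x : M, σ.IsDecompositionAt x (θ x) (f0 x) (f1 x) (f3 x)) :
    f0 = fun x => 7⁻¹ * σ.star (k := 7) 0 (wedgeD θ (σ.star 4 σ.form)) (by norm_num) x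
      Fin.elim0 := by
  funext x
  have h := σ.isDecompositionAt_iff.1 (hdec x)
  refine scalar_eq_of_decomposition h.1 h.2.2 ?_
  rw [← star_form]
  rfl

theorem covector_eq {θ : DForm M 3} {f0 : M → ℝ} {f1 : DForm M 1} {f3 : DForm M 3}
    (hdec : ∀ x : M, σ.IsDecompositionAt x (θ x) (f0 x) (f1 x) (f3 x)) :
    f1 = (-(4 : ℝ)⁻¹) • σ.star (k := 6) 1 (wedgeD θ σ.form) := by
  refine DForm.eq_smul fun x => ?_
  have h := σ.isDecompositionAt_iff.1 (hdec x)
  refine ⟨_, ?_, covector_eq_of_decomposition h.1 h.2.1 rfl⟩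
  rw [← form_eq]
  rfl

theorem star_eq_add_of_eq_sub {k l : ℕ} {h : k + l = 7} {ω α β : DForm M k} {ζ η : DForm M l}
    (hω : ω = α - β) (hζ : σ.star l α h = ζ) (hη : σ.star l β h = (-1 : ℝ) • η) :
    σ.star l ω h = ζ + η := by
  rw [hω, star_sub, hζ, hη]
  module

theorem star_eq_sub_of_eq_sub {k l : ℕ} {h : k + l = 7} {ω α β : DForm M k} {ζ η : DForm M l}
    (hω : ω = α - β) (hζ : σ.star l α h = ζ) (hη : σ.star l β h = η) :
    σ.star l ω h = ζ - η := by
  rw [hω, star_sub, hζ, hη]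

theorem star_wedgeD_eq_add {p q l : ℕ} {h : p + q + l = 7} {ω α β : DForm M p} {γ : DForm M q}
    {ζ η : DForm M l} (hω : ω = α + β) (hζ : σ.star l (wedgeD α γ) h = ζ)
    (hη : σ.star l (wedgeD β γ) h = η) : σ.star l (wedgeD ω γ) h = ζ + η := by
  rw [hω, wedgeD_add_left, star_add, hζ, hη]

theorem star_wedgeD_eq_sub {p q l : ℕ} {h : p + q + l = 7} {ω α β : DForm M p} {γ : DForm M q}
    {ζ η : DForm M l} (hω : ω = α - β) (hζ : σ.star l (wedgeD α γ) h = ζ)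
    (hη : σ.star l (wedgeD β γ) h = η) : σ.star l (wedgeD ω γ) h = ζ - η := by
  rw [hω, wedgeD_sub_left, star_sub, hζ, hη]

theorem star_wedgeD_eq_smul {p q l : ℕ} {h : p + q + l = 7} {α : DForm M p} {β γ : DForm M q}
    {ζ : DForm M l} {c : ℝ} (hβ : β = c • γ) (hζ : σ.star l (wedgeD α γ) h = ζ) :
    σ.star l (wedgeD α β) h = c • ζ := by
  have h1 : wedgeD α (c • γ) = c • wedgeD α γ := funext fun x => wedge_smul_right (α x) c (γ x)
  rw [hβ, h1, star_smul, hζ]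

theorem codiff_eq_neg {l : ℕ} (ω : DForm M 3) (h : 2 + 1 + l = 7) {γ : DForm M 2}
    (hγ : σ.star 2 (extD (σ.star l ω h)) (by omega) = γ) :
    σ.codiff (k := 2) l ω h = (-1 : ℝ) • γ := by
  have e : (-1 : ℝ) ^ (2 + 1) = -1 := by norm_num
  rw [codiff, hγ, e]

theorem tau_eq : σ.tau = (-1 : ℝ) • σ.star 2 (extD (σ.star 4 σ.form)) :=
  σ.codiff_eq_neg _ _ rfl

theorem star_linear {k l : ℕ} (h : k + l = 7) (α β γ : DForm M k) (a b : ℝ) :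
    σ.star l (a • α + b • β - γ) h
      = a • σ.star l α h + b • σ.star l β h - σ.star l γ h := by
  rw [star_sub, star_add, star_smul, star_smul]

theorem eq_neg_star {k l : ℕ} {h : k + l = 7} {ω η : DForm M k} {ζ : DForm M l}
    (hω : ω = (-1 : ℝ) • η) (hη : σ.star l η h = ζ) : ζ = (-1 : ℝ) • σ.star l ω h := by
  rw [hω, star_smul, hη]
  module

theorem star_eq_linear {k l : ℕ} {h : k + l = 7} {ω α β γ : DForm M k} {α' β' γ' : DForm M l}
    {a b : ℝ} (hω : ω = a • α + b • β - γ) (hα : σ.star l α h = α') (hβ : σ.star l β h = β')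
    (hγ : σ.star l γ h = γ') : σ.star l ω h = a • α' + b • β' - γ' := by
  rw [hω, star_linear, hα, hβ, hγ]

/-- The definition of τ with the outer star removed by ** = 1. -/
theorem extD_star_form : extD (σ.star 4 σ.form) = (-1 : ℝ) • σ.star 5 σ.tau := by
  exact σ.eq_neg_star (k := 2) (l := 5) (h := by norm_num) σ.tau_eq
    (σ.star_star (k := 5) (l := 2) (by norm_num) (by norm_num) _)

/-- After the elimination of f³, the star is applied term by term, and **(f¹∧σ) = f¹∧σ. -/
theorem opH_eq {θ : DForm M 3} {f0 : M → ℝ} {f1 : DForm M 1} {f3 : DForm M 3} {ψ : DForm M 4}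
    (hdec : ∀ x : M, σ.IsDecompositionAt x (θ x) (f0 x) (f1 x) (f3 x))
    (hψ : σ.star 4 σ.form = ψ) : σ.opH θ = σ.star 2 (extD ((7 / 3 : ℝ) • (fun x => f0 x • ψ x)
      + (2 : ℝ) • (wedgeD f1 σ.form : DForm M 4) - σ.star 4 θ)) := by
  rw [opH]
  refine congrArg (fun ω : DForm M 4 => σ.star 2 (extD ω)) ?_
  have hT : ∀ x, σ.star 3 (wedgeD f1 σ.form : DForm M 4) (by norm_num) x
      = hodgeStar (σ.inducingMap x) (k := 4) (l := 3) (by norm_num)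
          (wedge (σ.components θ x).2.1 (σ.form x)) := by
    intro x
    rw [σ.components_eq (hdec x)]
    rfl
  have hγ : σ.star 4 (σ.star 3 (wedgeD f1 σ.form : DForm M 4)) = (wedgeD f1 σ.form : DForm M 4) :=
    σ.star_star _ _ _
  have hα : σ.star 4 (fun x => f0 x • σ.form x : DForm M 3) = fun x => f0 x • ψ x := by
    rw [star_fun_smul, hψ]
  refine σ.star_eq_linear (funext fun x => ?_) hα hγ rfl
  have h0 : (σ.components θ x).1 = f0 x := by rw [σ.components_eq (hdec x)]
  have hd : σ.IsDecompositionAt x (θ x) (σ.components θ x).1 (σ.components θ x).2.1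
      (σ.components θ x).2.2 := by
    rw [σ.components_eq (hdec x)]
    exact hdec x
  refine (smul_add_sub_eq hd.1 (hT x)).trans ?_
  generalize σ.star 3 (wedgeD f1 σ.form : DForm M 4) (by norm_num) = T
  rw [h0]
  rfl

theorem star_extD_star_form : σ.star 2 (extD (σ.star 4 σ.form)) = (-1 : ℝ) • σ.tau := by
  have h := σ.tau_eq
  generalize σ.star 2 (extD (σ.star 4 σ.form)) = X at h ⊢
  rw [h]
  module

theorem d77Hat_eq (α : DForm M 1) :
    σ.d77Hat α = σ.star 1 (wedgeD (extD α) (σ.star 4 σ.form))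
      - σ.star 1 (wedgeD α (σ.star 5 σ.tau)) :=
  σ.star_eq_sub_of_eq_sub rfl rfl rfl

theorem star_wedgeD_d77Hat (α : DForm M 1) :
    σ.star 2 (wedgeD (σ.d77Hat α) (σ.star 4 σ.form)) = σ.xi (extD α)
      - σ.star 2 (wedgeD (σ.star 1 (wedgeD α (σ.star 5 σ.tau))) (σ.star 4 σ.form)) :=
  σ.star_wedgeD_eq_sub (σ.d77Hat_eq α) (σ.star_wedgeD_star_wedgeD_dual _) rfl

theorem xi_star_wedgeD (α : DForm M 1) : σ.xi (σ.star 2 (wedgeD (σ.star 4 σ.form) α))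
    = (3 : ℝ) • σ.star 2 (wedgeD α (σ.star 4 σ.form)) := by
  rw [star_wedgeD_dual_comm, xi_star_wedgeD_dual]

end Pointwise

/-! ### Leibniz rules for H and d⁷₇ -/

section Global

variable {M : Type*} [TopologicalSpace M] [ChartedSpace E7 M]
  [IsManifold (𝓡 7) ((⊤ : ℕ∞) : WithTop ℕ∞) M] (σ : G2Structure M)

theorem star_extD_fun_smul {f : M → ℝ} {ω : DForm M 4} {γ : DForm M 2} (hf : IsClassFun 1 f)
    (hω : IsClass 1 ω) (hγ : σ.star 2 (extD ω) = (-1 : ℝ) • γ) :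
    σ.star 2 (extD (fun x => f x • ω x : DForm M 4))
      = σ.star 2 (wedgeD (dFun f) ω) - (fun x => f x • γ x : DForm M 2) := by
  have h1 : σ.star 2 (fun x => f x • extD ω x : DForm M 5)
      = (-1 : ℝ) • (fun x => f x • γ x : DForm M 2) := by
    refine (σ.star_fun_smul _ f (extD ω)).trans ?_
    rw [hγ]
    funext x
    exact smul_comm (f x) (-1 : ℝ) (γ x)
  generalize (fun x => f x • γ x : DForm M 2) = ζ at h1
  rw [extD_fun_smul hf hω]
  refine (σ.star_add _ _ _).trans ?_
  refine (congrArg₂ (fun a b : DForm M 2 => a + b) rfl h1).trans ?_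
  module

/-- Closedness of σ enters here: it kills the term α∧dσ. -/
theorem star_extD_wedgeD {α : DForm M 1} (hα : IsClass 1 α) (hσ : IsClass 1 σ.form)
    (hd : extD σ.form = 0) :
    σ.star 2 (extD (wedgeD α σ.form : DForm M 4)) = σ.star 2 (wedgeD σ.form (extD α)) := by
  have h1 : wedgeD α (0 : DForm M (3 + 1)) = 0 := funext fun x => by
    have := wedge_smul_right (α x) (0 : ℝ) (0 : TangentSpace (𝓡 7) x [⋀^Fin (3 + 1)]→L[ℝ] ℝ)
    rwa [zero_smul, zero_smul] at this
  rw [extD_wedgeD_three hα hσ, hd, h1, ← star_wedgeD_two_comm]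
  exact congrArg (fun ω : DForm M 5 => σ.star 2 ω) (sub_zero _)

theorem isClass_tau {n : ℕ∞} (hσ : IsClass (n + 1) σ.form) : IsClass n σ.tau := by
  rw [tau_eq]
  have hσ' := hσ.of_le (le_self_add : n ≤ n + 1)
  exact (σ.isClass_star _ hσ' (σ.isClass_star _ hσ hσ).extD).const_smul _

theorem extD_linear {k : ℕ} {α β γ : DForm M k} (hα : IsClass 1 α)
    (hβ : IsClass 1 β) (hγ : IsClass 1 γ) (a b : ℝ) :
    extD (a • α + b • β - γ) = a • extD α + b • extD β - extD γ := by
  have h1 : extD (a • α + b • β - γ) = extD (a • α + b • β) - extD γ :=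
    extD_sub ((hα.const_smul a).add (hβ.const_smul b)) hγ
  have h2 : extD (a • α + b • β) = a • extD α + b • extD β := by
    rw [extD_add (hα.const_smul a) (hβ.const_smul b), extD_smul, extD_smul]
  rw [h1, h2]

theorem star_extD_eq_linear {k l : ℕ} {h : k + 1 + l = 7} {α β γ : DForm M k}
    {α' β' γ' : DForm M l} {a b : ℝ} (hα : IsClass 1 α) (hβ : IsClass 1 β) (hγ : IsClass 1 γ)
    (eα : σ.star l (extD α) h = α') (eβ : σ.star l (extD β) h = β')
    (eγ : σ.star l (extD γ) h = γ') :
    σ.star l (extD (a • α + b • β - γ)) h = a • α' + b • β' - γ' := by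
  rw [extD_linear hα hβ hγ, star_linear, eα, eβ, eγ]

theorem opH_eq_sub {θ : DForm M 3} {f0 : M → ℝ} {f1 : DForm M 1} {f3 : DForm M 3}
    {ψ : DForm M 4} (hσ : IsClass 1 σ.form) (hdσ : extD σ.form = 0) (hθ : IsClass 1 θ)
    (hf0 : IsClassFun 1 f0) (hf1 : IsClass 1 f1)
    (hdec : ∀ x : M, σ.IsDecompositionAt x (θ x) (f0 x) (f1 x) (f3 x))
    (hψ : σ.star 4 σ.form = ψ) :
    σ.opH θ = (7 / 3 : ℝ) • (σ.star 2 (wedgeD (dFun f0) ψ)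
        - (fun x => f0 x • σ.tau x : DForm M 2))
      + (2 : ℝ) • σ.star 2 (wedgeD σ.form (extD f1)) - σ.star 2 (extD (σ.star 4 θ)) := by
  have hψ1 : IsClass 1 ψ := by
    rw [← hψ]
    exact σ.isClass_star _ hσ hσ
  have h1 : IsClass 1 (wedgeD f1 σ.form) :=
    IsClass.wedge (k := 6) (l := 4) (m := 3) (by norm_num) (by norm_num) (by norm_num) hf1 hσ
  have hτ : σ.star 2 (extD ψ) = (-1 : ℝ) • σ.tau := by
    rw [← hψ]
    exact σ.star_extD_star_form
  rw [σ.opH_eq hdec hψ]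
  exact σ.star_extD_eq_linear (hψ1.fun_smul hf0) h1 (σ.isClass_star _ hσ hθ)
    (σ.star_extD_fun_smul hf0 hψ1 hτ) (σ.star_extD_wedgeD hf1 hσ hdσ) rfl

theorem star_extD_wedgeD_four {α : DForm M 1} {ψ : DForm M 4} {ζ η : DForm M 1}
    (hα : IsClass 1 α) (hψ : IsClass 1 ψ) (hζ : σ.star (k := 6) 1 (wedgeD (extD α) ψ) = ζ)
    (hη : σ.star (k := 6) 1 (wedgeD α (extD ψ)) = (-1 : ℝ) • η) :
    σ.star (k := 6) 1 (extD (wedgeD α ψ)) = ζ + η :=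
  σ.star_eq_add_of_eq_sub (k := 6) (extD_wedgeD_four hα hψ) hζ hη

/-- In the Leibniz rule -α∧d*σ becomes +α∧*τ. The opposite sign in `d77Hat_eq` is the whole
difference between the two versions of the theorem. -/
theorem d77_eq {α : DForm M 1} (hα : IsClass 1 α) (hσ : IsClass 1 σ.form) :
    σ.d77 α = σ.star 1 (wedgeD (extD α) (σ.star 4 σ.form))
      + σ.star 1 (wedgeD α (σ.star 5 σ.tau)) :=
  σ.star_extD_wedgeD_four hα (σ.isClass_star _ hσ hσ) rfl
    (σ.star_wedgeD_eq_smul σ.extD_star_form rfl)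

theorem star_wedgeD_d77 {α : DForm M 1} (hα : IsClass 1 α) (hσ : IsClass 1 σ.form) :
    σ.star 2 (wedgeD (σ.d77 α) (σ.star 4 σ.form)) = σ.xi (extD α)
      + σ.star 2 (wedgeD (σ.star 1 (wedgeD α (σ.star 5 σ.tau))) (σ.star 4 σ.form)) :=
  σ.star_wedgeD_eq_add (σ.d77_eq hα hσ) (σ.star_wedgeD_star_wedgeD_dual _) rfl

theorem isClass_xi {n : ℕ∞} {γ : DForm M 2} (hσ : IsClass n σ.form) (hγ : IsClass n γ) :
    IsClass n (σ.xi γ) :=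
  hγ.add (σ.isClass_star _ hσ (IsClass.wedge (k := 4) (l := 5) (m := 2) (by norm_num)
    (by norm_num) (by norm_num) hσ hγ))

theorem isClass_star_wedgeD_dual {n : ℕ∞} {α : DForm M 1} (hσ : IsClass n σ.form)
    (hα : IsClass n α) : IsClass n (σ.star 2 (wedgeD α (σ.star 4 σ.form))) :=
  σ.isClass_star _ hσ (IsClass.wedge (k := 6) (l := 3) (m := 2) (by norm_num)
    (by norm_num) (by norm_num) hα (σ.isClass_star _ hσ hσ))

theorem isClass_star_wedgeD_star_tau {n : ℕ∞} {α : DForm M 1} (hσ : IsClass (n + 1) σ.form)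
    (hα : IsClass n α) : IsClass n (σ.star 1 (wedgeD α (σ.star 5 σ.tau))) :=
  have hσ' := hσ.of_le (le_self_add : n ≤ n + 1)
  σ.isClass_star _ hσ' (IsClass.wedge (k := 6) (l := 2) (m := 1) (by norm_num)
    (by norm_num) (by norm_num) hα (σ.isClass_star _ hσ' (σ.isClass_tau hσ)))

theorem isClass_star_wedgeD_extD {n : ℕ∞} {α : DForm M 1} (hσ : IsClass n σ.form)
    (hα : IsClass (n + 1) α) : IsClass n (σ.star 1 (wedgeD (extD α) (σ.star 4 σ.form))) :=
  σ.isClass_star _ hσ (IsClass.wedge (k := 5) (l := 3) (m := 1) (by norm_num)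
    (by norm_num) (by norm_num) hα.extD (σ.isClass_star _ hσ hσ))

end Global

end G2Structure

/-! ### Linear combination of the identities -/

theorem add_eq_of_eq_add {W : Type*} [AddCommGroup W] [Module ℝ W]
    {q p c g y s z x u t d q' p' c' g' y' s' z' x' u' t' d' : W}
    (h : q = (7 / 3 : ℝ) • (c - g) + (2 : ℝ) • y - p) (hs : s = z + u) (hz : z' = d + y')
    (hx : x = (3 : ℝ) • u') (ht : t = (7 / 3 : ℝ) • g') (eq : q = q') (ep : p = p') (ec : c = c')
    (eg : g = g') (ey : y = y') (es : s = s') (ez : z = z') (ex : x = x') (eu : u = u')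
    (et : t = t') (ed : d = d') :
    q' + p' = (7 / 3 : ℝ) • c' + (2 : ℝ) • s' - (2 : ℝ) • d' - (2 / 3 : ℝ) • x' - t' := by
  subst ez ey ed eu eg ec ep eq et ex es
  rw [h, hs, hz, hx, ht]
  module

theorem add_eq_of_eq_sub {W : Type*} [AddCommGroup W] [Module ℝ W]
    {q p c g y s z x u t d q' p' c' g' y' s' z' x' u' t' d' : W}
    (h : q = (7 / 3 : ℝ) • (c - g) + (2 : ℝ) • y - p) (hs : s = z - u) (hz : z' = d + y')
    (hx : x = (3 : ℝ) • u') (ht : t = (7 / 3 : ℝ) • g') (eq : q = q') (ep : p = p') (ec : c = c')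
    (eg : g = g') (ey : y = y') (es : s = s') (ez : z = z') (ex : x = x') (eu : u = u')
    (et : t = t') (ed : d = d') :
    q' + p' = (7 / 3 : ℝ) • c' + (2 : ℝ) • s' - (2 : ℝ) • d' + (2 / 3 : ℝ) • x' - t' := by
  subst ez ey ed eu eg ec ep eq et ex es
  rw [h, hs, hz, hx, ht]
  -- With s = d + y + u and x = 3u, the combination 2s - 2d - (2/3)x is 2y; this fixes the
  -- coefficient 2/3.
  module

theorem sub_sub_eq_sub_add {W : Type*} [AddCommGroup W] {a y d x t : W}
    (h : a = y - d - x - t) : a = y - d - (t + x) := by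
  rw [h]
  abel

theorem sub_add_eq_sub_sub' {W : Type*} [AddCommGroup W] {a y d x t : W}
    (h : a = y - d + x - t) : a = y - d - (t - x) := by
  rw [h]
  abel

theorem DForm.mul_smul {M : Type*} [TopologicalSpace M] [ChartedSpace E7 M] {k : ℕ} (c : ℝ)
    (f : M → ℝ) (ω : DForm M k) :
    (fun x => (c * f x) • ω x : DForm M k) = c • (fun x => f x • ω x : DForm M k) :=
  funext fun _ => SemigroupAction.mul_smul _ _ _

theorem IsClass.of_eq_sub {M : Type*} [TopologicalSpace M] [ChartedSpace E7 M]
    [IsManifold (𝓡 7) ((⊤ : ℕ∞) : WithTop ℕ∞) M] {n : ℕ∞} {k : ℕ} {α β γ : DForm M k}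
    (hα : IsClass n α) (hγ : IsClass n γ) (h : α = β - γ) : IsClass n β := by
  rw [eq_add_of_sub_eq h.symm]
  exact hα.add hγ

/-! ### Regularity of all terms and the Laplacian -/

namespace G2Structure

variable {M : Type*} [TopologicalSpace M] [ChartedSpace E7 M] (σ : G2Structure M)

theorem xi_eq_add {γ δ : DForm M 2} (h : ∀ p, σ.star 2 (wedgeD σ.form γ) p = δ)
    (η : DForm M 2) (hη : η = γ) : σ.xi γ = η + δ := by
  rw [xi, h, hη]

theorem star_zero {k l : ℕ} (h : k + l = 7) : σ.star l (0 : DForm M k) h = 0 := by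
  have := σ.star_smul h (0 : ℝ) (0 : DForm M k)
  rwa [zero_smul, zero_smul] at this

theorem _root_.G2.DForm.add_eq_of_eq_add {q p c g y s z x u t q' p' c' g' y' s' z' x' u' t' : DForm M 2}
    {d : DForm M (1 + 1)}
    (h : q = (7 / 3 : ℝ) • (c - g) + (2 : ℝ) • y - p) (hs : s = z + u)
    (hz : ∀ d' : DForm M 2, d' = d → z' = d' + y') (hx : x = (3 : ℝ) • u')
    (ht : t = (7 / 3 : ℝ) • g') (eq : q = q') (ep : p = p') (ec : c = c') (eg : g = g')
    (ey : y = y') (es : s = s') (ez : z = z') (ex : x = x') (eu : u = u') (et : t = t') :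
    q' + p' = (7 / 3 : ℝ) • c' + (2 : ℝ) • s' - (2 : ℝ) • d - (2 / 3 : ℝ) • x' - t' :=
  _root_.G2.add_eq_of_eq_add (W := DForm M 2) h hs (hz d rfl) hx ht eq ep ec eg ey es ez ex eu et rfl

theorem _root_.G2.DForm.add_eq_of_eq_sub {q p c g y s z x u t q' p' c' g' y' s' z' x' u' t' : DForm M 2}
    {d : DForm M (1 + 1)}
    (h : q = (7 / 3 : ℝ) • (c - g) + (2 : ℝ) • y - p) (hs : s = z - u)
    (hz : ∀ d' : DForm M 2, d' = d → z' = d' + y') (hx : x = (3 : ℝ) • u')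
    (ht : t = (7 / 3 : ℝ) • g') (eq : q = q') (ep : p = p') (ec : c = c') (eg : g = g')
    (ey : y = y') (es : s = s') (ez : z = z') (ex : x = x') (eu : u = u') (et : t = t') :
    q' + p' = (7 / 3 : ℝ) • c' + (2 : ℝ) • s' - (2 : ℝ) • d + (2 / 3 : ℝ) • x' - t' :=
  _root_.G2.add_eq_of_eq_sub (W := DForm M 2) h hs (hz d rfl) hx ht eq ep ec eg ey es ez ex eu et rfl

variable [IsManifold (𝓡 7) ((⊤ : ℕ∞) : WithTop ℕ∞) M] {n : ℕ∞} {θ : DForm M 3} {f0 : M → ℝ}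
  {f1 : DForm M 1} {f3 : DForm M 3}

theorem isClassFun_scalar (hσ : IsClass n σ.form) (hθ : IsClass n θ)
    (hdec : ∀ x : M, σ.IsDecompositionAt x (θ x) (f0 x) (f1 x) (f3 x)) : IsClassFun n f0 := by
  rw [σ.scalar_eq hdec]
  have h : IsClass n (σ.star (k := 7) 0 (wedgeD θ (σ.star 4 σ.form)) (by norm_num)) :=
    σ.isClass_star _ hσ (IsClass.wedge (k := 4) (l := 3) (m := 0) (by norm_num) (by norm_num)
      (by norm_num) hθ (σ.isClass_star _ hσ hσ))
  exact fun x₀ => contDiffOn_const.mul (h.isClassFun x₀)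

theorem isClass_covector (hσ : IsClass n σ.form) (hθ : IsClass n θ)
    (hdec : ∀ x : M, σ.IsDecompositionAt x (θ x) (f0 x) (f1 x) (f3 x)) : IsClass n f1 := by
  rw [σ.covector_eq hdec]
  refine IsClass.const_smul _ ?_
  exact σ.isClass_star _ hσ (IsClass.wedge (k := 4) (l := 4) (m := 1) (by norm_num) (by norm_num)
    (by norm_num) hθ hσ)

theorem isClass_opH (hσ : IsClass (n + 1) σ.form) (hθ : IsClass (n + 1) θ)
    (hdec : ∀ x : M, σ.IsDecompositionAt x (θ x) (f0 x) (f1 x) (f3 x)) : IsClass n (σ.opH θ) := by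
  rw [σ.opH_eq hdec rfl]
  refine σ.isClass_star _ (hσ.of_le le_self_add) (IsClass.extD ?_)
  have h1 : IsClass (n + 1) (wedgeD f1 σ.form) :=
    IsClass.wedge (k := 6) (l := 4) (m := 3) (by norm_num) (by norm_num) (by norm_num)
      (σ.isClass_covector hσ hθ hdec) hσ
  refine IsClass.sub (IsClass.add (IsClass.const_smul _ ?_) (IsClass.const_smul _ ?_)) ?_
  · exact IsClass.fun_smul (σ.isClassFun_scalar hσ hθ hdec) (σ.isClass_star _ hσ hσ)
  · exact h1
  · exact σ.isClass_star _ hσ hθ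

theorem isClass_sharpContract (hσ : IsClass n σ.form) {α : DForm M 1} (hα : IsClass n α) :
    IsClass n (σ.sharpContract α) := by
  rw [sharpContract_eq]
  exact σ.isClass_star_wedgeD_dual hσ hα

/-- Read off from the Leibniz rule: the form equals *d(f⁰ψ) + f⁰τ, and both summands are of class n.
-/
theorem isClass_star_wedgeD_dFun {ψ : DForm M 4} (hσ : IsClass (n + 1) σ.form)
    (hψ : IsClass (n + 1) ψ) (hτ : σ.star 2 (extD ψ) = (-1 : ℝ) • σ.tau)
    (hf : IsClassFun (n + 1) f0) : IsClass n (σ.star 2 (wedgeD (dFun f0) ψ)) := by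
  have hA : IsClass n (σ.star 2 (extD (fun x => f0 x • ψ x : DForm M 4))) :=
    σ.isClass_star _ (hσ.of_le le_self_add) (hψ.fun_smul hf).extD
  refine hA.of_eq_sub ?_ (σ.star_extD_fun_smul (fun x => (hf x).of_le (by exact_mod_cast le_add_self))
    (hψ.of_le le_add_self) hτ)
  exact IsClass.fun_smul (fun x => (hf x).of_le (by exact_mod_cast le_self_add)) (σ.isClass_tau hσ)

theorem isClass_sharpContract_dFun (hσ : IsClass (n + 1) σ.form) (hf : IsClassFun (n + 1) f0) :
    IsClass n (σ.sharpContract (dFun f0)) := by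
  rw [sharpContract_eq]
  exact σ.isClass_star_wedgeD_dFun hσ (σ.isClass_star _ hσ hσ) σ.star_extD_star_form hf

theorem isClass_d77 {α : DForm M 1} (hσ : IsClass (n + 1) σ.form) (hα : IsClass (n + 1) α) :
    IsClass n (σ.d77 α) :=
  σ.isClass_star _ (hσ.of_le le_self_add) (IsClass.extD (IsClass.wedge (k := 6) (l := 3) (m := 2)
    (by norm_num) (by norm_num) (by norm_num) hα (σ.isClass_star _ hσ hσ)))

theorem isClass_d77Hat {α : DForm M 1} (hσ : IsClass (n + 1) σ.form) (hα : IsClass (n + 1) α) :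
    IsClass n (σ.d77Hat α) := by
  rw [d77Hat_eq]
  exact (σ.isClass_star_wedgeD_extD (hσ.of_le le_self_add) hα).sub
    (σ.isClass_star_wedgeD_star_tau hσ (hα.of_le le_self_add))

theorem codiff_zero {k l : ℕ} (h : k + 1 + l = 7) : σ.codiff l (0 : DForm M (k + 1)) h = 0 := by
  have h0 : extD (0 : DForm M l) = 0 := by
    have := extD_smul (0 : ℝ) (0 : DForm M l)
    rwa [zero_smul, zero_smul] at this
  rw [codiff, star_zero, h0, star_zero, smul_zero]

/-- For closed θ only dd*θ = -d(*d*θ) survives. The identity for q + p is solved for -p, and the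
term 2d drops out because d is closed. The class-one hypotheses allow the exterior derivative to be
distributed. -/
theorem laplacian_eq {p q y d t : DForm M 2} (hθ : extD θ = 0)
    (hp : σ.star 2 (extD (σ.star 4 θ)) = p) (h : q + p = y - (2 : ℝ) • d - t) (hd : extD d = 0)
    (hq : IsClass 1 q) (hy : IsClass 1 y) (ht : IsClass 1 t) (hdc : IsClass 1 d) :
    σ.laplacian θ = extD q - extD y + extD t := by
  have h1 : σ.codiff (k := 2) 4 θ (by norm_num) = (1 : ℝ) • q + (1 : ℝ) • t
      - (y - (2 : ℝ) • d) := by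
    rw [σ.codiff_eq_neg θ (by norm_num) hp, eq_sub_of_add_eq' h]
    module
  have h2 : σ.codiff (k := 3) 3 (extD θ) (by norm_num) = 0 := by
    rw [hθ]
    exact σ.codiff_zero _
  rw [laplacian, h1, h2, extD_linear hq ht (hy.sub (hdc.const_smul 2)), extD_sub hy
    (hdc.const_smul 2), extD_smul, hd]
  module

theorem laplacian_eq_add {p q a b x t : DForm M 2} {d : DForm M (1 + 1)} (hθ : extD θ = 0)
    (hp : σ.star 2 (extD (σ.star 4 θ)) = p)
    (h : q + p = (7 / 3 : ℝ) • a + (2 : ℝ) • b - (2 : ℝ) • d - (2 / 3 : ℝ) • x - t)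
    (hd : extD d = 0) (hq : IsClass 1 q) (ha : IsClass 1 a) (hb : IsClass 1 b) (hx : IsClass 1 x)
    (ht : IsClass 1 t) (hdc : IsClass 1 d) :
    σ.laplacian θ = extD q - extD ((7 / 3 : ℝ) • a + (2 : ℝ) • b)
      + extD (t + (2 / 3 : ℝ) • x) :=
  σ.laplacian_eq (d := d) hθ hp (sub_sub_eq_sub_add h) hd hq ((ha.const_smul _).add (hb.const_smul _))
    (ht.add (hx.const_smul _)) hdc

theorem laplacian_eq_sub {p q a b x t : DForm M 2} {d : DForm M (1 + 1)} (hθ : extD θ = 0)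
    (hp : σ.star 2 (extD (σ.star 4 θ)) = p)
    (h : q + p = (7 / 3 : ℝ) • a + (2 : ℝ) • b - (2 : ℝ) • d + (2 / 3 : ℝ) • x - t)
    (hd : extD d = 0) (hq : IsClass 1 q) (ha : IsClass 1 a) (hb : IsClass 1 b) (hx : IsClass 1 x)
    (ht : IsClass 1 t) (hdc : IsClass 1 d) :
    σ.laplacian θ = extD q - extD ((7 / 3 : ℝ) • a + (2 : ℝ) • b)
      + extD (t - (2 / 3 : ℝ) • x) :=
  σ.laplacian_eq (d := d) hθ hp (sub_add_eq_sub_sub' h) hd hq ((ha.const_smul _).add (hb.const_smul _))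
    (ht.sub (hx.const_smul _)) hdc

end G2Structure

end G2

end

/-! ### The six identities -/

open scoped Manifold in
open G2 in
theorem mainTheorem11 {M : Type*} [TopologicalSpace M] [ChartedSpace E7 M]
    [IsManifold (𝓡 7) ((⊤ : ℕ∞) : WithTop ℕ∞) M]
    (σ : G2Structure M) (hσ : IsClass 2 σ.form) (hdσ : extD σ.form = 0)
    (θ : DForm M 3) (hθ : IsClass 2 θ) (hdθ : extD θ = 0)
    (f0 : M → ℝ) (f1 : DForm M 1) (f3 : DForm M 3)
    (hdec : ∀ x : M, σ.IsDecompositionAt x (θ x) (f0 x) (f1 x) (f3 x)) :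
    -- the identities for `d⁷₇ α = * d (α ∧ *σ)`
    (σ.opH θ + σ.star 2 (extD (σ.star 4 θ))
        = (7 / 3 : ℝ) • σ.star 2 (wedgeD (dFun f0) (σ.star 4 σ.form))
          + (2 : ℝ) • σ.star 2 (wedgeD (σ.d77 f1) (σ.star 4 σ.form))
          - (2 : ℝ) • extD f1
          - (2 / 3 : ℝ) • σ.xi (σ.star 2 (wedgeD (σ.star 4 σ.form)
              (σ.star 1 (wedgeD f1 (σ.star 5 σ.tau)))))
          - (fun x => ((7 / 3 : ℝ) * f0 x) • σ.tau x : DForm M 2))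
    ∧ (σ.opH θ + σ.star 2 (extD (σ.star 4 θ))
        = (7 / 3 : ℝ) • σ.sharpContract (dFun f0)
          + (2 : ℝ) • σ.sharpContract (σ.d77 f1)
          - (2 : ℝ) • extD f1
          - (2 / 3 : ℝ) • σ.xi (σ.star 2 (wedgeD (σ.star 4 σ.form)
              (σ.star 1 (wedgeD f1 (σ.star 5 σ.tau)))))
          - (fun x => ((7 / 3 : ℝ) * f0 x) • σ.tau x : DForm M 2))
    ∧ (σ.laplacian θ
        = extD (σ.opH θ)
          - extD ((7 / 3 : ℝ) • σ.sharpContract (dFun f0)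
              + (2 : ℝ) • σ.sharpContract (σ.d77 f1))
          + extD ((fun x => ((7 / 3 : ℝ) * f0 x) • σ.tau x : DForm M 2)
              + (2 / 3 : ℝ) • σ.xi (σ.star 2 (wedgeD (σ.star 4 σ.form)
                  (σ.star 1 (wedgeD f1 (σ.star 5 σ.tau)))))))
    -- the same identities for `d̂⁷₇ α = * (dα ∧ *σ - α ∧ *τ)`
    ∧ (σ.opH θ + σ.star 2 (extD (σ.star 4 θ))
        = (7 / 3 : ℝ) • σ.star 2 (wedgeD (dFun f0) (σ.star 4 σ.form))
          + (2 : ℝ) • σ.star 2 (wedgeD (σ.d77Hat f1) (σ.star 4 σ.form))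
          - (2 : ℝ) • extD f1
          + (2 / 3 : ℝ) • σ.xi (σ.star 2 (wedgeD (σ.star 4 σ.form)
              (σ.star 1 (wedgeD f1 (σ.star 5 σ.tau)))))
          - (fun x => ((7 / 3 : ℝ) * f0 x) • σ.tau x : DForm M 2))
    ∧ (σ.opH θ + σ.star 2 (extD (σ.star 4 θ))
        = (7 / 3 : ℝ) • σ.sharpContract (dFun f0)
          + (2 : ℝ) • σ.sharpContract (σ.d77Hat f1)
          - (2 : ℝ) • extD f1
          + (2 / 3 : ℝ) • σ.xi (σ.star 2 (wedgeD (σ.star 4 σ.form)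
              (σ.star 1 (wedgeD f1 (σ.star 5 σ.tau)))))
          - (fun x => ((7 / 3 : ℝ) * f0 x) • σ.tau x : DForm M 2))
    ∧ (σ.laplacian θ
        = extD (σ.opH θ)
          - extD ((7 / 3 : ℝ) • σ.sharpContract (dFun f0)
              + (2 : ℝ) • σ.sharpContract (σ.d77Hat f1))
          + extD ((fun x => ((7 / 3 : ℝ) * f0 x) • σ.tau x : DForm M 2)
              - (2 / 3 : ℝ) • σ.xi (σ.star 2 (wedgeD (σ.star 4 σ.form)
                  (σ.star 1 (wedgeD f1 (σ.star 5 σ.tau))))))) := by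
  have hσ1 := hσ.of_le one_le_two
  -- Class 2 is written as 1 + 1 for the lemmas that lose one derivative: class 1 must remain before
  -- the last d.
  have hσ2 : IsClass (1 + 1) σ.form := by rwa [one_add_one_eq_two]
  have hθ2 : IsClass (1 + 1) θ := by rwa [one_add_one_eq_two]
  have hf0 := σ.isClassFun_scalar hσ2 hθ2 hdec
  have hf0' : IsClassFun 1 f0 := σ.isClassFun_scalar hσ1 (hθ.of_le one_le_two) hdec
  have hf1 := σ.isClass_covector hσ2 hθ2 hdec
  have hf1' := hf1.of_le le_add_self
  have hQ := σ.opH_eq_sub hσ1 hdσ (hθ.of_le one_le_two) hf0' hf1' hdec rfl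
  have hτ : IsClass 1 (fun x => ((7 / 3 : ℝ) * f0 x) • σ.tau x : DForm M 2) :=
    IsClass.fun_smul (fun x => contDiffOn_const.mul (hf0' x)) (σ.isClass_tau hσ2)
  have hX := (σ.isClass_xi hσ1 (by
    rw [G2Structure.star_wedgeD_dual_comm]
    exact σ.isClass_star_wedgeD_dual hσ1 (σ.isClass_star_wedgeD_star_tau hσ2 hf1')) :
      IsClass 1 (σ.xi (σ.star 2 (wedgeD (σ.star 4 σ.form)
              (σ.star 1 (wedgeD f1 (σ.star 5 σ.tau)))))))
  -- This removes -2df¹ from the Laplacian formulas; it needs f¹ of class 2, which comes from σ and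
  -- θ being so.
  have hdd : extD (extD f1) = 0 := extD_extD (by rwa [← one_add_one_eq_two])
  have hd := σ.isClass_sharpContract_dFun hσ2 hf0
  have hq := σ.isClass_opH hσ2 hθ2 hdec
  have e1 := σ.star_wedgeD_d77 hf1' hσ1
  have e2 := σ.star_wedgeD_d77Hat f1
  have e3 := σ.xi_star_wedgeD (σ.star 1 (wedgeD f1 (σ.star 5 σ.tau)))
  have e4 := DForm.mul_smul (7 / 3 : ℝ) f0 σ.tau
  refine ⟨?_, ?_, ?_, ?_, ?_, ?_⟩
  · exact DForm.add_eq_of_eq_add hQ e1 (σ.xi_eq_add fun _ => rfl) e3 e4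
      rfl rfl rfl rfl rfl rfl rfl rfl rfl rfl
  · exact DForm.add_eq_of_eq_add hQ e1 (σ.xi_eq_add fun _ => rfl) e3 e4 rfl rfl
      (σ.sharpContract_eq _).symm rfl rfl (σ.sharpContract_eq _).symm rfl rfl rfl rfl
  · exact σ.laplacian_eq_add hdθ rfl (DForm.add_eq_of_eq_add hQ e1 (σ.xi_eq_add fun _ => rfl) e3 e4
      rfl rfl (σ.sharpContract_eq _).symm rfl rfl (σ.sharpContract_eq _).symm rfl rfl rfl rfl)
      hdd hq hd (σ.isClass_sharpContract hσ1 (σ.isClass_d77 hσ2 hf1)) hX hτ hf1.extD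
  · exact DForm.add_eq_of_eq_sub hQ e2 (σ.xi_eq_add fun _ => rfl) e3 e4
      rfl rfl rfl rfl rfl rfl rfl rfl rfl rfl
  · exact DForm.add_eq_of_eq_sub hQ e2 (σ.xi_eq_add fun _ => rfl) e3 e4 rfl rfl
      (σ.sharpContract_eq _).symm rfl rfl (σ.sharpContract_eq _).symm rfl rfl rfl rfl
  · exact σ.laplacian_eq_sub hdθ rfl (DForm.add_eq_of_eq_sub hQ e2 (σ.xi_eq_add fun _ => rfl) e3 e4
      rfl rfl (σ.sharpContract_eq _).symm rfl rfl (σ.sharpContract_eq _).symm rfl rfl rfl rfl)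
      hdd hq hd (σ.isClass_sharpContract hσ1 (σ.isClass_d77Hat hσ2 hf1)) hX hτ hf1.extD
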